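/- **Weighted timed games.** Let $X$ be a finite non-empty set of clocks and $M\ge 1$ an integer. A weighted timed game (WTG) $\mathcal G$ over $X$ has finitely many locations $L=L_{\mathrm{Min}}\uplus L_{\mathrm{Max}}$, target locations $L_T\subseteq L_{\mathrm{Min}}$, finitely many edges $e=(\ell,g,Y,\ell')$ ($g$ a finite conjunction of constraints $x\bowtie c$ with ${\bowtie}\in\{<,\le,>,\ge\}$, $c\in\mathbb Z$, $|c|\le M$; $Y\subseteq X$ the clocks to reset), integer weights on locations and edges, and final weights $\mathrm{wt}_T(\ell,\cdot):[0,M)^X\to\mathbb R\cup\{\pm\infty\}$, $\ell\in L_T$, that are piecewise affine (finitely many polyhedral pieces, rational coefficients) and continuous on regions. A configuration is $(\ell,\nu)$ with $\nu\in[0,M)^X$; there is a transition $(\ell,\nu)\xrightarrow{d,e}(\ell',(\nu+d)[Y:=0])$ of weight $d\cdot\mathrm{wt}(\ell)+\mathrm{wt}(e)$ if $d\ge0$, $\nu+d\in[0,M)^X$ and $\nu+d\models g$. No edge leaves $L_T$, and every configuration outside $L_T$ has a transition. The owner of the current location chooses the next transition, strategies depending on the whole finite play; a play reaching a target configuration has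 as weight its cumulative weight plus the final weight, an infinite play has weight $+\infty$; Min minimises and Max maximises. A configuration has value $v$ if $\sup_{\sigma_{\mathrm{Max}}}\inf_{\sigma_{\mathrm{Min}}}$ and $\inf_{\sigma_{\mathrm{Min}}}\sup_{\sigma_{\mathrm{Max}}}$ of the weight of the outcome are both equal to $v$. **Region game.** Regions are the usual classes of $[0,M)^X$ (same integral parts, same clocks with zero fractional part, same order of fractional parts). The region game $\mathcal R(\mathcal G)$ is the game whose locations are the region states $(\ell,r)$ and whose edges are the transitions $(\ell,r)\xrightarrow{r'',e}(\ell',r')$, where $e=(\ell,g,Y,\ell')$, $r''$ is a time-successor of $r$ satisfying $g$, and $r'=r''[Y:=0]$; such an edge has guard $r''$, and everything else is inherited from $\mathcal G$. Let $|\mathcal R|$ be its number of region states, $W=M\max_\ell|\mathrm{wt}(\ell)|+\max_e|\mathrm{wt}(e)|$ and $W_T=\sup|\mathrm{wt}_T|$ over target configurations. $\mathcal G$ is *almost-divergent* if every finite play following a cycle $\rho$ of $\mathcal R(\mathcal G)$ has cumulative weight in $(-\infty,-1]\cup\{0\}\cup[1,+\infty)$ and, whenever this weight is $0$, for every decomposition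 $\rho=\rho_1\rho_2\rho_3$ of the cycle into two smaller cycles $\rho_2$ and $\rho_3\rho_1$, all plays following $\rho_2$ or $\rho_3\rho_1$ have cumulative weight $0$. A strongly connected component (SCC) of $\mathcal R(\mathcal G)$ is *non-negative* if all plays following its cycles have weight $0$ or at least $1$ (*non-positive*: $0$ or at most $-1$). The *kernel* $\mathsf K$ is the subgraph of the edges of $\mathcal R(\mathcal G)$ that lie on a simple cycle all of whose plays have weight $0$, together with the states they cover. For a state $s\in\mathsf K$, $\mathsf K_s$ is the part of $\mathsf K$ accessible from $s$, and the output edges of $s$ are the edges outside $\mathsf K$ starting in $\mathsf K_s$; for $s\notin\mathsf K$, they are all the edges starting in $s$. **Semi-unfolding.** Let $s_0=(\ell_0,r_0)$ be a region state. Let $T$ be the tree with root labelled $s_0$, in which each non-leaf node labelled $s$ has, for every output edge of $s$, one child labelled by the end of that edge; a node labelled $s\in\mathsf K$ stands for $\mathsf K_s$. A node is a leaf when its label has its location in $L_T$ (target leaf), or when the branch from the root to it contains at least $\gamma=3|\mathcal R|W+2W_T+2$ nodes with the same label (stopped leaf). The semi-unfolding $\mathcal T(\mathcal G)$ is the WTG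 obtained from $T$ by replacing each non-leaf node labelled $s\in\mathsf K$ by a copy of $\mathsf K_s$ and each other node labelled $s$ by a copy of $s$, with copies of the output edges leading to the copies of their ends in the corresponding children; owners, weights, guards and resets are inherited. Its target locations are the leaves; final weights are inherited on target leaves and, on a stopped leaf labelled $s$, constantly $+\infty$ if the SCC of $s$ is non-negative and $-\infty$ otherwise (then it is non-positive). Let $\tilde s_0$ be the copy of $s_0$ in the root. **Proposition.** Let $\mathcal G$ be an almost-divergent WTG in which no configuration has value $+\infty$ or $-\infty$, and let $s_0=(\ell_0,r_0)$ be a region state. Then $\mathcal T(\mathcal G)$ is finite (finitely many locations and edges), every branch of $T$ has at most $|\mathcal R|\,\gamma$ edges, and for all $\nu_0\in r_0$ the configurations $(\ell_0,\nu_0)$ of $\mathcal G$ and $(\tilde s_0,\nu_0)$ of $\mathcal T(\mathcal G)$ both have a value, which is finite and the same: $$\mathrm{Val}_{\mathcal G}(\ell_0,\nu_0)=\mathrm{Val}_{\mathcal T(\mathcal G)}(\tilde s_0,\nu_0)\in\mathbb R.$$ -/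

import Mathlib

universe u

open Classical

noncomputable section

/-! ### Clocks, regions, guards, piecewise affine functions -/

/-- The valuations of the clocks that lie in `[0, M)^X`. -/
def BoundedVal {X : Type u} (M : ℕ) (ν : X → ℝ) : Prop :=
  ∀ x, 0 ≤ ν x ∧ ν x < M

/-- Time elapse of delay `d`. -/
def elapse {X : Type u} (ν : X → ℝ) (d : ℝ) : X → ℝ := fun x => ν x + d

/-- Reset of the clocks in `Y` to `0`. -/
def resetClocks {X : Type u} (Y : Set X) (ν : X → ℝ) : X → ℝ :=
  fun x => if x ∈ Y then 0 else ν x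

/-- The region (granularity `1`, clocks bounded by `M`) of the valuation `ν`: same integral parts,
same clocks with zero fractional part, same ordering of the fractional parts. -/
def regionOf {X : Type u} (M : ℕ) (ν : X → ℝ) : Set (X → ℝ) :=
  {ν' | BoundedVal M ν' ∧ (∀ x, ⌊ν' x⌋ = ⌊ν x⌋) ∧
    (∀ x, Int.fract (ν' x) = 0 ↔ Int.fract (ν x) = 0) ∧
    (∀ x y, Int.fract (ν' x) ≤ Int.fract (ν' y) ↔ Int.fract (ν x) ≤ Int.fract (ν y))}

/-- The finite set of regions partitioning `[0, M)^X`. -/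
def Region (X : Type u) (M : ℕ) : Type u :=
  {r : Set (X → ℝ) // ∃ ν, BoundedVal M ν ∧ r = regionOf M ν}

/-- Comparison operators of atomic constraints. -/
inductive Cmp
  | lt | le | gt | ge

/-- A non-diagonal atomic constraint `x ⋈ c` with an integer constant `c`. -/
structure AtomicConstraint (X : Type u) where
  clock : X
  cmp : Cmp
  const : ℤ

/-- Satisfaction of an atomic constraint. -/
def AtomicConstraint.Sat {X : Type u} (a : AtomicConstraint X) (ν : X → ℝ) : Prop :=
  match a.cmp with
  | .lt => ν a.clock < a.const
  | .le => ν a.clock ≤ a.const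
  | .gt => ν a.clock > a.const
  | .ge => ν a.clock ≥ a.const

/-- `Z` is the set of valuations satisfying some guard, that is, a finite conjunction of
non-diagonal atomic constraints, with integer constants of absolute value at most `M`. -/
def IsRectangularZone {X : Type u} (M : ℕ) (Z : Set (X → ℝ)) : Prop :=
  ∃ g : List (AtomicConstraint X), (∀ a ∈ g, |a.const| ≤ (M : ℤ)) ∧
    Z = {ν | ∀ a ∈ g, a.Sat ν}

/-- An affine expression `a₁ x₁ + ⋯ + aₙ xₙ + b` with rational coefficients. -/
structure AffineExpr (X : Type u) where
  coeff : X → ℚ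
  const : ℚ

/-- The value of an affine expression at a valuation. -/
def AffineExpr.eval {X : Type u} [Fintype X] (a : AffineExpr X) (ν : X → ℝ) : ℝ :=
  ∑ x, (a.coeff x : ℝ) * ν x + a.const

/-- What a partition function attaches to a base cell: an affine function or an infinite
constant. -/
inductive Piece (X : Type u)
  | affine (a : AffineExpr X)
  | top
  | bot

/-- The function described by a piece. -/
def Piece.eval {X : Type u} [Fintype X] : Piece X → (X → ℝ) → EReal
  | .affine a, ν => ((a.eval ν : ℝ) : EReal)
  | .top, _ => ⊤
  | .bot, _ => ⊥

/-- `f` is piecewise affine on `[0, M)^X`: finitely many affine equalities `E i = 0` partition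
the domain into base cells, given by the sign (`< 0`, `= 0` or `> 0`) of each `E i`, and `F`
describes `f` on each base cell. -/
def IsPiecewiseAffine {X : Type u} [Fintype X] (M : ℕ) (f : (X → ℝ) → EReal) : Prop :=
  ∃ (k : ℕ) (E : Fin k → AffineExpr X) (F : (Fin k → SignType) → Piece X),
    ∀ ν, BoundedVal M ν → f ν = (F fun i => SignType.sign ((E i).eval ν)).eval ν

/-- `f` is continuous on regions. -/
def ContinuousOnRegions {X : Type u} (M : ℕ) (f : (X → ℝ) → EReal) : Prop :=
  ∀ r : Region X M, ContinuousOn f r.1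

/-! ### Weighted timed games and their semantics -/

/-- The data of a (turn-based) weighted timed game over the clocks `X`, with clocks bounded by
`bound`. The guard of an edge is represented by the set of valuations that satisfy it.
Locations outside `minLoc` belong to player Max; `finalWeight` only matters on target locations.
The hypotheses made on games are gathered in `WTG.Admissible`. -/
structure WTG (X : Type u) where
  Loc : Type u
  Edge : Type u
  minLoc : Set Loc
  target : Set Loc
  src : Edge → Loc
  tgt : Edge → Loc
  guard : Edge → Set (X → ℝ)
  reset : Edge → Set X
  locWeight : Loc → ℤ
  edgeWeight : Edge → ℤ
  finalWeight : Loc → (X → ℝ) → EReal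
  bound : ℕ

namespace WTG

variable {X : Type u}

/-- Configurations: a location and a valuation. -/
abbrev Config (G : WTG X) : Type u := G.Loc × (X → ℝ)

/-- Labels of transitions: a delay and an edge. -/
abbrev Move (G : WTG X) : Type u := ℝ × G.Edge

/-- The move `m = (d, e)` labels a transition from the configuration `c` in the semantics
restricted to clock values in `[0, bound)`. -/
def Legal (G : WTG X) (c : G.Config) (m : G.Move) : Prop :=
  0 ≤ m.1 ∧ G.src m.2 = c.1 ∧ BoundedVal G.bound (elapse c.2 m.1) ∧
    elapse c.2 m.1 ∈ G.guard m.2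

/-- The configuration reached from `c` by the move `m`. -/
def step (G : WTG X) (c : G.Config) (m : G.Move) : G.Config :=
  (G.tgt m.2, resetClocks (G.reset m.2) (elapse c.2 m.1))

/-- The last configuration of the play from `c` with moves `h`. In this and the next definitions,
the moves of a finite play are listed with the most recent one first. -/
def last (G : WTG X) (c : G.Config) : List G.Move → G.Config
  | [] => c
  | m :: h => G.step (G.last c h) m

/-- The moves `h`, played from `c`, form a finite path of the transition system. -/
def IsPlay (G : WTG X) (c : G.Config) : List G.Move → Prop
  | [] => True
  | m :: h => G.IsPlay c h ∧ G.Legal (G.last c h) m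

/-- The cumulative weight of the play from `c` with moves `h`. -/
def cumWeight (G : WTG X) (c : G.Config) : List G.Move → ℝ
  | [] => 0
  | m :: h => G.cumWeight c h + (m.1 * G.locWeight (G.last c h).1 + G.edgeWeight m.2)

/-- A finite play. -/
structure FinPlay (G : WTG X) where
  start : G.Config
  moves : List G.Move
  isPlay : G.IsPlay start moves

/-- The last configuration of a finite play. -/
def FinPlay.lastConfig {G : WTG X} (p : G.FinPlay) : G.Config := G.last p.start p.moves

/-- A finite play is non-maximal if it can be extended (and has not reached a target). -/
def FinPlay.NonMaximal {G : WTG X} (p : G.FinPlay) : Prop :=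
  p.lastConfig.1 ∉ G.target ∧ ∃ m, G.Legal p.lastConfig m

/-- The extension of a finite play by a legal move. -/
def FinPlay.extend {G : WTG X} (p : G.FinPlay) (m : {m // G.Legal p.lastConfig m}) : G.FinPlay :=
  ⟨p.start, m.1 :: p.moves, p.isPlay, m.2⟩

/-- Strategies of the player owning the locations in `P`: every non-maximal finite play ending in
`P` is mapped to a legal move from its last configuration. -/
def Strategy (G : WTG X) (P : Set G.Loc) : Type u :=
  ∀ p : G.FinPlay, p.NonMaximal → p.lastConfig.1 ∈ P → {m // G.Legal p.lastConfig m}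

abbrev MinStrategy (G : WTG X) : Type u := G.Strategy G.minLoc

abbrev MaxStrategy (G : WTG X) : Type u := G.Strategy G.minLocᶜ

/-- One turn of the game, when the players follow `σ` and `τ`; maximal plays are unchanged. -/
def turn (G : WTG X) (σ : G.MinStrategy) (τ : G.MaxStrategy) (p : G.FinPlay) : G.FinPlay :=
  if h : p.NonMaximal then
    if hP : p.lastConfig.1 ∈ G.minLoc then p.extend (σ p h hP) else p.extend (τ p h hP)
  else p

/-- The prefix of length `n` of the outcome of `σ` and `τ` from `c` (the whole outcome if it has
length less than `n`). -/
def outcome (G : WTG X) (c : G.Config) (σ : G.MinStrategy) (τ : G.MaxStrategy) (n : ℕ) :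
    G.FinPlay :=
  (G.turn σ τ)^[n] ⟨c, [], trivial⟩

/-- The weight of the outcome of `σ` and `τ` from `c`: the cumulative weight plus the final weight
if a target location is reached, and `+∞` otherwise. -/
def payoff (G : WTG X) (c : G.Config) (σ : G.MinStrategy) (τ : G.MaxStrategy) : EReal :=
  if h : ∃ n, (G.outcome c σ τ n).lastConfig.1 ∈ G.target then
    (G.cumWeight c (G.outcome c σ τ (Nat.find h)).moves : EReal) +
      G.finalWeight (G.outcome c σ τ (Nat.find h)).lastConfig.1
        (G.outcome c σ τ (Nat.find h)).lastConfig.2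
  else ⊤

/-- The lower value of a configuration. -/
def lowerVal (G : WTG X) (c : G.Config) : EReal :=
  ⨆ τ : G.MaxStrategy, ⨅ σ : G.MinStrategy, G.payoff c σ τ

/-- The upper value of a configuration. -/
def upperVal (G : WTG X) (c : G.Config) : EReal :=
  ⨅ σ : G.MinStrategy, ⨆ τ : G.MaxStrategy, G.payoff c σ τ

/-- The configuration `c` has value `v` in `G`. -/
def HasValue (G : WTG X) (c : G.Config) (v : EReal) : Prop :=
  G.lowerVal c = v ∧ G.upperVal c = v

/-- The standing hypotheses on weighted timed games: finitely many locations and edges; targets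
belong to Min and have no outgoing edges; no other configuration is deadlocked; guards are
non-diagonal with integer constants bounded by `bound`; final weights are piecewise affine and
continuous on regions. -/
structure Admissible [Fintype X] (G : WTG X) : Prop where
  finite_loc : Finite G.Loc
  finite_edge : Finite G.Edge
  bound_pos : 0 < G.bound
  target_subset : G.target ⊆ G.minLoc
  src_notMem_target : ∀ e, G.src e ∉ G.target
  no_deadlock : ∀ l, l ∉ G.target → ∀ ν, BoundedVal G.bound ν → ∃ m, G.Legal (l, ν) m
  guard_zone : ∀ e, IsRectangularZone G.bound (G.guard e)
  final_affine : ∀ l ∈ G.target, IsPiecewiseAffine G.bound (G.finalWeight l)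
  final_cont : ∀ l ∈ G.target, ContinuousOnRegions G.bound (G.finalWeight l)

/-- `p` is a path from `l` to `l'` in the graph of the game (edges in order). -/
def IsPath (G : WTG X) : G.Loc → List G.Edge → G.Loc → Prop
  | l, [], l' => l = l'
  | l, e :: p, l' => G.src e = l ∧ G.IsPath (G.tgt e) p l'

/-- A maximal weight, in absolute value, of the transitions of the semantics:
`bound * max |location weights| + max |edge weights|`. -/
def maxWeight (G : WTG X) : ℝ :=
  G.bound * (⨆ l, |(G.locWeight l : ℝ)|) + ⨆ e, |(G.edgeWeight e : ℝ)|

/-- The supremum of the absolute values of the final weights of target configurations. -/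
def maxFinalWeight (G : WTG X) : ℝ :=
  sSup {a | ∃ l ∈ G.target, ∃ ν, BoundedVal G.bound ν ∧ a = |(G.finalWeight l ν).toReal|}

/-! ### Region game, almost-divergence, kernel -/

/-- Region states. -/
abbrev RegionState (G : WTG X) : Type u := G.Loc × Region X G.bound

/-- Transitions of the region abstraction: from the region `start`, time elapses to the region
`mid`, which satisfies the guard of `edge`, and the reset leads to the region `dest`. -/
structure RegionEdge (G : WTG X) where
  edge : G.Edge
  start : Region X G.bound
  mid : Region X G.bound
  dest : Region X G.bound
  time_succ : ∃ ν ∈ start.1, ∃ d : ℝ, 0 ≤ d ∧ elapse ν d ∈ mid.1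
  sat : mid.1 ⊆ G.guard edge
  reset_eq : resetClocks (G.reset edge) '' mid.1 = dest.1

/-- The region game of `G`. -/
def regionGame (G : WTG X) : WTG X where
  Loc := G.RegionState
  Edge := G.RegionEdge
  minLoc := {s | s.1 ∈ G.minLoc}
  target := {s | s.1 ∈ G.target}
  src t := (G.src t.edge, t.start)
  tgt t := (G.tgt t.edge, t.dest)
  guard t := t.mid.1
  reset t := G.reset t.edge
  locWeight s := G.locWeight s.1
  edgeWeight t := G.edgeWeight t.edge
  finalWeight s := G.finalWeight s.1
  bound := G.bound

/-- The number of region states. -/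
def numRegionStates (G : WTG X) : ℕ := Nat.card G.RegionState

/-- `p` is a region cycle around the region state `s`. -/
def IsCycle (G : WTG X) (s : G.RegionState) (p : List G.RegionEdge) : Prop :=
  p ≠ [] ∧ G.regionGame.IsPath s p s

/-- The cumulative weights of the finite plays that follow the region path `p` from `s`. -/
def followWeights (G : WTG X) (s : G.RegionState) (p : List G.RegionEdge) : Set ℝ :=
  {w | ∃ ν ∈ s.2.1, ∃ h : List G.regionGame.Move, G.regionGame.IsPlay (s, ν) h ∧
    (h.map Prod.snd).reverse = p ∧ w = G.regionGame.cumWeight (s, ν) h}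

/-- `G` is almost-divergent: a play following a region cycle has cumulative weight in
`(-∞, -1] ∪ {0} ∪ [1, +∞)`, and if this weight is `0`, then for every decomposition
`p = p₁ p₂ p₃` of the cycle into two smaller cycles `p₂` and `p₃ p₁`, all plays following `p₂` or
`p₃ p₁` have weight `0`. -/
def AlmostDivergent (G : WTG X) : Prop :=
  ∀ s p, G.IsCycle s p → ∀ w ∈ G.followWeights s p,
    (w ≤ -1 ∨ w = 0 ∨ 1 ≤ w) ∧
    (w = 0 → ∀ s' p₁ p₂ p₃, p = p₁ ++ p₂ ++ p₃ → p₂ ≠ [] → p₃ ≠ [] →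
      G.regionGame.IsPath s p₁ s' → G.regionGame.IsPath s' p₂ s' →
      (∀ w' ∈ G.followWeights s' p₂, w' = 0) ∧ (∀ w' ∈ G.followWeights s' (p₃ ++ p₁), w' = 0))

/-- Edges of the kernel: those that belong to a simple `0`-cycle of the region game, i.e. a cycle
without repeated states such that all plays following it have weight `0`. -/
def kernelEdges (G : WTG X) : Set G.RegionEdge :=
  {t | ∃ s p, G.IsCycle s p ∧ (p.map G.regionGame.src).Nodup ∧
    (∀ w ∈ G.followWeights s p, w = 0) ∧ t ∈ p}

/-- States of the kernel: those covered by its edges. -/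
def kernelStates (G : WTG X) : Set G.RegionState :=
  {s | ∃ t ∈ G.kernelEdges, G.regionGame.src t = s ∨ G.regionGame.tgt t = s}

/-- The states of the part of the kernel accessible from `s`. -/
def kernelPart (G : WTG X) (s : G.RegionState) : Set G.RegionState :=
  {s' | ∃ p : List G.RegionEdge, (∀ t ∈ p, t ∈ G.kernelEdges) ∧ G.regionGame.IsPath s p s'}

/-- The output edges of `s`: if `s` is in the kernel, the non-kernel edges that start in the part of
the kernel accessible from `s`; otherwise all the edges that start in `s`. -/
def outputEdges (G : WTG X) (s : G.RegionState) : Set G.RegionEdge :=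
  {t | (s ∈ G.kernelStates ∧ t ∉ G.kernelEdges ∧ G.regionGame.src t ∈ G.kernelPart s) ∨
    (s ∉ G.kernelStates ∧ G.regionGame.src t = s)}

/-- The strongly connected component of `s` in the region game is non-negative: every play
following a cycle of it has weight `0` or at least `1`. -/
def NonnegSCC (G : WTG X) (s : G.RegionState) : Prop :=
  ∀ s' p, G.IsCycle s' p →
    (∃ q, G.regionGame.IsPath s q s') → (∃ q, G.regionGame.IsPath s' q s) →
    ∀ w ∈ G.followWeights s' p, w = 0 ∨ 1 ≤ w

/-! ### The semi-unfolding -/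

/-- The number of repetitions at which a branch is stopped. -/
def unfoldBound (G : WTG X) : ℝ :=
  3 * G.numRegionStates * G.maxWeight + 2 * G.maxFinalWeight + 2

/-- A node of the tree is given by the output edges labelling the branch from the root to it, the
last one first. Its label is `entry s₀ n`, which stands for the whole part of the kernel accessible
from `entry s₀ n` if this state is in the kernel. -/
def entry (G : WTG X) (s₀ : G.RegionState) : List G.RegionEdge → G.RegionState
  | [] => s₀
  | t :: _ => G.regionGame.tgt t

/-- The labels of the nodes on the branch from the root to `n`, both included. -/
def branchLabels (G : WTG X) (s₀ : G.RegionState) : List G.RegionEdge → List G.RegionState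
  | [] => [G.entry s₀ []]
  | t :: n => G.entry s₀ (t :: n) :: G.branchLabels s₀ n

/-- The construction of the tree stops at `n`: a target is reached, or the branch contains
`unfoldBound` nodes with the same label. -/
def IsLeaf (G : WTG X) (s₀ : G.RegionState) (n : List G.RegionEdge) : Prop :=
  (G.entry s₀ n).1 ∈ G.target ∨ ∃ s, G.unfoldBound ≤ ((G.branchLabels s₀ n).count s : ℝ)

/-- The nodes of the tree with root labelled by `s₀`. -/
def IsNode (G : WTG X) (s₀ : G.RegionState) : List G.RegionEdge → Prop
  | [] => True
  | t :: n => G.IsNode s₀ n ∧ ¬ G.IsLeaf s₀ n ∧ t ∈ G.outputEdges (G.entry s₀ n)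

/-- The region states that are copied when the node `n` is replaced by a game: the whole accessible
part of the kernel for non-leaf nodes labelled by a kernel, and a single state otherwise. -/
def nodeStates (G : WTG X) (s₀ : G.RegionState) (n : List G.RegionEdge) : Set G.RegionState :=
  {s | (¬ G.IsLeaf s₀ n ∧ G.entry s₀ n ∈ G.kernelStates ∧ s ∈ G.kernelPart (G.entry s₀ n)) ∨
    ((G.IsLeaf s₀ n ∨ G.entry s₀ n ∉ G.kernelStates) ∧ s = G.entry s₀ n)}

/-- Locations of the semi-unfolding: copies, for each node, of its region states. -/
abbrev UnfoldLoc (G : WTG X) (s₀ : G.RegionState) : Type u :=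
  {q : List G.RegionEdge × G.RegionState // G.IsNode s₀ q.1 ∧ q.2 ∈ G.nodeStates s₀ q.1}

/-- Edges of the semi-unfolding: copies, for each non-leaf node, of the edges of the region game
that start in a state of the node. -/
abbrev UnfoldEdge (G : WTG X) (s₀ : G.RegionState) : Type u :=
  {q : List G.RegionEdge × G.RegionEdge // G.IsNode s₀ q.1 ∧ ¬ G.IsLeaf s₀ q.1 ∧
    G.regionGame.src q.2 ∈ G.nodeStates s₀ q.1}

theorem isPath_append_singleton (G : WTG X) {l l' : G.Loc} {p : List G.Edge} {e : G.Edge}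
    (hp : G.IsPath l p l') (he : G.src e = l') : G.IsPath l (p ++ [e]) (G.tgt e) := by
  induction p generalizing l with
  | nil => exact ⟨he.trans hp.symm, rfl⟩
  | cons a p ih => exact ⟨hp.1, ih hp.2⟩

theorem mem_kernelPart_self (G : WTG X) (s : G.RegionState) : s ∈ G.kernelPart s :=
  ⟨[], fun _ ht => absurd ht List.not_mem_nil, rfl⟩

theorem entry_mem_nodeStates (G : WTG X) (s₀ : G.RegionState) (n : List G.RegionEdge) :
    G.entry s₀ n ∈ G.nodeStates s₀ n := by
  by_cases h : G.IsLeaf s₀ n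
  · exact Or.inr ⟨Or.inl h, rfl⟩
  · by_cases h' : G.entry s₀ n ∈ G.kernelStates
    · exact Or.inl ⟨h, h', G.mem_kernelPart_self _⟩
    · exact Or.inr ⟨Or.inr h', rfl⟩

theorem tgt_mem_nodeStates (G : WTG X) (s₀ : G.RegionState) {n : List G.RegionEdge}
    {t : G.RegionEdge} (hn : ¬ G.IsLeaf s₀ n) (ht : G.regionGame.src t ∈ G.nodeStates s₀ n)
    (hk : t ∈ G.kernelEdges) : G.regionGame.tgt t ∈ G.nodeStates s₀ n := by
  rcases ht with ⟨_, h, p, hp, hpath⟩ | ⟨h | h, h'⟩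
  · refine Or.inl ⟨hn, h, p ++ [t], ?_, G.regionGame.isPath_append_singleton hpath rfl⟩
    intro a ha
    rcases List.mem_append.1 ha with ha | ha
    · exact hp a ha
    · exact (List.mem_singleton.1 ha) ▸ hk
  · exact absurd h hn
  · exact absurd ⟨t, hk, Or.inl h'⟩ h

theorem isNode_cons (G : WTG X) (s₀ : G.RegionState) {n : List G.RegionEdge}
    {t : G.RegionEdge} (hN : G.IsNode s₀ n) (hn : ¬ G.IsLeaf s₀ n)
    (ht : G.regionGame.src t ∈ G.nodeStates s₀ n) (hk : t ∉ G.kernelEdges) :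
    G.IsNode s₀ (t :: n) := by
  refine ⟨hN, hn, ?_⟩
  rcases ht with ⟨_, h, h'⟩ | ⟨h | h, h'⟩
  · exact Or.inl ⟨h, hk, h'⟩
  · exact absurd h hn
  · exact Or.inr ⟨h, h'⟩

/-- The end of a copied edge: kernel edges stay in the same node, and output edges lead to the
copy of their end in the corresponding child. -/
def unfoldTgt (G : WTG X) (s₀ : G.RegionState) (q : G.UnfoldEdge s₀) : G.UnfoldLoc s₀ :=
  if hk : q.1.2 ∈ G.kernelEdges then
    ⟨(q.1.1, G.regionGame.tgt q.1.2), q.2.1, G.tgt_mem_nodeStates s₀ q.2.2.1 q.2.2.2 hk⟩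
  else
    ⟨(q.1.2 :: q.1.1, G.regionGame.tgt q.1.2),
      G.isNode_cons s₀ q.2.1 q.2.2.1 q.2.2.2 hk, G.entry_mem_nodeStates s₀ (q.1.2 :: q.1.1)⟩

/-- The semi-unfolding of `G` from the region state `s₀`. Owners, weights, guards and resets are
inherited from the region game. The final locations are the leaves; the final weight is inherited
on target leaves, and on stopped leaves it is `+∞` in a non-negative strongly connected component
and `-∞` otherwise (in an almost-divergent game, in a non-positive one). -/
def semiUnfolding (G : WTG X) (s₀ : G.RegionState) : WTG X where
  Loc := G.UnfoldLoc s₀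
  Edge := G.UnfoldEdge s₀
  minLoc := {q | q.1.2.1 ∈ G.minLoc}
  target := {q | G.IsLeaf s₀ q.1.1}
  src q := ⟨(q.1.1, G.regionGame.src q.1.2), q.2.1, q.2.2.2⟩
  tgt := G.unfoldTgt s₀
  guard q := G.regionGame.guard q.1.2
  reset q := G.regionGame.reset q.1.2
  locWeight q := G.regionGame.locWeight q.1.2
  edgeWeight q := G.regionGame.edgeWeight q.1.2
  finalWeight q ν :=
    if q.1.2.1 ∈ G.target then G.regionGame.finalWeight q.1.2 ν
    else if G.NonnegSCC q.1.2 then ⊤ else ⊥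
  bound := G.bound

/-- The initial location of the semi-unfolding: the copy of `s₀` in the root. -/
def unfoldRoot (G : WTG X) (s₀ : G.RegionState) : (G.semiUnfolding s₀).Loc :=
  ⟨([], s₀), trivial, G.entry_mem_nodeStates s₀ []⟩

end WTG

end

/-! Write `W` for `maxWeight`, `W_T` for `maxFinalWeight` and `B = |R| W + W_T` for `valBound`. The
value of a configuration is the infimum `val` of the budgets with which Min wins, and
`hasValue_of_wins` turns statements about the inductive predicate `Wins` into statements about
strategies, without any appeal to a determinacy theorem.

Two facts about `G` carry the proof. The first is that values lie in `[-B, B]`. For the upper bound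
(`val_le_valBound`), Min reaches a target along a region attractor in fewer than `|R|` turns. For
the lower bound (`neg_valBound_le_val`), Max limits the visits of edges on negative cycles so that
no cycle of the play has negative weight; if Max could not, then against an almost optimal Max the
value would grow without bound along some play (`eq_empty_of_subset_force`).

The second fact is that a component never mixes positive and negative cycles (`not_pos_and_neg`) and
that cycles of weight `0` are exactly those inside the kernel (`AllZero.mem_kernelEdges`,
`allZero_of_kernel`). Hence a cycle using an output edge weighs at least `1` or at most `-1`,
according to the sign of its component. A label repeated `k + 1` times on a branch therefore
accounts for a weight of absolute value at least `k`.

Both facts meet in the potential of a play of the semi-unfolding: its cumulative weight plus the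
value in `G` of its last configuration. At a stopped leaf the weight has drifted by at least
`unfoldBound - 1`, which exceeds `2 B` by at least `1`, so the potential differs by at least `1`
from that of an earlier entry (`exists_potential_gap`). A nearly optimal Max never lets the
potential fall by more than `1/2`, hence never meets a `-∞` leaf; a nearly optimal Min never lets it
rise by more than `1/2` between entries, hence never meets a `+∞` leaf. At target leaves the
potential is the payoff itself, so it is close to the value of the root.

The two players are treated differently. Max may be almost optimal turn by turn, since an infinite
play is worth `+∞`. Min must also leave each copy of the kernel, where turn by turn optimality could
circle forever on `0`-cycles; inside a node Min follows a winning strategy of `G`, which is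
well-founded, and pays an error only once per node. Branches having bounded length, the total error
is under control. -/

namespace WTG

variable {X : Type u}

/-! ### Plays and their concatenation -/

/-- The weight of the transition from `c` labelled by `m`. -/
noncomputable def moveWeight (G : WTG X) (c : G.Config) (m : G.Move) : ℝ :=
  m.1 * G.locWeight c.1 + G.edgeWeight m.2

theorem cumWeight_cons (G : WTG X) (c : G.Config) (m : G.Move) (h : List G.Move) :
    G.cumWeight c (m :: h) = G.cumWeight c h + G.moveWeight (G.last c h) m := rfl

theorem last_append (G : WTG X) (c : G.Config) (h₂ h₁ : List G.Move) :
    G.last c (h₂ ++ h₁) = G.last (G.last c h₁) h₂ := by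
  induction h₂ with
  | nil => rfl
  | cons m h ih => simp only [List.cons_append, last, ih]

theorem isPlay_append (G : WTG X) (c : G.Config) (h₂ h₁ : List G.Move) :
    G.IsPlay c (h₂ ++ h₁) ↔ G.IsPlay c h₁ ∧ G.IsPlay (G.last c h₁) h₂ := by
  induction h₂ with
  | nil => simp [IsPlay]
  | cons m h ih => simp only [List.cons_append, IsPlay, ih, last_append, and_assoc]

theorem cumWeight_append (G : WTG X) (c : G.Config) (h₂ h₁ : List G.Move) :
    G.cumWeight c (h₂ ++ h₁) = G.cumWeight c h₁ + G.cumWeight (G.last c h₁) h₂ := by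
  induction h₂ with
  | nil => simp [cumWeight]
  | cons m h ih =>
    simp only [List.cons_append, cumWeight_cons, ih, last_append]
    ring

/-! ### Winning below a budget, and determinacy -/

/-- From `c`, player Min can enforce that a target is reached with a weight less than `a`. -/
inductive Wins (G : WTG X) : G.Config → ℝ → Prop
  | target {c : G.Config} {a : ℝ} (ht : c.1 ∈ G.target) (h : G.finalWeight c.1 c.2 < a) :
      Wins G c a
  | min {c : G.Config} {a : ℝ} (m : G.Move) (ht : c.1 ∉ G.target) (hm : c.1 ∈ G.minLoc)
      (hl : G.Legal c m) (h : Wins G (G.step c m) (a - G.moveWeight c m)) : Wins G c a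
  | max {c : G.Config} {a : ℝ} (ht : c.1 ∉ G.target) (hm : c.1 ∉ G.minLoc)
      (hl : ∃ m, G.Legal c m)
      (h : ∀ m, G.Legal c m → Wins G (G.step c m) (a - G.moveWeight c m)) : Wins G c a

/-- The predicate `Wins`, with an ordinal that bounds the number of remaining turns. -/
inductive WinsRank (G : WTG X) : Ordinal.{u} → G.Config → ℝ → Prop
  | target {α : Ordinal.{u}} {c : G.Config} {a : ℝ} (ht : c.1 ∈ G.target)
      (h : G.finalWeight c.1 c.2 < a) : WinsRank G α c a
  | min {α β : Ordinal.{u}} {c : G.Config} {a : ℝ} (m : G.Move) (ht : c.1 ∉ G.target)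
      (hm : c.1 ∈ G.minLoc) (hl : G.Legal c m) (hβ : β < α)
      (h : WinsRank G β (G.step c m) (a - G.moveWeight c m)) : WinsRank G α c a
  | max {α : Ordinal.{u}} {c : G.Config} {a : ℝ} (ht : c.1 ∉ G.target) (hm : c.1 ∉ G.minLoc)
      (hl : ∃ m, G.Legal c m) (f : G.Move → Ordinal.{u}) (hf : ∀ m, G.Legal c m → f m < α)
      (h : ∀ m, G.Legal c m → WinsRank G (f m) (G.step c m) (a - G.moveWeight c m)) :
      WinsRank G α c a

/-- Delays range over a continuum, so a Max turn can have infinitely many successors with unbounded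
ranks; this is why ranks are ordinals. -/
theorem Wins.exists_rank {G : WTG X} {c : G.Config} {a : ℝ} (h : G.Wins c a) :
    ∃ α, G.WinsRank α c a := by
  induction h with
  | target ht h => exact ⟨0, .target ht h⟩
  | min m ht hm hl _ ih =>
    obtain ⟨β, hβ⟩ := ih
    exact ⟨Order.succ β, .min m ht hm hl (Order.lt_succ β) hβ⟩
  | @max c a ht hm hl _ ih =>
    choose! f hf using ih
    refine ⟨⨆ m, Order.succ (f m), .max ht hm hl f (fun m _ => ?_) hf⟩
    exact (Order.lt_succ (f m)).trans_le (Ordinal.le_iSup (fun m => Order.succ (f m)) m)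

theorem Wins.mono {G : WTG X} {c : G.Config} {a b : ℝ} (h : G.Wins c a) (hab : a ≤ b) :
    G.Wins c b := by
  induction h generalizing b with
  | target ht h => exact .target ht (h.trans_le (EReal.coe_le_coe_iff.2 hab))
  | min m ht hm hl _ ih => exact .min m ht hm hl (ih (by linarith))
  | max ht hm hl _ ih => exact .max ht hm hl fun m hl => ih m hl (by linarith)

theorem coe_add_lt_coe_iff (x a : ℝ) (f : EReal) :
    (x : EReal) + f < (a : EReal) ↔ f < ((a - x : ℝ) : EReal) := by
  induction f with
  | bot => exact ⟨fun _ => EReal.bot_lt_coe _, fun _ => by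
      rw [EReal.add_bot]; exact EReal.bot_lt_coe _⟩
  | top => simp
  | coe y =>
    rw [← EReal.coe_add, EReal.coe_lt_coe_iff, EReal.coe_lt_coe_iff]
    constructor <;> intro h <;> linarith

/-- The cumulative weight of a finite play. -/
noncomputable def FinPlay.cum {G : WTG X} (p : G.FinPlay) : ℝ := G.cumWeight p.start p.moves

theorem FinPlay.cum_extend {G : WTG X} (p : G.FinPlay) (m : {m // G.Legal p.lastConfig m}) :
    (p.extend m).cum = p.cum + G.moveWeight p.lastConfig m.1 := rfl

theorem FinPlay.lastConfig_extend {G : WTG X} (p : G.FinPlay)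
    (m : {m // G.Legal p.lastConfig m}) :
    (p.extend m).lastConfig = G.step p.lastConfig m.1 := rfl

theorem turn_start (G : WTG X) (σ : G.MinStrategy) (τ : G.MaxStrategy) (p : G.FinPlay) :
    (G.turn σ τ p).start = p.start := by
  unfold turn
  split_ifs <;> rfl

theorem turn_of_mem_target (G : WTG X) (σ : G.MinStrategy) (τ : G.MaxStrategy) {p : G.FinPlay}
    (hp : p.lastConfig.1 ∈ G.target) : G.turn σ τ p = p :=
  dif_neg fun h => h.1 hp

theorem outcome_start (G : WTG X) (c : G.Config) (σ : G.MinStrategy) (τ : G.MaxStrategy) (n : ℕ) :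
    (G.outcome c σ τ n).start = c := by
  induction n with
  | zero => rfl
  | succ n ih =>
    unfold outcome at ih ⊢
    rw [Function.iterate_succ_apply', turn_start, ih]

theorem outcome_succ (G : WTG X) (c : G.Config) (σ : G.MinStrategy) (τ : G.MaxStrategy) (n : ℕ) :
    G.outcome c σ τ (n + 1) = G.turn σ τ (G.outcome c σ τ n) :=
  Function.iterate_succ_apply' _ _ _

theorem outcome_eq_of_le (G : WTG X) (c : G.Config) (σ : G.MinStrategy) (τ : G.MaxStrategy)
    {k n : ℕ} (hk : (G.outcome c σ τ k).lastConfig.1 ∈ G.target) (hkn : k ≤ n) :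
    G.outcome c σ τ n = G.outcome c σ τ k := by
  induction n, hkn using Nat.le_induction with
  | base => rfl
  | succ n _ ih => rw [outcome_succ, ih, turn_of_mem_target _ _ _ hk]

theorem payoff_eq_of_mem_target (G : WTG X) (c : G.Config) (σ : G.MinStrategy) (τ : G.MaxStrategy)
    {n : ℕ} (hn : (G.outcome c σ τ n).lastConfig.1 ∈ G.target) :
    G.payoff c σ τ = ((G.outcome c σ τ n).cum : EReal) +
      G.finalWeight (G.outcome c σ τ n).lastConfig.1 (G.outcome c σ τ n).lastConfig.2 := by
  have hex : ∃ n, (G.outcome c σ τ n).lastConfig.1 ∈ G.target := ⟨n, hn⟩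
  have h := G.outcome_eq_of_le c σ τ (Nat.find_spec hex) (Nat.find_min' hex hn)
  unfold payoff FinPlay.cum
  rw [dif_pos hex, h, outcome_start]

/-- A memoryful strategy of Min that decreases the rank of `WinsRank` at every turn. -/
noncomputable def rankStrategy (G : WTG X) (a : ℝ) : G.MinStrategy := fun p hn _ =>
  if h : ∃ m, G.Legal p.lastConfig m ∧ ∃ β, G.WinsRank β (G.step p.lastConfig m)
      (a - p.cum - G.moveWeight p.lastConfig m) ∧
      ∀ α, G.WinsRank α p.lastConfig (a - p.cum) → β < α then ⟨h.choose, h.choose_spec.1⟩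
  else ⟨hn.2.choose, hn.2.choose_spec⟩

theorem rankStrategy_spec (G : WTG X) {a : ℝ} {p : G.FinPlay} (hn : p.NonMaximal)
    (hP : p.lastConfig.1 ∈ G.minLoc) {α : Ordinal.{u}}
    (hα : G.WinsRank α p.lastConfig (a - p.cum)) :
    ∃ β < α, G.WinsRank β (p.extend (G.rankStrategy a p hn hP)).lastConfig
      (a - (p.extend (G.rankStrategy a p hn hP)).cum) := by
  have hex : ∃ α, G.WinsRank α p.lastConfig (a - p.cum) := ⟨α, hα⟩
  have h : ∃ m, G.Legal p.lastConfig m ∧ ∃ β, G.WinsRank β (G.step p.lastConfig m)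
      (a - p.cum - G.moveWeight p.lastConfig m) ∧
      ∀ α, G.WinsRank α p.lastConfig (a - p.cum) → β < α := by
    -- A strategy sees the play but no rank. Taking the least rank of the configuration gives a
    -- successor whose rank lies below every possible one.
    obtain ⟨α₀, hα₀, hmin⟩ := exists_minimal_of_wellFoundedLT
      (fun α => G.WinsRank α p.lastConfig (a - p.cum)) hex
    cases hα₀ with
    | target ht _ => exact absurd ht hn.1
    | min m _ _ hl hβ h =>
      refine ⟨m, hl, _, h, fun α hα => hβ.trans_le ?_⟩
      exact not_lt.1 fun hlt => absurd (hmin hα hlt.le) (not_le.2 hlt)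
    | max _ hm _ _ _ _ => exact absurd hP hm
  obtain ⟨β, hβ, hlt⟩ := h.choose_spec.2
  refine ⟨β, hlt α hα, ?_⟩
  have he : G.rankStrategy a p hn hP = ⟨h.choose, h.choose_spec.1⟩ := dif_pos h
  rw [he, FinPlay.lastConfig_extend, FinPlay.cum_extend, ← sub_sub]
  exact hβ

/-- The rank drops at every turn, whoever moves, so well-foundedness stops the play at a target,
with the final weight below what is left of the budget. -/
theorem rankStrategy_wins (G : WTG X) (a : ℝ) (τ : G.MaxStrategy) (α : Ordinal.{u}) :
    ∀ p : G.FinPlay, G.WinsRank α p.lastConfig (a - p.cum) →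
      ∃ n, ((G.turn (G.rankStrategy a) τ)^[n] p).lastConfig.1 ∈ G.target ∧
        ((((G.turn (G.rankStrategy a) τ)^[n] p).cum : EReal) +
          G.finalWeight ((G.turn (G.rankStrategy a) τ)^[n] p).lastConfig.1
            ((G.turn (G.rankStrategy a) τ)^[n] p).lastConfig.2 < a) := by
  induction α using WellFoundedLT.induction with
  | ind α ih =>
  intro p hp
  by_cases ht : p.lastConfig.1 ∈ G.target
  · refine ⟨0, ht, ?_⟩
    cases hp with
    | target _ h => exact (coe_add_lt_coe_iff _ _ _).2 h
    | min _ h => exact absurd ht h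
    | max h => exact absurd ht h
  · have hn : p.NonMaximal := by
      refine ⟨ht, ?_⟩
      cases hp with
      | target h => exact absurd h ht
      | min m _ _ hl => exact ⟨m, hl⟩
      | max _ _ hl => exact hl
    have key : ∃ β < α, G.WinsRank β (G.turn (G.rankStrategy a) τ p).lastConfig
        (a - (G.turn (G.rankStrategy a) τ p).cum) := by
      unfold turn
      rw [dif_pos hn]
      by_cases hP : p.lastConfig.1 ∈ G.minLoc
      · rw [dif_pos hP]
        exact G.rankStrategy_spec hn hP hp
      · rw [dif_neg hP]
        cases hp with
        | target h => exact absurd h ht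
        | min _ _ h => exact absurd h hP
        | max _ _ _ f hf h =>
          refine ⟨_, hf _ (τ p hn hP).2, ?_⟩
          rw [FinPlay.lastConfig_extend, FinPlay.cum_extend, ← sub_sub]
          exact h _ (τ p hn hP).2
    obtain ⟨β, hβ, hw⟩ := key
    obtain ⟨n, hn⟩ := ih β hβ _ hw
    exact ⟨n + 1, by simpa only [Function.iterate_succ_apply] using hn⟩

theorem Wins.upperVal_le {G : WTG X} {c : G.Config} {a : ℝ} (h : G.Wins c a) :
    G.upperVal c ≤ a := by
  obtain ⟨α, hα⟩ := h.exists_rank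
  refine iInf_le_of_le (G.rankStrategy a) (iSup_le fun τ => ?_)
  obtain ⟨n, hn, hlt⟩ := G.rankStrategy_wins a τ α ⟨c, [], trivial⟩
    (by simpa [FinPlay.lastConfig, FinPlay.cum, last, cumWeight] using hα)
  rw [G.payoff_eq_of_mem_target c (G.rankStrategy a) τ hn]
  exact hlt.le

/-- A strategy of Max that avoids the configurations from which Min wins. -/
noncomputable def avoidStrategy (G : WTG X) (a : ℝ) : G.MaxStrategy := fun p hn _ =>
  if h : ∃ m, G.Legal p.lastConfig m ∧
      ¬ G.Wins (G.step p.lastConfig m) (a - p.cum - G.moveWeight p.lastConfig m) then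
    ⟨h.choose, h.choose_spec.1⟩
  else ⟨hn.2.choose, hn.2.choose_spec⟩

/-- A winning successor at a Min turn would make the configuration winning by `Wins.min`; at a Max
turn, failure of `Wins.max` yields a losing successor. -/
theorem not_wins_turn (G : WTG X) {a : ℝ} (σ : G.MinStrategy) {p : G.FinPlay}
    (hp : ¬ G.Wins p.lastConfig (a - p.cum)) :
    ¬ G.Wins (G.turn σ (G.avoidStrategy a) p).lastConfig
      (a - (G.turn σ (G.avoidStrategy a) p).cum) := by
  unfold turn
  by_cases hn : p.NonMaximal
  · rw [dif_pos hn]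
    by_cases hP : p.lastConfig.1 ∈ G.minLoc
    · rw [dif_pos hP, FinPlay.lastConfig_extend, FinPlay.cum_extend, ← sub_sub]
      exact fun h => hp (.min _ hn.1 hP (σ p hn hP).2 h)
    · rw [dif_neg hP, FinPlay.lastConfig_extend, FinPlay.cum_extend, ← sub_sub]
      have h : ∃ m, G.Legal p.lastConfig m ∧
          ¬ G.Wins (G.step p.lastConfig m) (a - p.cum - G.moveWeight p.lastConfig m) := by
        by_contra hcon
        push Not at hcon
        exact hp (.max hn.1 hP hn.2 hcon)
      have he : G.avoidStrategy a p hn hP = ⟨h.choose, h.choose_spec.1⟩ := dif_pos h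
      rw [he]
      exact h.choose_spec.2
  · rwa [dif_neg hn]

/-- Avoiding winning configurations suffices for Max: a target can then only be reached with payoff
at least `a`, and a play without target has payoff `⊤`. -/
theorem le_lowerVal_of_not_wins {G : WTG X} {c : G.Config} {a : ℝ} (h : ¬ G.Wins c a) :
    a ≤ G.lowerVal c := by
  refine le_iSup_of_le (G.avoidStrategy a) (le_iInf fun σ => ?_)
  have key : ∀ n, ¬ G.Wins (G.outcome c σ (G.avoidStrategy a) n).lastConfig
      (a - (G.outcome c σ (G.avoidStrategy a) n).cum) := by
    intro n
    induction n with
    | zero => simpa [outcome, FinPlay.lastConfig, FinPlay.cum, last, cumWeight] using h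
    | succ n ih =>
      rw [outcome_succ]
      exact G.not_wins_turn σ ih
  by_cases hex : ∃ n, (G.outcome c σ (G.avoidStrategy a) n).lastConfig.1 ∈ G.target
  · obtain ⟨n, hn⟩ := hex
    rw [G.payoff_eq_of_mem_target c σ _ hn]
    refine not_lt.1 fun hlt => key n (.target hn ?_)
    exact (coe_add_lt_coe_iff _ _ _).1 hlt
  · unfold payoff
    rw [dif_neg hex]
    exact le_top

theorem lowerVal_le_upperVal (G : WTG X) (c : G.Config) : G.lowerVal c ≤ G.upperVal c :=
  iSup_iInf_le_iInf_iSup _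

/-- Games are determined: the value is the threshold of the budgets with which Min wins. -/
theorem hasValue_of_wins {G : WTG X} {c : G.Config} {v : ℝ} (h₁ : ∀ a > v, G.Wins c a)
    (h₂ : ∀ a < v, ¬ G.Wins c a) : G.HasValue c v := by
  have hu : G.upperVal c ≤ v := by
    refine EReal.le_of_forall_lt_iff_le.1 fun z hz => ?_
    exact (h₁ z (EReal.coe_lt_coe_iff.1 hz)).upperVal_le
  have hl : (v : EReal) ≤ G.lowerVal c := by
    refine EReal.ge_of_forall_gt_iff_ge.1 fun z hz => ?_
    exact le_lowerVal_of_not_wins (h₂ z (EReal.coe_lt_coe_iff.1 hz))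
  exact ⟨le_antisymm ((G.lowerVal_le_upperVal c).trans hu) hl,
    le_antisymm hu (hl.trans (G.lowerVal_le_upperVal c))⟩

theorem exists_wins_of_not_hasValue_top {G : WTG X} {c : G.Config} (h : ¬ G.HasValue c ⊤) :
    ∃ a, G.Wins c a := by
  by_contra! hcon
  have hl : G.lowerVal c = ⊤ :=
    EReal.eq_top_iff_forall_lt _ |>.2 fun a =>
      (EReal.coe_lt_coe_iff.2 (lt_add_one a)).trans_le (le_lowerVal_of_not_wins (hcon (a + 1)))
  exact h ⟨hl, top_le_iff.1 (hl ▸ G.lowerVal_le_upperVal c)⟩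

theorem exists_not_wins_of_not_hasValue_bot {G : WTG X} {c : G.Config} (h : ¬ G.HasValue c ⊥) :
    ∃ a, ¬ G.Wins c a := by
  by_contra! hcon
  have hu : G.upperVal c = ⊥ :=
    EReal.eq_bot_iff_forall_lt _ |>.2 fun a =>
      (hcon (a - 1)).upperVal_le.trans_lt (EReal.coe_lt_coe_iff.2 (sub_one_lt a))
  exact h ⟨le_bot_iff.1 (hu ▸ G.lowerVal_le_upperVal c), hu⟩

/-- If Max can maintain the property `I` of plays, then a play with property `I` reaches a target
within the budget with which Min wins. -/
theorem Wins.exists_play {G : WTG X} {c₀ : G.Config} {I : List G.Move → Prop}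
    (hmin : ∀ h m, G.IsPlay c₀ h → I h → (G.last c₀ h).1 ∉ G.target → (G.last c₀ h).1 ∈ G.minLoc →
      G.Legal (G.last c₀ h) m → I (m :: h))
    (hmax : ∀ h, G.IsPlay c₀ h → I h → (G.last c₀ h).1 ∉ G.target → (G.last c₀ h).1 ∉ G.minLoc →
      (∃ m, G.Legal (G.last c₀ h) m) → ∃ m, G.Legal (G.last c₀ h) m ∧ I (m :: h))
    {a : ℝ} (hw : G.Wins c₀ a) (h₀ : I []) :
    ∃ h, G.IsPlay c₀ h ∧ I h ∧ (G.last c₀ h).1 ∈ G.target ∧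
      G.finalWeight (G.last c₀ h).1 (G.last c₀ h).2 < ((a - G.cumWeight c₀ h : ℝ) : EReal) := by
  suffices H : ∀ c b, G.Wins c b → ∀ h, G.IsPlay c₀ h → I h → G.last c₀ h = c →
      b = a - G.cumWeight c₀ h → ∃ h, G.IsPlay c₀ h ∧ I h ∧ (G.last c₀ h).1 ∈ G.target ∧
      G.finalWeight (G.last c₀ h).1 (G.last c₀ h).2 < ((a - G.cumWeight c₀ h : ℝ) : EReal) from
    H c₀ a hw [] trivial h₀ rfl (by simp [cumWeight])
  intro c b hw
  induction hw with
  | target ht hf =>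
    rintro h hp hI rfl rfl
    exact ⟨h, hp, hI, ht, hf⟩
  | min m ht hm hl _ ih =>
    rintro h hp hI rfl rfl
    exact ih (m :: h) ⟨hp, hl⟩ (hmin h m hp hI ht hm hl) rfl
      (by rw [cumWeight_cons, sub_sub])
  | max ht hm hl _ ih =>
    rintro h hp hI rfl rfl
    obtain ⟨m, hl, hI'⟩ := hmax h hp hI ht hm hl
    exact ih m hl (m :: h) ⟨hp, hl⟩ hI' rfl (by rw [cumWeight_cons, sub_sub])

end WTG

/-! ### Regions -/

/-- The strictly increasing transformations of the line that commute with the translation by `1`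
and fix `0`. Two valuations are in the same region if such a map sends one to the other. -/
structure IsClockMap (F : ℝ → ℝ) : Prop where
  strictMono : StrictMono F
  add_one : ∀ y, F (y + 1) = F y + 1
  zero : F 0 = 0

namespace IsClockMap

variable {F : ℝ → ℝ}

theorem add_nat (hF : IsClockMap F) (y : ℝ) (k : ℕ) : F (y + k) = F y + k := by
  induction k with
  | zero => simp
  | succ k ih => push_cast; rw [← add_assoc, hF.add_one, ih, add_assoc]

theorem add_int (hF : IsClockMap F) (y : ℝ) (k : ℤ) : F (y + k) = F y + k := by
  obtain ⟨n, rfl | rfl⟩ := k.eq_nat_or_neg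
  · exact_mod_cast hF.add_nat y n
  · have := hF.add_nat (y + ((-(n : ℤ) : ℤ) : ℝ)) n
    push_cast at this ⊢
    rw [neg_add_cancel_right] at this
    linarith

theorem int (hF : IsClockMap F) (k : ℤ) : F k = k := by
  simpa [hF.zero] using hF.add_int 0 k

theorem floor (hF : IsClockMap F) (y : ℝ) : ⌊F y⌋ = ⌊y⌋ := by
  rw [Int.floor_eq_iff, ← hF.int ⌊y⌋]
  refine ⟨hF.strictMono.monotone (Int.floor_le y), ?_⟩
  rw [← hF.add_one]
  exact hF.strictMono (Int.lt_floor_add_one y)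

theorem fract (hF : IsClockMap F) (y : ℝ) : Int.fract (F y) = F (Int.fract y) := by
  have := hF.add_int (Int.fract y) ⌊y⌋
  rw [Int.fract_add_floor] at this
  rw [Int.fract, hF.floor, this, add_sub_cancel_right]

theorem mem_regionOf {X : Type u} {M : ℕ} (hF : IsClockMap F) {ν : X → ℝ} (hν : BoundedVal M ν) :
    F ∘ ν ∈ regionOf M ν := by
  refine ⟨fun x => ⟨?_, ?_⟩, fun x => hF.floor _, fun x => ?_, fun x y => ?_⟩
  · simpa [hF.zero] using hF.strictMono.monotone (hν x).1
  · have := hF.strictMono (hν x).2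
    have h := hF.int M
    push_cast at h
    rwa [h] at this
  · simp only [Function.comp_apply, hF.fract]
    exact ⟨fun h => hF.strictMono.injective (h.trans hF.zero.symm), fun h => by rw [h, hF.zero]⟩
  · simp only [Function.comp_apply, hF.fract]
    exact hF.strictMono.le_iff_le

/-- If `F` sends `ν` to `ν'`, a delay `d` from `ν` is matched by the delay `-F (-d)` from `ν'`, and
this map relates the two elapsed valuations. -/
theorem elapse (hF : IsClockMap F) (d : ℝ) : IsClockMap fun y => F (y - d) - F (-d) where
  strictMono a b hab := sub_lt_sub_right (hF.strictMono (sub_lt_sub_right hab d)) _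
  add_one y := by
    rw [show y + 1 - d = y - d + 1 by ring, hF.add_one]
    ring
  zero := by simp

end IsClockMap

/-- A strictly increasing function on a finite subset of `[0, 1)` containing the fixed point `0`
extends to `[0, 1)`. -/
theorem exists_strictMonoOn_extension (A : Finset ℝ) (g : ℝ → ℝ) (h0 : (0 : ℝ) ∈ A)
    (hA : ∀ a ∈ A, 0 ≤ a ∧ a < 1) (hg0 : g 0 = 0) (hg1 : ∀ a ∈ A, g a < 1)
    (hg : ∀ a ∈ A, ∀ b ∈ A, a < b → g a < g b) :
    ∃ f : ℝ → ℝ, (∀ a ∈ A, f a = g a) ∧ (∀ y z, 0 ≤ y → y < z → z < 1 → f y < f z) ∧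
      ∀ y, 0 ≤ y → y < 1 → 0 ≤ f y ∧ f y < 1 := by
  -- The slope `δ` is smaller than every gap between values of `g`, and than the room left below
  -- `1`.
  obtain ⟨δ, hδ, hδ1, hδg⟩ : ∃ δ : ℝ, 0 < δ ∧ (∀ a ∈ A, g a + δ < 1) ∧
      ∀ p ∈ A ×ˢ A, p.1 < p.2 → g p.1 + δ < g p.2 := by
    have h1 : ∀ a ∈ A, ∀ᶠ δ in nhdsWithin (0 : ℝ) (Set.Ioi 0), g a + δ < 1 := fun a ha => by
      filter_upwards [nhdsWithin_le_nhds (eventually_lt_nhds (sub_pos.2 (hg1 a ha)))] with δ hδ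
      linarith
    have h2 : ∀ p ∈ A ×ˢ A, ∀ᶠ δ in nhdsWithin (0 : ℝ) (Set.Ioi 0),
        p.1 < p.2 → g p.1 + δ < g p.2 := fun p hp => by
      by_cases hlt : p.1 < p.2
      · have := hg _ (Finset.mem_product.1 hp).1 _ (Finset.mem_product.1 hp).2 hlt
        filter_upwards [nhdsWithin_le_nhds (eventually_lt_nhds (sub_pos.2 this))] with δ hδ _
        linarith
      · exact Filter.Eventually.of_forall fun _ h => absurd h hlt
    obtain ⟨δ, ⟨h1, h2⟩, h3⟩ := (((Filter.eventually_all_finset A).2 h1).and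
      ((Filter.eventually_all_finset _).2 h2)).and self_mem_nhdsWithin |>.exists
    exact ⟨δ, h3, h1, h2⟩
  have hne : ∀ y : ℝ, 0 ≤ y → (A.filter (· ≤ y)).Nonempty := fun y hy => ⟨0, by simp [h0, hy]⟩
  -- The maximum of the lines of slope `δ` issued from the points of the graph of `g` to the left of
  -- `y`. The slope is so small that at a point of `A` the line issued from that point dominates.
  let f : ℝ → ℝ := fun y =>
    if hy : 0 ≤ y then (A.filter (· ≤ y)).sup' (hne y hy) fun a => g a + δ * (y - a) else 0
  have hf : ∀ y (hy : 0 ≤ y), f y =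
      (A.filter (· ≤ y)).sup' (hne y hy) fun a => g a + δ * (y - a) := fun y hy => dif_pos hy
  refine ⟨f, fun a ha => ?_, fun y z hy hyz hz => ?_, fun y hy hy1 => ⟨?_, ?_⟩⟩
  · rw [hf a (hA a ha).1]
    refine le_antisymm (Finset.sup'_le _ _ fun b hb => ?_) ?_
    · obtain ⟨hb, hba⟩ := Finset.mem_filter.1 hb
      rcases hba.eq_or_lt with rfl | hlt
      · simp
      · have := hδg (b, a) (Finset.mem_product.2 ⟨hb, ha⟩) hlt
        have h1 := (hA a ha).2
        have h2 := (hA b hb).1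
        dsimp only at this
        nlinarith
    · refine (Finset.le_sup' (fun b => g b + δ * (a - b))
        ((Finset.mem_filter (p := (· ≤ a))).2 ⟨ha, le_rfl⟩)).trans' ?_
      simp
  · rw [hf y hy, hf z (hy.trans hyz.le), Finset.sup'_lt_iff]
    intro b hb
    obtain ⟨hb, hby⟩ := Finset.mem_filter.1 hb
    refine lt_of_lt_of_le ?_ (Finset.le_sup' (fun b => g b + δ * (z - b))
      ((Finset.mem_filter (p := (· ≤ z))).2 ⟨hb, hby.trans hyz.le⟩))
    have := mul_lt_mul_of_pos_left (sub_lt_sub_right hyz b) hδ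
    simpa using this
  · rw [hf y hy]
    refine (Finset.le_sup' (fun b => g b + δ * (y - b))
      ((Finset.mem_filter (p := (· ≤ y))).2 ⟨h0, hy⟩)).trans' ?_
    simp only [hg0, sub_zero, zero_add]
    positivity
  · rw [hf y hy, Finset.sup'_lt_iff]
    intro b hb
    obtain ⟨hb, hby⟩ := Finset.mem_filter.1 hb
    have h1 := hδ1 b hb
    have h2 := (hA b hb).1
    nlinarith

/-- As the fractional parts of `ν` and `ν'` are ordered alike and vanish together, matching them
clock by clock is a well-defined increasing map on a finite set. It extends to `[0, 1)` and then, by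
integer translations, to the line. -/
theorem exists_clockMap_of_mem_regionOf {X : Type u} [Finite X] {M : ℕ} {ν ν' : X → ℝ}
    (h : ν' ∈ regionOf M ν) : ∃ F, IsClockMap F ∧ F ∘ ν = ν' := by
  obtain ⟨-, hfl, hz, ho⟩ := h
  have := Fintype.ofFinite X
  let A : Finset ℝ := insert 0 (Finset.univ.image fun x => Int.fract (ν x))
  let g : ℝ → ℝ := fun y =>
    if hy : ∃ x, Int.fract (ν x) = y then Int.fract (ν' hy.choose) else 0
  have hgx : ∀ x, g (Int.fract (ν x)) = Int.fract (ν' x) := fun x => by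
    have hy : ∃ x', Int.fract (ν x') = Int.fract (ν x) := ⟨x, rfl⟩
    have : g (Int.fract (ν x)) = Int.fract (ν' hy.choose) := dif_pos hy
    rw [this]
    exact le_antisymm ((ho _ _).2 hy.choose_spec.le) ((ho _ _).2 hy.choose_spec.ge)
  have hg0 : g 0 = 0 := by
    by_cases hy : ∃ x, Int.fract (ν x) = 0
    · obtain ⟨x, hx⟩ := hy
      rw [← hx, hgx, hx]
      exact (hz x).2 hx
    · exact dif_neg hy
  have hmem : ∀ a ∈ A, a = 0 ∨ ∃ x, a = Int.fract (ν x) := fun a ha => by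
    simpa [A, eq_comm] using ha
  obtain ⟨f, hfg, hf, hf1⟩ := exists_strictMonoOn_extension A g (by simp [A])
    (fun a ha => by
      rcases hmem a ha with rfl | ⟨x, rfl⟩
      · simp
      · exact ⟨Int.fract_nonneg _, Int.fract_lt_one _⟩) hg0
    (fun a ha => by
      rcases hmem a ha with rfl | ⟨x, rfl⟩
      · simp [hg0]
      · rw [hgx]; exact Int.fract_lt_one _)
    (fun a ha b hb hab => by
      rcases hmem a ha with rfl | ⟨x, rfl⟩ <;> rcases hmem b hb with rfl | ⟨y, rfl⟩
      · exact absurd hab (lt_irrefl _)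
      · rw [hg0, hgx]
        exact (Int.fract_nonneg _).lt_of_ne fun h => hab.ne ((hz y).1 h.symm).symm
      · exact absurd hab (Int.fract_nonneg _).not_gt
      · rw [hgx, hgx]
        exact lt_of_not_ge fun h => absurd ((ho _ _).1 h) hab.not_ge)
  refine ⟨fun y => ⌊y⌋ + f (Int.fract y), ⟨fun y z hyz => ?_, fun y => ?_, ?_⟩, ?_⟩
  · rcases (Int.floor_mono hyz.le).eq_or_lt with he | hlt
    · have : Int.fract y < Int.fract z := by
        simp only [Int.fract, he]; linarith
      have := hf _ _ (Int.fract_nonneg y) this (Int.fract_lt_one z)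
      rw [he]
      linarith
    · have h1 := (hf1 _ (Int.fract_nonneg y) (Int.fract_lt_one y)).2
      have h2 := (hf1 _ (Int.fract_nonneg z) (Int.fract_lt_one z)).1
      have h3 : (⌊y⌋ : ℝ) + 1 ≤ ⌊z⌋ := by exact_mod_cast hlt
      linarith
  · simp only [Int.floor_add_one, Int.fract_add_one]
    push_cast
    ring
  · simp [hfg 0 (by simp [A]), hg0]
  · funext x
    simp only [Function.comp_apply]
    rw [hfg _ (by simp [A]), hgx, ← hfl, Int.floor_add_fract]

theorem mem_regionOf_self {X : Type u} {M : ℕ} {ν : X → ℝ} (hν : BoundedVal M ν) :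
    ν ∈ regionOf M ν := ⟨hν, fun _ => rfl, fun _ => Iff.rfl, fun _ _ => Iff.rfl⟩

theorem regionOf_eq_of_mem {X : Type u} {M : ℕ} {ν ν' : X → ℝ} (h : ν' ∈ regionOf M ν) :
    regionOf M ν' = regionOf M ν := by
  obtain ⟨-, h1, h2, h3⟩ := h
  ext μ
  simp only [regionOf, Set.mem_ofPred_eq, h1, h2, h3]

namespace Region

variable {X : Type u} {M : ℕ}

/-- The region of a valuation. -/
def mk (ν : X → ℝ) (hν : BoundedVal M ν) : Region X M := ⟨regionOf M ν, ν, hν, rfl⟩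

theorem mem_mk {ν : X → ℝ} (hν : BoundedVal M ν) : ν ∈ (mk ν hν).1 := mem_regionOf_self hν

theorem eq_regionOf (r : Region X M) {ν : X → ℝ} (hν : ν ∈ r.1) : r.1 = regionOf M ν := by
  obtain ⟨_, ν₀, _, rfl⟩ := r
  exact (regionOf_eq_of_mem hν).symm

theorem bounded (r : Region X M) {ν : X → ℝ} (hν : ν ∈ r.1) : BoundedVal M ν := by
  obtain ⟨_, ν₀, _, rfl⟩ := r
  exact hν.1

theorem nonempty (r : Region X M) : r.1.Nonempty := by
  obtain ⟨_, ν₀, h, rfl⟩ := r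
  exact ⟨ν₀, mem_regionOf_self h⟩

theorem exists_clockMap [Finite X] (r : Region X M) {ν ν' : X → ℝ} (hν : ν ∈ r.1)
    (hν' : ν' ∈ r.1) : ∃ F, IsClockMap F ∧ F ∘ ν = ν' :=
  exists_clockMap_of_mem_regionOf (r.eq_regionOf hν ▸ hν')

theorem clockMap_mem (r : Region X M) {F : ℝ → ℝ} (hF : IsClockMap F) {ν : X → ℝ}
    (hν : ν ∈ r.1) : F ∘ ν ∈ r.1 := by
  rw [r.eq_regionOf hν]
  exact hF.mem_regionOf (r.bounded hν)

theorem eq_of_mem {r r' : Region X M} {ν : X → ℝ} (h : ν ∈ r.1) (h' : ν ∈ r'.1) : r = r' :=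
  Subtype.ext ((r.eq_regionOf h).trans (r'.eq_regionOf h').symm)

/-- Time successors do not depend on the valuation in the region. -/
theorem exists_elapse_mem [Finite X] {r r' : Region X M} {ν ν' : X → ℝ} (hν : ν ∈ r.1)
    (hν' : ν' ∈ r.1) {d : ℝ} (hd : 0 ≤ d) (h : elapse ν d ∈ r'.1) :
    ∃ d', 0 ≤ d' ∧ elapse ν' d' ∈ r'.1 := by
  obtain ⟨F, hF, rfl⟩ := r.exists_clockMap hν hν'
  refine ⟨-F (-d), ?_, ?_⟩
  · have := hF.strictMono.monotone (neg_nonpos.2 hd)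
    rw [hF.zero] at this
    linarith
  · convert r'.clockMap_mem (hF.elapse d) h using 1
    funext x
    simp [elapse, sub_eq_add_neg]

theorem resetClocks_bounded {ν : X → ℝ} (Y : Set X) (hν : BoundedVal M ν) :
    BoundedVal M (resetClocks Y ν) := fun x => by
  by_cases hx : x ∈ Y
  · simpa [resetClocks, hx] using (hν x).1.trans_lt (hν x).2
  · simpa [resetClocks, hx] using hν x

/-- Clock maps fix `0`, hence commute with resets. The image is therefore a full region, as the
field `reset_eq` of a region edge requires. -/
theorem image_resetClocks [Finite X] (r : Region X M) (Y : Set X) {ν : X → ℝ} (hν : ν ∈ r.1) :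
    resetClocks Y '' r.1 = regionOf M (resetClocks Y ν) := by
  have hcomp : ∀ {F : ℝ → ℝ} (μ : X → ℝ), IsClockMap F →
      resetClocks Y (F ∘ μ) = F ∘ resetClocks Y μ := fun {F} μ hF => by
    funext x
    by_cases hx : x ∈ Y <;> simp [resetClocks, hx, hF.zero]
  have hb := resetClocks_bounded Y (r.bounded hν)
  ext μ
  constructor
  · rintro ⟨ν', hν', rfl⟩
    obtain ⟨F, hF, rfl⟩ := r.exists_clockMap hν hν'
    rw [hcomp _ hF]
    exact hF.mem_regionOf hb
  · intro hμ
    obtain ⟨F, hF, rfl⟩ := exists_clockMap_of_mem_regionOf hμ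
    exact ⟨F ∘ ν, r.clockMap_mem hF hν, hcomp _ hF⟩

/-- Clock maps are increasing and fix the integers, so they preserve comparisons with integer
constants. -/
theorem subset_zone [Finite X] (r : Region X M) {Z : Set (X → ℝ)} (hZ : IsRectangularZone M Z)
    {ν : X → ℝ} (hν : ν ∈ r.1) (h : ν ∈ Z) : r.1 ⊆ Z := by
  obtain ⟨g, -, rfl⟩ := hZ
  intro ν' hν' a ha
  obtain ⟨F, hF, rfl⟩ := r.exists_clockMap hν hν'
  have h := h a ha
  have hc := hF.int a.const
  unfold AtomicConstraint.Sat at h ⊢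
  cases hcmp : a.cmp <;> simp only [hcmp, Function.comp_apply, gt_iff_lt, ge_iff_le] at h ⊢ <;>
    rw [← hc]
  · exact hF.strictMono h
  · exact hF.strictMono.monotone h
  · exact hF.strictMono h
  · exact hF.strictMono.monotone h

/-- Integral parts are constant on a region, so fractional parts are affine there, and their order
and zeros survive convex combinations. -/
theorem convex (r : Region X M) : Convex ℝ r.1 := by
  obtain ⟨_, ν₀, hν₀, rfl⟩ := r
  intro ν hν ν' hν' a b ha hb hab
  have hfl : ∀ x, ⌊(a • ν + b • ν') x⌋ = ⌊ν₀ x⌋ := fun x => by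
    have h1 := (Int.floor_eq_iff.1 (hν.2.1 x))
    have h2 := (Int.floor_eq_iff.1 (hν'.2.1 x))
    rw [Int.floor_eq_iff]
    simp only [Pi.add_apply, Pi.smul_apply, smul_eq_mul]
    obtain rfl : b = 1 - a := by linarith
    constructor
    · nlinarith
    · rcases ha.eq_or_lt with rfl | ha
      · linarith
      · nlinarith
  have hfr : ∀ x, Int.fract ((a • ν + b • ν') x) =
      a * Int.fract (ν x) + b * Int.fract (ν' x) := fun x => by
    simp only [Int.fract, hfl x, hν.2.1 x, hν'.2.1 x]
    simp only [Pi.add_apply, Pi.smul_apply, smul_eq_mul]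
    obtain rfl : b = 1 - a := by linarith
    ring
  refine ⟨fun x => ?_, hfl, fun x => ?_, fun x y => ?_⟩
  · have h1 := hν.1 x
    have h2 := hν'.1 x
    simp only [Pi.add_apply, Pi.smul_apply, smul_eq_mul]
    refine ⟨by nlinarith, ?_⟩
    obtain rfl : b = 1 - a := by linarith
    rcases ha.eq_or_lt with rfl | ha
    · linarith
    · nlinarith
  · have h1 := hν.2.2.1 x
    have h2 := hν'.2.2.1 x
    have n1 := Int.fract_nonneg (ν x)
    have n2 := Int.fract_nonneg (ν' x)
    rw [hfr]
    constructor
    · intro h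
      by_contra hne
      have p1 := n1.lt_of_ne fun h => hne (h1.1 h.symm)
      have p2 := n2.lt_of_ne fun h => hne (h2.1 h.symm)
      rcases ha.eq_or_lt with rfl | ha
      · obtain rfl : b = 1 := by linarith
        linarith
      · nlinarith
    · intro h
      rw [h1.2 h, h2.2 h]
      simp
  · have h1 := hν.2.2.2 x y
    have h2 := hν'.2.2.2 x y
    rw [hfr, hfr]
    constructor
    · intro h
      by_contra hne
      have p1 := lt_of_not_ge fun h => hne (h1.1 h)
      have p2 := lt_of_not_ge fun h => hne (h2.1 h)
      rcases ha.eq_or_lt with rfl | ha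
      · obtain rfl : b = 1 := by linarith
        linarith
      · nlinarith
    · intro h
      have := h1.2 h
      have := h2.2 h
      gcongr

instance finite [Finite X] : Finite (Region X M) := by
  let φ : Region X M → (X → Fin (M + 1)) × (X → Prop) × (X → X → Prop) := fun r =>
    ⟨fun x => Fin.ofNat (M + 1) ⌊r.nonempty.some x⌋.toNat,
      fun x => Int.fract (r.nonempty.some x) = 0,
      fun x y => Int.fract (r.nonempty.some x) ≤ Int.fract (r.nonempty.some y)⟩
  refine Finite.of_injective φ fun r r' h => ?_
  simp only [φ, Prod.mk.injEq] at h
  obtain ⟨h1, h2, h3⟩ := h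
  have hr := r.nonempty.some_mem
  have hr' := r'.nonempty.some_mem
  refine eq_of_mem hr (r'.eq_regionOf hr' ▸ ⟨r.bounded hr, fun x => ?_, fun x => ?_, fun x y => ?_⟩)
  · have key : ∀ {ν : X → ℝ}, BoundedVal M ν → 0 ≤ ⌊ν x⌋ ∧ ⌊ν x⌋.toNat < M + 1 := fun {ν} hν => by
      have h0 : 0 ≤ ⌊ν x⌋ := Int.floor_nonneg.2 (hν x).1
      have h1 : ⌊ν x⌋ < M := Int.floor_lt.2 (by exact_mod_cast (hν x).2)
      omega
    obtain ⟨a1, a2⟩ := key (r.bounded hr)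
    obtain ⟨b1, b2⟩ := key (r'.bounded hr')
    have := congrArg Fin.val (congrFun h1 x)
    simp only [Fin.ofNat, Nat.mod_eq_of_lt a2, Nat.mod_eq_of_lt b2] at this
    omega
  · exact iff_of_eq (congrFun h2 x)
  · exact iff_of_eq (congrFun (congrFun h3 x) y)

end Region

namespace WTG

variable {X : Type u}

/-! ### Paths -/

theorem isPath_append (G : WTG X) {l l' : G.Loc} {p q : List G.Edge} :
    G.IsPath l (p ++ q) l' ↔ ∃ k, G.IsPath l p k ∧ G.IsPath k q l' := by
  induction p generalizing l with
  | nil => simp [IsPath]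
  | cons e p ih =>
    simp only [List.cons_append, IsPath, ih]
    constructor
    · rintro ⟨h, k, h1, h2⟩
      exact ⟨k, ⟨h, h1⟩, h2⟩
    · rintro ⟨k, ⟨h, h1⟩, h2⟩
      exact ⟨h, k, h1, h2⟩

theorem IsPath.unique {G : WTG X} {l k k' : G.Loc} {p : List G.Edge} (h : G.IsPath l p k)
    (h' : G.IsPath l p k') : k = k' := by
  induction p generalizing l with
  | nil => exact (Eq.symm h).trans h'
  | cons e p ih => exact ih h.2 h'.2

/-- The path followed by a play. -/
def path {G : WTG X} (h : List G.Move) : List G.Edge := (h.map Prod.snd).reverse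

theorem path_append {G : WTG X} (h₂ h₁ : List G.Move) :
    path (h₂ ++ h₁) = path h₁ ++ path h₂ := by simp [path]

theorem path_cons {G : WTG X} (m : G.Move) (h : List G.Move) :
    path (m :: h) = path h ++ [m.2] := by simp [path]

theorem path_eq_append {G : WTG X} {h : List G.Move} {p q : List G.Edge} (hp : path h = p ++ q) :
    ∃ h₂ h₁, h = h₂ ++ h₁ ∧ path h₁ = p ∧ path h₂ = q := by
  have : h.map Prod.snd = q.reverse ++ p.reverse := by
    rw [← List.reverse_append, ← hp, path, List.reverse_reverse]
  obtain ⟨h₂, h₁, rfl, h2, h1⟩ := List.map_eq_append_iff.1 this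
  exact ⟨h₂, h₁, rfl, by simp [path, h1], by simp [path, h2]⟩

theorem IsPlay.isPath {G : WTG X} {c : G.Config} {h : List G.Move} (hp : G.IsPlay c h) :
    G.IsPath c.1 (path h) (G.last c h).1 := by
  induction h with
  | nil => rfl
  | cons m h ih =>
    rw [path_cons]
    exact G.isPath_append_singleton (ih hp.1) hp.2.2.1

/-! ### Bounds on weights -/

theorem locWeight_le {G : WTG X} [Finite G.Loc] (l : G.Loc) :
    |(G.locWeight l : ℝ)| ≤ ⨆ l, |(G.locWeight l : ℝ)| :=
  le_ciSup (f := fun l => |(G.locWeight l : ℝ)|) (Set.finite_range _).bddAbove l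

theorem edgeWeight_le {G : WTG X} [Finite G.Edge] (e : G.Edge) :
    |(G.edgeWeight e : ℝ)| ≤ ⨆ e, |(G.edgeWeight e : ℝ)| :=
  le_ciSup (f := fun e => |(G.edgeWeight e : ℝ)|) (Set.finite_range _).bddAbove e

theorem maxWeight_nonneg (G : WTG X) : 0 ≤ G.maxWeight :=
  add_nonneg (mul_nonneg (Nat.cast_nonneg _) (Real.iSup_nonneg fun _ => abs_nonneg _))
    (Real.iSup_nonneg fun _ => abs_nonneg _)

/-- Any clock bounds the delay, since it stays in `[0, bound)`. Without clocks delays would be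
unbounded. -/
theorem abs_moveWeight_le [Nonempty X] {G : WTG X} [Finite G.Loc] [Finite G.Edge] {c : G.Config}
    {m : G.Move} (hc : BoundedVal G.bound c.2) (h : G.Legal c m) :
    |G.moveWeight c m| ≤ G.maxWeight := by
  obtain ⟨x⟩ := ‹Nonempty X›
  have hd : |m.1| ≤ G.bound := by
    rw [abs_of_nonneg h.1]
    have h1 := (h.2.2.1 x).2
    have h2 := (hc x).1
    unfold elapse at h1
    linarith
  refine (abs_add_le _ _).trans (add_le_add ?_ (edgeWeight_le _))
  rw [abs_mul]
  exact mul_le_mul hd (locWeight_le _) (abs_nonneg _) (Nat.cast_nonneg _)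

/-! ### Plays of the region game -/

section RegionGame

variable {G : WTG X}

/-- The region of a state of the region game. -/
def stateRegion (s : G.regionGame.Loc) : Region X G.bound := Prod.snd s

/-- The middle region of an edge of the region game. -/
def midRegion (t : G.regionGame.Edge) : Region X G.bound := RegionEdge.mid t

variable (G) in
/-- Cycles of the region game. -/
def Cycle (s : G.regionGame.Loc) (p : List G.regionGame.Edge) : Prop :=
  p ≠ [] ∧ G.regionGame.IsPath s p s

variable (G) in
/-- The cumulative weights of the plays that follow a path of the region game. -/
def weights (s : G.regionGame.Loc) (p : List G.regionGame.Edge) : Set ℝ := G.followWeights s p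

variable (G) in
/-- The edges of the kernel, as a set of edges of the region game. -/
def kernel : Set G.regionGame.Edge := G.kernelEdges

/-- The configuration of `G` that underlies a configuration of its region game. -/
def baseConfig (c : G.regionGame.Config) : G.Config := (c.1.1, c.2)

/-- The move of `G` that underlies a move of its region game. -/
def baseMove (m : G.regionGame.Move) : G.Move := (m.1, m.2.edge)

/-- The valuation of the configuration belongs to the region of its state. -/
def InRegion (c : G.regionGame.Config) : Prop := c.2 ∈ (stateRegion c.1).1

theorem InRegion.bounded {c : G.regionGame.Config} (hc : InRegion c) : BoundedVal G.bound c.2 :=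
  (stateRegion c.1).bounded hc

theorem Legal.base {c : G.regionGame.Config} {m : G.regionGame.Move} (h : G.regionGame.Legal c m) :
    G.Legal (baseConfig c) (baseMove m) :=
  ⟨h.1, congrArg Prod.fst h.2.1, h.2.2.1, m.2.sat h.2.2.2⟩

theorem Legal.inRegion_step {c : G.regionGame.Config} {m : G.regionGame.Move}
    (h : G.regionGame.Legal c m) : InRegion (G.regionGame.step c m) := by
  exact (RegionEdge.reset_eq m.2).le (Set.mem_image_of_mem _ h.2.2.2)

theorem IsPlay.inRegion_last {c : G.regionGame.Config} {h : List G.regionGame.Move}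
    (hp : G.regionGame.IsPlay c h) (hc : InRegion c) : InRegion (G.regionGame.last c h) := by
  cases h with
  | nil => exact hc
  | cons m h => exact hp.2.inRegion_step

theorem Legal.exists_lift [Fintype X] (hG : G.Admissible) {c : G.regionGame.Config} {m : G.Move}
    (hc : InRegion c) (h : G.Legal (baseConfig c) m) :
    ∃ m', baseMove m' = m ∧ G.regionGame.Legal c m' := by
  let t : G.RegionEdge := ⟨m.2, stateRegion c.1, Region.mk _ h.2.2.1,
    Region.mk _ (Region.resetClocks_bounded _ h.2.2.1), ⟨_, hc, _, h.1, Region.mem_mk h.2.2.1⟩,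
    Region.subset_zone _ (hG.guard_zone _) (Region.mem_mk h.2.2.1) h.2.2.2,
    Region.image_resetClocks _ _ (Region.mem_mk h.2.2.1)⟩
  exact ⟨(m.1, t), rfl, h.1, Prod.ext h.2.1 rfl, h.2.2.1, Region.mem_mk h.2.2.1⟩

theorem exists_legal_of_src [Finite X] {c : G.regionGame.Config} (hc : InRegion c)
    {t : G.regionGame.Edge} (ht : G.regionGame.src t = c.1) : ∃ d, G.regionGame.Legal c (d, t) := by
  obtain ⟨ν, hν, d, hd, h⟩ := t.time_succ
  have hst : t.start = stateRegion c.1 := congrArg stateRegion ht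
  rw [hst] at hν
  obtain ⟨d', hd', h'⟩ := Region.exists_elapse_mem hν hc hd h
  exact ⟨d', hd', ht, Region.bounded _ h', h'⟩

instance [Finite X] [Finite G.Edge] : Finite G.regionGame.Edge := by
  refine Finite.of_injective (α := G.RegionEdge)
    (β := G.Edge × Region X G.bound × Region X G.bound × Region X G.bound)
    (fun t => (t.edge, t.start, t.mid, t.dest)) ?_
  rintro ⟨⟩ ⟨⟩ h
  simp only [Prod.mk.injEq] at h
  obtain ⟨rfl, rfl, rfl, rfl⟩ := h
  rfl

theorem exists_play_of_isPath [Finite X] {c : G.regionGame.Config} (hc : InRegion c)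
    {p : List G.regionGame.Edge} {s : G.regionGame.Loc} (hp : G.regionGame.IsPath c.1 p s) :
    ∃ h, G.regionGame.IsPlay c h ∧ path h = p := by
  induction p generalizing c with
  | nil => exact ⟨[], trivial, rfl⟩
  | cons t p ih =>
    obtain ⟨d, hd⟩ := exists_legal_of_src hc hp.1
    obtain ⟨h, hpl, hpath⟩ := ih (c := G.regionGame.step c (d, t)) hd.inRegion_step hp.2
    refine ⟨h ++ [(d, t)], (isPlay_append _ _ _ _).2 ⟨⟨trivial, hd⟩, hpl⟩, ?_⟩
    rw [path_append, hpath]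
    rfl

theorem abs_region_moveWeight_le [Fintype X] [Nonempty X] (hG : G.Admissible)
    {c : G.regionGame.Config} {m : G.regionGame.Move} (hc : InRegion c)
    (h : G.regionGame.Legal c m) : |G.regionGame.moveWeight c m| ≤ G.maxWeight := by
  have := hG.finite_loc
  have := hG.finite_edge
  exact abs_moveWeight_le (c := baseConfig c) hc.bounded h.base

theorem abs_cumWeight_le [Fintype X] [Nonempty X] (hG : G.Admissible)
    {c : G.regionGame.Config} {h : List G.regionGame.Move} (hc : InRegion c)
    (hp : G.regionGame.IsPlay c h) : |G.regionGame.cumWeight c h| ≤ h.length * G.maxWeight := by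
  induction h with
  | nil => simp [cumWeight]
  | cons m h ih =>
    rw [cumWeight_cons]
    refine (abs_add_le _ _).trans ?_
    have h1 := ih hp.1
    have h2 := abs_region_moveWeight_le hG (hp.1.inRegion_last hc) hp.2
    push_cast [List.length_cons]
    linarith

/-! ### Weights of the plays that follow a path -/

theorem IsPlay.mem_weights {c : G.regionGame.Config} {h : List G.regionGame.Move}
    (hc : InRegion c) (hp : G.regionGame.IsPlay c h) :
    G.regionGame.cumWeight c h ∈ G.weights c.1 (path h) :=
  ⟨c.2, hc, h, hp, rfl, rfl⟩

theorem weights_nonempty [Finite X] {s s' : G.regionGame.Loc} {p : List G.regionGame.Edge}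
    (hp : G.regionGame.IsPath s p s') : (G.weights s p).Nonempty := by
  obtain ⟨ν, hν⟩ := (stateRegion s).nonempty
  obtain ⟨h, hpl, rfl⟩ := exists_play_of_isPath (c := (s, ν)) hν hp
  exact ⟨_, IsPlay.mem_weights (c := (s, ν)) hν hpl⟩

theorem exists_add_of_mem_weights_append {s s' : G.regionGame.Loc} {p q : List G.regionGame.Edge}
    (hp : G.regionGame.IsPath s p s') {w : ℝ} (hw : w ∈ G.weights s (p ++ q)) :
    ∃ w₁ ∈ G.weights s p, ∃ w₂ ∈ G.weights s' q, w = w₁ + w₂ := by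
  obtain ⟨ν, hν, h, hpl, hpath, rfl⟩ := hw
  obtain ⟨h₂, h₁, rfl, rfl, rfl⟩ := path_eq_append hpath
  obtain ⟨hpl₁, hpl₂⟩ := (isPlay_append _ _ _ _).1 hpl
  obtain rfl := hpl₁.isPath.unique hp
  have hin : InRegion (G := G) (s, ν) := hν
  exact ⟨_, hpl₁.mem_weights hin, _, hpl₂.mem_weights (hpl₁.inRegion_last hin),
    cumWeight_append _ _ _ _⟩

theorem abs_le_of_mem_weights [Fintype X] [Nonempty X] (hG : G.Admissible)
    {s : G.regionGame.Loc} {p : List G.regionGame.Edge} {w : ℝ} (hw : w ∈ G.weights s p) :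
    |w| ≤ p.length * G.maxWeight := by
  obtain ⟨ν, hν, h, hpl, rfl, rfl⟩ := hw
  have := abs_cumWeight_le hG (c := (s, ν)) hν hpl
  simpa [path] using this

/-- Along fixed edges, the elapsed and reset valuations and the weights are affine in the starting
valuation and the delays, and the guards of the region game are convex. Averaging the delays
therefore gives a play. -/
theorem exists_convex_combination {s : G.regionGame.Loc} {ν ν' : X → ℝ} {a b : ℝ} (ha : 0 ≤ a)
    (hb : 0 ≤ b) (hab : a + b = 1) {h h' : List G.regionGame.Move}
    (hp : G.regionGame.IsPlay (s, ν) h) (hp' : G.regionGame.IsPlay (s, ν') h')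
    (heq : h.map Prod.snd = h'.map Prod.snd) :
    ∃ h'', G.regionGame.IsPlay (s, a • ν + b • ν') h'' ∧ h''.map Prod.snd = h.map Prod.snd ∧
      G.regionGame.last (s, ν) h = ((G.regionGame.last (s, ν') h').1,
        (G.regionGame.last (s, ν) h).2) ∧
      G.regionGame.last (s, a • ν + b • ν') h'' = ((G.regionGame.last (s, ν) h).1,
        a • (G.regionGame.last (s, ν) h).2 + b • (G.regionGame.last (s, ν') h').2) ∧
      G.regionGame.cumWeight (s, a • ν + b • ν') h'' =
        a * G.regionGame.cumWeight (s, ν) h + b * G.regionGame.cumWeight (s, ν') h' := by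
  induction h generalizing h' with
  | nil =>
    cases h' with
    | nil => exact ⟨[], trivial, rfl, rfl, rfl, by simp [cumWeight]⟩
    | cons m' h' => simp at heq
  | cons m h ih =>
    cases h' with
    | nil => simp at heq
    | cons m' h' =>
      obtain ⟨d, t⟩ := m
      obtain ⟨d', t'⟩ := m'
      simp only [List.map_cons, List.cons.injEq] at heq
      obtain ⟨rfl, heq⟩ := heq
      obtain ⟨h'', hp'', hmap, hloc, hlast, hcum⟩ := ih hp.1 hp'.1 heq
      have hel : elapse (a • (G.regionGame.last (s, ν) h).2 +
          b • (G.regionGame.last (s, ν') h').2) (a * d + b * d') =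
          a • elapse (G.regionGame.last (s, ν) h).2 d +
            b • elapse (G.regionGame.last (s, ν') h').2 d' := by
        funext x
        simp only [elapse, Pi.add_apply, Pi.smul_apply, smul_eq_mul]
        ring
      have hmem := (midRegion t).convex hp.2.2.2.2 hp'.2.2.2.2 ha hb hab
      have hloc1 := congrArg Prod.fst hloc
      refine ⟨(a * d + b * d', t) :: h'', ⟨hp'', ?_⟩, by simp [hmap], rfl, ?_, ?_⟩
      · have h1 := hp.2.1
        have h2 := hp'.2.1
        have h3 : 0 ≤ a * d + b * d' := by positivity
        rw [hlast]
        refine ⟨h3, hp.2.2.1, ?_, ?_⟩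
        · exact (midRegion t).bounded (hel ▸ hmem)
        · exact hel ▸ hmem
      · simp only [last, hlast, step]
        rw [hel]
        refine Prod.ext rfl ?_
        funext x
        by_cases hx : x ∈ G.regionGame.reset t <;> simp [resetClocks, hx]
      · rw [cumWeight_cons, cumWeight_cons, cumWeight_cons, hcum, hlast]
        simp only [moveWeight]
        rw [← hloc1]
        obtain rfl : b = 1 - a := by linarith
        ring

/-- The weights along a path form an interval. Since `(0, 1)` and `(-1, 0)` are forbidden on cycles,
all plays following a given cycle have weights of the same sign. -/
theorem mem_weights_of_between {s : G.regionGame.Loc} {p : List G.regionGame.Edge} {w w' x : ℝ}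
    (hw : w ∈ G.weights s p) (hw' : w' ∈ G.weights s p) (h₁ : w ≤ x) (h₂ : x ≤ w') :
    x ∈ G.weights s p := by
  obtain ⟨ν, hν, h, hpl, rfl, rfl⟩ := hw
  obtain ⟨ν', hν', h', hpl', hpath, rfl⟩ := hw'
  obtain ⟨a, b, ha, hb, hab, rfl⟩ := (segment_eq_Icc (h₁.trans h₂)).ge ⟨h₁, h₂⟩
  obtain ⟨h'', hpl'', hmap, -, -, hcum⟩ := exists_convex_combination ha hb hab hpl hpl'
    (List.reverse_injective hpath.symm)
  exact ⟨_, (stateRegion s).convex hν hν' ha hb hab, h'', hpl'', by rw [hmap], by rw [hcum]; rfl⟩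

/-! ### Cycles of almost-divergent games -/

/-- All the plays that follow the path have cumulative weight `0`. -/
def AllZero (s : G.regionGame.Loc) (p : List G.regionGame.Edge) : Prop := ∀ w ∈ G.weights s p, w = 0

theorem AllZero.append {s s' : G.regionGame.Loc} {p q : List G.regionGame.Edge}
    (hps : G.regionGame.IsPath s p s') (hp : AllZero s p) (hq : AllZero s' q) :
    AllZero s (p ++ q) := by
  intro w hw
  obtain ⟨w₁, h₁, w₂, h₂, rfl⟩ := exists_add_of_mem_weights_append hps hw
  rw [hp _ h₁, hq _ h₂, add_zero]

theorem AlmostDivergent.pos_of_pos (hdiv : G.AlmostDivergent) {s : G.regionGame.Loc}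
    {p : List G.regionGame.Edge} (hp : G.Cycle s p) {w w' : ℝ} (hw : w ∈ G.weights s p)
    (hw' : w' ∈ G.weights s p) (hpos : 0 < w) : 1 ≤ w' := by
  by_contra! hlt
  have h1 := (hdiv s p hp w hw).1
  have h2 := (hdiv s p hp w' hw').1
  have h3 : w' ≤ 0 := by
    rcases h2 with h | h | h <;> linarith
  have h4 : 1 ≤ w := by
    rcases h1 with h | h | h <;> linarith
  have h5 := (hdiv s p hp (1 / 2)
    (mem_weights_of_between hw' hw (by linarith) (by linarith))).1
  norm_num at h5

theorem AlmostDivergent.neg_of_neg (hdiv : G.AlmostDivergent) {s : G.regionGame.Loc}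
    {p : List G.regionGame.Edge} (hp : G.Cycle s p) {w w' : ℝ} (hw : w ∈ G.weights s p)
    (hw' : w' ∈ G.weights s p) (hneg : w < 0) : w' ≤ -1 := by
  by_contra! hlt
  have h1 := (hdiv s p hp w hw).1
  have h2 := (hdiv s p hp w' hw').1
  have h3 : 0 ≤ w' := by
    rcases h2 with h | h | h <;> linarith
  have h4 : w ≤ -1 := by
    rcases h1 with h | h | h <;> linarith
  have h5 := (hdiv s p hp (-(1 / 2))
    (mem_weights_of_between hw hw' (by linarith) (by linarith))).1
  norm_num at h5

theorem AlmostDivergent.allZero_of_zero (hdiv : G.AlmostDivergent) {s : G.regionGame.Loc}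
    {p : List G.regionGame.Edge} (hp : G.Cycle s p) (h0 : 0 ∈ G.weights s p) :
    AllZero s p := by
  intro w hw
  rcases lt_trichotomy w 0 with h | h | h
  · linarith [hdiv.neg_of_neg hp hw h0 h]
  · exact h
  · linarith [hdiv.pos_of_pos hp hw h0 h]

/-- The definition of almost-divergence needs one play of weight `0`; every region path is followed
by some play, so one is available. -/
theorem AllZero.decompose [Finite X] (hdiv : G.AlmostDivergent) {s s' : G.regionGame.Loc}
    {p₁ p₂ p₃ : List G.regionGame.Edge} (h0 : AllZero s (p₁ ++ p₂ ++ p₃)) (h₂ : p₂ ≠ []) (h₃ : p₃ ≠ [])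
    (hp₁ : G.regionGame.IsPath s p₁ s') (hp₂ : G.regionGame.IsPath s' p₂ s')
    (hp₃ : G.regionGame.IsPath s' p₃ s) : AllZero s' p₂ ∧ AllZero s' (p₃ ++ p₁) := by
  have hp : G.regionGame.IsPath s (p₁ ++ p₂ ++ p₃) s := by
    rw [isPath_append]
    exact ⟨s', (isPath_append _).2 ⟨s', hp₁, hp₂⟩, hp₃⟩
  obtain ⟨w, hw⟩ := weights_nonempty hp
  exact (hdiv s _ ⟨List.append_ne_nil_of_right_ne_nil _ h₃, hp⟩ w hw).2 (h0 w hw) s' p₁ p₂ p₃ rfl h₂ h₃ hp₁ hp₂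

/-- The square `p q p q` is again a `0`-cycle, and its decomposition `p (q p) q` exhibits `q p` as
an inner cycle. -/
theorem AllZero.rotate [Finite X] (hdiv : G.AlmostDivergent) {s s' : G.regionGame.Loc}
    {p q : List G.regionGame.Edge} (h0 : AllZero s (p ++ q)) (hp : G.regionGame.IsPath s p s')
    (hq : G.regionGame.IsPath s' q s) : AllZero s' (q ++ p) := by
  rcases eq_or_ne q [] with rfl | hne
  · obtain rfl : s' = s := hq
    simpa using h0
  · have hpq : G.regionGame.IsPath s (p ++ q) s := (isPath_append _).2 ⟨s', hp, hq⟩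
    have := AllZero.append hpq h0 h0
    rw [List.append_assoc, ← List.append_assoc q p q, ← List.append_assoc] at this
    exact (this.decompose hdiv (by simp [hne]) hne hp
      ((isPath_append _).2 ⟨s, hq, hp⟩) hq).1

theorem exists_split_of_not_nodup {α β : Type*} (f : α → β) {l : List α} (h : ¬ (l.map f).Nodup) :
    ∃ l₁ a l₂ b l₃, l = l₁ ++ (a :: l₂) ++ (b :: l₃) ∧ f a = f b := by
  induction l with
  | nil => simp at h
  | cons a l ih =>
    by_cases ha : f a ∈ l.map f
    · obtain ⟨b, hb, hab⟩ := List.mem_map.1 ha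
      obtain ⟨l₂, l₃, rfl⟩ := List.append_of_mem hb
      exact ⟨[], a, l₂, b, l₃, by simp, hab.symm⟩
    · have : ¬ (l.map f).Nodup := fun hn => h (List.nodup_cons.2 ⟨ha, hn⟩)
      obtain ⟨l₁, a', l₂, b, l₃, rfl, hab⟩ := ih this
      exact ⟨a :: l₁, a', l₂, b, l₃, by simp, hab⟩

/-- A cycle of weight `0` only uses edges of the kernel. -/
theorem AllZero.mem_kernelEdges [Finite X] (hdiv : G.AlmostDivergent) {s : G.regionGame.Loc}
    {p : List G.regionGame.Edge} (hp : G.Cycle s p) (h0 : AllZero s p) :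
    ∀ t ∈ p, t ∈ G.kernel := by
  induction hn : p.length using Nat.strong_induction_on generalizing s p with
  | _ n ih =>
  by_cases hnd : (p.map G.regionGame.src).Nodup
  · exact fun t ht => ⟨s, p, hp, hnd, h0, ht⟩
  -- A repeated state cuts the cycle into two strictly shorter cycles, both of weight `0` by
  -- almost-divergence.
  · obtain ⟨p₁, a, p₂, b, p₃, rfl, hab⟩ := exists_split_of_not_nodup _ hnd
    obtain ⟨k', h12, h3⟩ := (isPath_append _).1 hp.2
    obtain ⟨k, h1, h2⟩ := (isPath_append _).1 h12
    obtain rfl : k' = k := h3.1.symm.trans (hab.symm.trans h2.1)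
    obtain ⟨z2, z31⟩ := h0.decompose hdiv (by simp) (by simp) h1 h2 h3
    have i2 := ih _ (by rw [← hn]; simp; omega) ⟨by simp, h2⟩ z2 rfl
    have i31 := ih _ (by rw [← hn]; simp; omega)
      ⟨by simp, (isPath_append _).2 ⟨s, h3, h1⟩⟩ z31 rfl
    intro t ht
    simp only [List.mem_append] at ht i31
    rcases ht with (ht | ht) | ht
    · exact i31 t (Or.inr ht)
    · exact i2 t ht
    · exact i31 t (Or.inl ht)

/-- Each kernel edge can be undone by the rest of a `0`-cycle through it. Undoing the edges of `p`
from the last to the first gives `q`, and the nested cycles thus obtained have weight `0`. -/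
theorem exists_return_path [Finite X] (hdiv : G.AlmostDivergent) {s s' : G.regionGame.Loc}
    {p : List G.regionGame.Edge} (hp : G.regionGame.IsPath s p s') (hk : ∀ t ∈ p, t ∈ G.kernel) :
    ∃ q, G.regionGame.IsPath s' q s ∧ AllZero s (p ++ q) := by
  induction p generalizing s with
  | nil =>
    obtain rfl : s = s' := hp
    refine ⟨[], rfl, ?_⟩
    rintro w ⟨ν, -, h, -, hh, rfl⟩
    obtain rfl : h = [] := by simpa using hh
    rfl
  | cons t p ih =>
    obtain ⟨q, hq, hz⟩ := ih hp.2 fun t ht => hk t (List.mem_cons_of_mem _ ht)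
    obtain ⟨s₁, c, hc, hz', htc⟩ : ∃ s₁ c, G.Cycle s₁ c ∧ AllZero s₁ c ∧ t ∈ c := by
      obtain ⟨s₁, c, hc, -, hz', htc⟩ := hk t List.mem_cons_self
      exact ⟨s₁, c, hc, hz', htc⟩
    obtain ⟨c₁, c₂, rfl⟩ := List.append_of_mem htc
    obtain ⟨k, h1, h2⟩ := (isPath_append _).1 hc.2
    obtain rfl : k = s := h2.1.symm.trans hp.1
    have hr : G.regionGame.IsPath (G.regionGame.tgt t) (c₂ ++ c₁) k :=
      (isPath_append _).2 ⟨_, h2.2, h1⟩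
    have ht : G.regionGame.IsPath k [t] (G.regionGame.tgt t) := ⟨h2.1, rfl⟩
    have z1 : AllZero k ([t] ++ (c₂ ++ c₁)) := AllZero.rotate hdiv (p := c₁) (q := t :: c₂) hz' h1 h2
    have z2 := z1.rotate hdiv ht hr
    have z3 := AllZero.append ((isPath_append _).2 ⟨_, hp.2, hq⟩) hz z2
    rw [← List.append_assoc] at z3
    have hpq : G.regionGame.IsPath s' (q ++ (c₂ ++ c₁)) k :=
      (isPath_append _).2 ⟨_, hq, hr⟩
    refine ⟨_, hpq, ?_⟩
    have := z3.rotate hdiv (s' := k)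
      (by rw [List.append_assoc]; exact (isPath_append _).2 ⟨_, hp.2, hpq⟩) ht
    simpa using this

/-- Cycles in the kernel have weight `0`. -/
theorem allZero_of_kernel [Finite X] (hdiv : G.AlmostDivergent) {s : G.regionGame.Loc}
    {p : List G.regionGame.Edge} (hp : G.Cycle s p) (hk : ∀ t ∈ p, t ∈ G.kernel) :
    AllZero s p := by
  -- The given cycle is a factor of the `0`-cycle `p q`, so it has weight `0` too.
  obtain ⟨q, hq, hz⟩ := exists_return_path hdiv hp.2 hk
  rcases eq_or_ne q [] with rfl | hne
  · simpa using hz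
  · exact (AllZero.decompose (p₁ := []) hdiv (by simpa using hz) hp.1 hne rfl hp.2 hq).1

/-- There are no positive and negative cycles around the same state. -/
theorem not_pos_and_neg_cycle [Fintype X] [Nonempty X] (hG : G.Admissible)
    (hdiv : G.AlmostDivergent) {s : G.regionGame.Loc} {A B : List G.regionGame.Edge} (hA : G.Cycle s A)
    (hB : G.Cycle s B) (hApos : ∀ w ∈ G.weights s A, 1 ≤ w)
    (hBneg : ∀ w ∈ G.weights s B, w ≤ -1) : False := by
  -- A single play runs through `A` while its total is at most `0` and through `B` otherwise. Its
  -- totals then stay in `[-C, C]`, although the weights of `A` and `B` may change from one passage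
  -- to the next.
  let C : ℝ := (max A.length B.length : ℕ) * G.maxWeight
  have hW := G.maxWeight_nonneg
  have hC : ∀ p ∈ [A, B], ∀ w ∈ G.weights s p, |w| ≤ C := fun p hp w hw => by
    refine (abs_le_of_mem_weights hG hw).trans (mul_le_mul_of_nonneg_right ?_ hW)
    simp only [List.mem_cons, List.not_mem_nil, or_false] at hp
    rcases hp with rfl | rfl <;> exact_mod_cast by simp
  have hcyc : ∀ p ∈ [A, B], G.Cycle s p := fun p hp => by
    simp only [List.mem_cons, List.not_mem_nil, or_false] at hp
    rcases hp with rfl | rfl <;> assumption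
  have hne0 : ∀ p ∈ [A, B], ∀ w ∈ G.weights s p, w ≠ 0 := fun p hp w hw => by
    simp only [List.mem_cons, List.not_mem_nil, or_false] at hp
    rcases hp with rfl | rfl
    · linarith [hApos w hw]
    · linarith [hBneg w hw]
  have hstep : ∀ q : {q : (X → ℝ) × ℝ // q.1 ∈ (stateRegion s).1}, ∃ q' : {q : (X → ℝ) × ℝ // q.1 ∈ (stateRegion s).1},
      ∃ p ∈ [A, B], p = (if q.1.2 ≤ 0 then A else B) ∧ ∃ h, G.regionGame.IsPlay (s, q.1.1) h ∧
        path h = p ∧ G.regionGame.last (s, q.1.1) h = (s, q'.1.1) ∧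
        q'.1.2 = q.1.2 + G.regionGame.cumWeight (s, q.1.1) h := by
    rintro ⟨⟨ν, x⟩, hν⟩
    have hp : (if x ≤ 0 then A else B) ∈ [A, B] := by split_ifs <;> simp
    obtain ⟨h, hpl, hpath⟩ := exists_play_of_isPath (c := (s, ν)) hν (hcyc _ hp).2
    have hl : (G.regionGame.last (s, ν) h).1 = s :=
      hpl.isPath.unique (hpath ▸ (hcyc _ hp).2)
    have hin := hpl.inRegion_last (c := (s, ν)) hν
    unfold InRegion at hin
    rw [hl] at hin
    exact ⟨⟨(_, _), hin⟩, _, hp, rfl, h, hpl, hpath, Prod.ext hl rfl, rfl⟩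
  choose next hnext using hstep
  obtain ⟨ν₀, hν₀⟩ := (stateRegion s).nonempty
  let u : ℕ → {q : (X → ℝ) × ℝ // q.1 ∈ (stateRegion s).1} := fun n => next^[n] ⟨(ν₀, 0), hν₀⟩
  have hu : ∀ n, u (n + 1) = next (u n) := fun n => Function.iterate_succ_apply' _ _ _
  have hbound : ∀ n, |(u n).1.2| ≤ C := by
    intro n
    induction n with
    | zero => simpa [u] using mul_nonneg (Nat.cast_nonneg _) hW
    | succ n ih =>
      obtain ⟨p, hp, hpe, h, hpl, hpath, -, hx⟩ := hnext (u n)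
      rw [hu, hx]
      have hw := hpl.mem_weights (c := (s, (u n).1.1)) (u n).2
      rw [hpath] at hw
      have hwC := abs_le.1 (hC p hp _ hw)
      have ih := abs_le.1 ih
      rw [abs_le]
      split_ifs at hpe with hle
      · have := hApos _ (hpe ▸ hw)
        constructor <;> linarith
      · have := hBneg _ (hpe ▸ hw)
        constructor <;> linarith
  have hseg : ∀ i k, ∃ p ∈ [A, B], ∃ q, G.regionGame.IsPath s q s ∧
      ∃ h, G.regionGame.IsPlay (s, (u i).1.1) h ∧ path h = p ++ q ∧
        G.regionGame.last (s, (u i).1.1) h = (s, (u (i + (k + 1))).1.1) ∧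
        (u (i + (k + 1))).1.2 = (u i).1.2 + G.regionGame.cumWeight (s, (u i).1.1) h := by
    intro i k
    induction k with
    | zero =>
      obtain ⟨p, hp, -, h, hpl, hpath, hl, hx⟩ := hnext (u i)
      exact ⟨p, hp, [], rfl, h, hpl, by simp [hpath], by rw [hl, ← hu], by rw [← hx, ← hu]⟩
    | succ k ih =>
      obtain ⟨p, hp, q, hq, h, hpl, hpath, hl, hx⟩ := ih
      obtain ⟨p', hp', -, h', hpl', hpath', hl', hx'⟩ := hnext (u (i + (k + 1)))
      refine ⟨p, hp, q ++ p', (isPath_append _).2 ⟨s, hq, (hcyc p' hp').2⟩, h' ++ h,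
        (isPlay_append _ _ _ _).2 ⟨hpl, by rwa [hl]⟩, ?_, ?_, ?_⟩
      · rw [path_append, hpath, hpath', List.append_assoc]
      · rw [last_append, hl, hl', ← hu]; rfl
      · have := congrArg (fun q => q.1.2) (hu (i + (k + 1)))
        rw [cumWeight_append, hl]
        linarith!
  -- Any stretch of the play is a cycle around `s`. Weight `0` would force its first factor, `A` or
  -- `B`, to have weight `0`; hence the totals are pairwise at distance at least `1`.
  have hsep : ∀ i k, 1 ≤ |(u (i + (k + 1))).1.2 - (u i).1.2| := by
    intro i k
    obtain ⟨p, hp, q, hq, h, hpl, hpath, -, hx⟩ := hseg i k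
    have hw := hpl.mem_weights (c := (s, (u i).1.1)) (u i).2
    rw [hpath] at hw
    have hc : G.Cycle s (p ++ q) :=
      ⟨by simp [(hcyc p hp).1], (isPath_append _).2 ⟨s, (hcyc p hp).2, hq⟩⟩
    rw [hx, add_sub_cancel_left]
    rcases (hdiv s _ hc _ hw).1 with h1 | h1 | h1
    · exact le_abs.2 (Or.inr (by linarith))
    · exfalso
      obtain ⟨w, hw'⟩ := weights_nonempty (hcyc p hp).2
      rcases eq_or_ne q [] with rfl | hne
      · exact hne0 p hp _ (by simpa using hw) h1
      · have hz := hdiv.allZero_of_zero hc (h1 ▸ hw)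
        exact hne0 p hp w hw' ((AllZero.decompose (p₁ := []) hdiv (by simpa using hz)
          (hcyc p hp).1 hne rfl (hcyc p hp).2 hq).1 w hw')
    · exact le_abs.2 (Or.inl h1)
  -- Totals at distance at least `1` have distinct integral parts, but a bounded interval offers
  -- only finitely many.
  have hinj : Function.Injective fun n => ⌊(u n).1.2⌋ := by
    have key : ∀ i j, i < j → ⌊(u i).1.2⌋ ≠ ⌊(u j).1.2⌋ := fun i j hij he => by
      obtain ⟨k, rfl⟩ := Nat.exists_eq_add_of_lt hij
      have := Int.abs_sub_lt_one_of_floor_eq_floor he.symm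
      exact absurd (hsep i k) (not_le.2 this)
    intro i j hij
    rcases lt_trichotomy i j with h | h | h
    · exact absurd hij (key i j h)
    · exact h
    · exact absurd hij.symm (key j i h)
  refine Set.infinite_range_of_injective hinj ((Set.finite_Icc ⌊-C⌋ ⌊C⌋).subset ?_)
  rintro _ ⟨n, rfl⟩
  have := abs_le.1 (hbound n)
  exact ⟨Int.floor_mono this.1, Int.floor_mono this.2⟩

/-- A strongly connected component does not contain both positive and negative cycles. -/
theorem not_pos_and_neg [Fintype X] [Nonempty X] (hG : G.Admissible) (hdiv : G.AlmostDivergent)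
    {s s' : G.regionGame.Loc} {p p' q q' : List G.regionGame.Edge} (hp : G.Cycle s p)
    (hp' : G.Cycle s' p') (hq : G.regionGame.IsPath s q s') (hq' : G.regionGame.IsPath s' q' s)
    {w w' : ℝ} (hw : w ∈ G.weights s p) (hw' : w' ∈ G.weights s' p') (hpos : 0 < w)
    (hneg : w' < 0) : False := by
  -- Iterating the negative cycle makes its weight low enough to absorb the detour `q`, `q'` between
  -- the two states.
  have hpow : ∀ k : ℕ, ∃ P, G.regionGame.IsPath s' P s' ∧
      ∀ x ∈ G.weights s' (p' ++ P), x ≤ -(k + 1 : ℝ) := by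
    intro k
    induction k with
    | zero => exact ⟨[], rfl, fun x hx => by
        simpa using hdiv.neg_of_neg hp' hw' (by simpa using hx) hneg⟩
    | succ k ih =>
      obtain ⟨P, hP, hx⟩ := ih
      refine ⟨p' ++ P, (isPath_append _).2 ⟨s', hp'.2, hP⟩, fun x hxm => ?_⟩
      obtain ⟨x₁, h₁, x₂, h₂, rfl⟩ := exists_add_of_mem_weights_append hp'.2 hxm
      have := hdiv.neg_of_neg hp' hw' h₁ hneg
      have := hx _ h₂
      push_cast
      linarith
  obtain ⟨k, hk⟩ := exists_nat_ge (q.length * G.maxWeight + q'.length * G.maxWeight)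
  obtain ⟨P, hP, hx⟩ := hpow k
  have hpP : G.regionGame.IsPath s' (p' ++ P) s' := (isPath_append _).2 ⟨s', hp'.2, hP⟩
  refine not_pos_and_neg_cycle hG hdiv (B := q ++ ((p' ++ P) ++ q')) hp ⟨by simp [hp'.1], ?_⟩
    (fun w' hw' => hdiv.pos_of_pos hp hw hw' hpos) fun y hy => ?_
  · exact (isPath_append _).2 ⟨s', hq, (isPath_append _).2 ⟨s', hpP, hq'⟩⟩
  · obtain ⟨y₁, h₁, y₂, h₂, rfl⟩ := exists_add_of_mem_weights_append hq hy
    obtain ⟨y₃, h₃, y₄, h₄, rfl⟩ := exists_add_of_mem_weights_append hpP h₂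
    have b1 := abs_le.1 (abs_le_of_mem_weights hG h₁)
    have b4 := abs_le.1 (abs_le_of_mem_weights hG h₄)
    have b3 := hx _ h₃
    linarith

end RegionGame

end WTG

namespace WTG

variable {X : Type u}

/-! ### The value function -/

section Value

variable {G : WTG X}

variable (G) in
/-- The value of a configuration, when it is finite. -/
noncomputable def val (c : G.Config) : ℝ := sInf {a | G.Wins c a}

variable (G) in
/-- No configuration has an infinite value. -/
def NoInfiniteValue : Prop :=
  ∀ (l : G.Loc) (ν : X → ℝ), BoundedVal G.bound ν → ¬ G.HasValue (l, ν) ⊤ ∧ ¬ G.HasValue (l, ν) ⊥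

theorem NoInfiniteValue.exists_wins (hfin : G.NoInfiniteValue) {c : G.Config}
    (hc : BoundedVal G.bound c.2) : ∃ a, G.Wins c a :=
  exists_wins_of_not_hasValue_top (hfin c.1 c.2 hc).1

theorem NoInfiniteValue.bddBelow (hfin : G.NoInfiniteValue) {c : G.Config}
    (hc : BoundedVal G.bound c.2) : BddBelow {a | G.Wins c a} := by
  obtain ⟨a, ha⟩ := exists_not_wins_of_not_hasValue_bot (hfin c.1 c.2 hc).2
  exact ⟨a, fun b hb => not_lt.1 fun hlt => ha (hb.mono hlt.le)⟩

theorem NoInfiniteValue.wins_of_lt (hfin : G.NoInfiniteValue) {c : G.Config}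
    (hc : BoundedVal G.bound c.2) {a : ℝ} (ha : G.val c < a) : G.Wins c a := by
  obtain ⟨b, hb, hlt⟩ := exists_lt_of_csInf_lt (hfin.exists_wins hc) ha
  exact Wins.mono hb hlt.le

theorem NoInfiniteValue.val_le (hfin : G.NoInfiniteValue) {c : G.Config}
    (hc : BoundedVal G.bound c.2) {a : ℝ} (ha : G.Wins c a) : G.val c ≤ a :=
  csInf_le (hfin.bddBelow hc) ha

theorem NoInfiniteValue.hasValue (hfin : G.NoInfiniteValue) {c : G.Config}
    (hc : BoundedVal G.bound c.2) : G.HasValue c (G.val c) :=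
  hasValue_of_wins (fun _ ha => hfin.wins_of_lt hc ha)
    fun _ ha hw => absurd (hfin.val_le hc hw) (not_le.2 ha)

theorem wins_iff_of_mem_target {c : G.Config} (hc : c.1 ∈ G.target) {a : ℝ} :
    G.Wins c a ↔ G.finalWeight c.1 c.2 < a := by
  refine ⟨fun h => ?_, .target hc⟩
  cases h with
  | target _ h => exact h
  | min _ h => exact absurd hc h
  | max h => exact absurd hc h

/-- An infinite final weight would be an infinite value of the target configuration. -/
theorem NoInfiniteValue.finalWeight_eq (hfin : G.NoInfiniteValue) {c : G.Config}
    (hc : BoundedVal G.bound c.2) (ht : c.1 ∈ G.target) :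
    G.finalWeight c.1 c.2 = (G.val c : EReal) := by
  have hval : G.val c = sInf {a : ℝ | G.finalWeight c.1 c.2 < a} := by
    simp only [val, wins_iff_of_mem_target ht]
  have h1 := hfin.exists_wins hc
  simp only [wins_iff_of_mem_target ht] at h1
  have h2 : ∃ a : ℝ, ¬ G.finalWeight c.1 c.2 < a := by
    obtain ⟨a, ha⟩ := exists_not_wins_of_not_hasValue_bot (hfin c.1 c.2 hc).2
    exact ⟨a, fun h => ha (.target ht h)⟩
  generalize G.finalWeight c.1 c.2 = f at hval h1 h2 ⊢
  induction f with
  | bot =>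
    obtain ⟨a, ha⟩ := h2
    exact absurd (EReal.bot_lt_coe a) ha
  | coe x =>
    have : {a : ℝ | (x : EReal) < a} = Set.Ioi x := by
      ext a
      exact EReal.coe_lt_coe_iff
    rw [hval, this, csInf_Ioi]
  | top =>
    obtain ⟨a, ha⟩ := h1
    exact absurd ha not_top_lt

/-- With `exists_val_le_moveWeight_add`, this is one half of the optimality equations: the value
never exceeds the weight plus the next value along a Min move, nor, up to `ε`, along a suitable Max
move. -/
theorem val_le_moveWeight_add (hfin : G.NoInfiniteValue) {c : G.Config}
    (hc : BoundedVal G.bound c.2) (ht : c.1 ∉ G.target) (hm : c.1 ∈ G.minLoc) {m : G.Move}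
    (hl : G.Legal c m) : G.val c ≤ G.moveWeight c m + G.val (G.step c m) := by
  refine le_of_forall_gt_imp_ge_of_dense fun a ha => hfin.val_le hc (.min m ht hm hl ?_)
  exact hfin.wins_of_lt (Region.resetClocks_bounded _ hl.2.2.1) (by linarith)

theorem exists_val_le_moveWeight_add [Fintype X] (hG : G.Admissible) (hfin : G.NoInfiniteValue)
    {c : G.Config} (hc : BoundedVal G.bound c.2) (ht : c.1 ∉ G.target) (hm : c.1 ∉ G.minLoc)
    {ε : ℝ} (hε : 0 < ε) :
    ∃ m, G.Legal c m ∧ G.val c ≤ G.moveWeight c m + G.val (G.step c m) + ε := by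
  by_contra! hcon
  have : G.val c ≤ G.val c - ε := by
    refine hfin.val_le hc (.max ht hm (hG.no_deadlock c.1 ht c.2 hc) fun m hl => ?_)
    exact hfin.wins_of_lt (Region.resetClocks_bounded _ hl.2.2.1) (by linarith [hcon m hl])
  linarith

/-- Without this bound the supremum defining `maxFinalWeight` would take its default value `0` and
bound nothing. -/
theorem bddAbove_finalWeights [Fintype X] (hG : G.Admissible) :
    BddAbove {a | ∃ l ∈ G.target, ∃ ν, BoundedVal G.bound ν ∧ a = |(G.finalWeight l ν).toReal|} := by
  have := hG.finite_loc
  have key : ∀ l ∈ G.target, ∃ B, ∀ ν, BoundedVal G.bound ν → |(G.finalWeight l ν).toReal| ≤ B := by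
    intro l hl
    obtain ⟨k, E, F, hF⟩ := hG.final_affine l hl
    have hp : ∀ P : Piece X, ∃ B, ∀ ν, BoundedVal G.bound ν → |(P.eval ν).toReal| ≤ B := by
      rintro (a | _ | _)
      · refine ⟨∑ x, |(a.coeff x : ℝ)| * G.bound + |(a.const : ℝ)|, fun ν hν => ?_⟩
        rw [Piece.eval, EReal.toReal_coe]
        refine (abs_add_le _ _).trans (add_le_add_left ?_ _)
        refine (Finset.abs_sum_le_sum_abs _ _).trans (Finset.sum_le_sum fun x _ => ?_)
        rw [abs_mul, abs_of_nonneg (hν x).1]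
        exact mul_le_mul_of_nonneg_left (hν x).2.le (abs_nonneg _)
      · exact ⟨0, fun _ _ => by simp [Piece.eval]⟩
      · exact ⟨0, fun _ _ => by simp [Piece.eval]⟩
    choose B hB using hp
    obtain ⟨b, hb⟩ := (Set.finite_range fun σ => B (F σ)).bddAbove
    refine ⟨b, fun ν hν => ?_⟩
    rw [hF ν hν]
    exact (hB _ ν hν).trans (hb ⟨_, rfl⟩)
  choose! B hB using key
  obtain ⟨b, hb⟩ := (Set.finite_range B).bddAbove
  refine ⟨b, ?_⟩
  rintro _ ⟨l, hl, ν, hν, rfl⟩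
  exact (hB l hl ν hν).trans (hb ⟨l, rfl⟩)

theorem maxFinalWeight_nonneg (G : WTG X) : 0 ≤ G.maxFinalWeight := by
  refine Real.sSup_nonneg ?_
  rintro _ ⟨l, -, ν, -, rfl⟩
  exact abs_nonneg _

theorem abs_val_le_of_mem_target [Fintype X] (hG : G.Admissible) (hfin : G.NoInfiniteValue)
    {c : G.Config} (hc : BoundedVal G.bound c.2) (ht : c.1 ∈ G.target) :
    |G.val c| ≤ G.maxFinalWeight := by
  refine le_csSup (bddAbove_finalWeights hG) ⟨c.1, ht, c.2, hc, ?_⟩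
  rw [hfin.finalWeight_eq hc ht, EReal.toReal_coe]

end Value

/-! ### The upper bound on the value -/

/-- Each strict step adds an element, and a chain that stops once stops for good. -/
theorem eq_succ_of_monotone_chain {S : Type*} [Finite S] {A : ℕ → Set S} (hA : Monotone A)
    (hs : ∀ i, A i = A (i + 1) → A (i + 1) = A (i + 2)) :
    A (Nat.card S) = A (Nat.card S + 1) := by
  have key : ∀ i, A i ≠ A (i + 1) → i + 1 ≤ (A (i + 1)).ncard := by
    intro i
    induction i with
    | zero =>
      intro h
      have := Set.ncard_lt_ncard ((hA (Nat.le_add_right 0 1)).lt_of_ne h)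
      omega
    | succ i ih =>
      intro h
      have h1 := ih fun he => h (hs i he)
      have := Set.ncard_lt_ncard ((hA (Nat.le_add_right (i + 1) 1)).lt_of_ne h)
      omega
  by_contra hne
  have h1 := key _ hne
  have h2 := Set.ncard_le_card (A (Nat.card S + 1))
  omega

theorem subset_of_monotone_chain {S : Type*} [Finite S] {A : ℕ → Set S} (hA : Monotone A)
    (hs : ∀ i, A i = A (i + 1) → A (i + 1) = A (i + 2)) (i : ℕ) : A i ⊆ A (Nat.card S) := by
  have h : ∀ k, A (Nat.card S + k) = A (Nat.card S + (k + 1)) := fun k => by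
    induction k with
    | zero => exact eq_succ_of_monotone_chain hA hs
    | succ k ih => exact hs _ ih
  have h' : ∀ k, A (Nat.card S + k) = A (Nat.card S) := fun k => by
    induction k with
    | zero => rfl
    | succ k ih => rw [← h, ih]
  exact (hA (Nat.le_add_left i _)).trans (h' i).le

section Bounds

variable {G : WTG X}

/-- The region states from which Min can enforce that `A` or a target is reached in one turn. -/
def attractStep (A : Set G.regionGame.Loc) : Set G.regionGame.Loc :=
  {s | s ∈ G.regionGame.target ∨
    (s ∈ G.regionGame.minLoc ∧ ∃ t, G.regionGame.src t = s ∧ G.regionGame.tgt t ∈ A) ∨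
    (s ∉ G.regionGame.minLoc ∧ ∀ t, G.regionGame.src t = s → G.regionGame.tgt t ∈ A)}

theorem attractStep_mono : Monotone (attractStep (G := G)) := by
  rintro A B hAB s (h | ⟨h, t, ht, hA⟩ | ⟨h, hA⟩)
  · exact Or.inl h
  · exact Or.inr (Or.inl ⟨h, t, ht, hAB hA⟩)
  · exact Or.inr (Or.inr ⟨h, fun t ht => hAB (hA t ht)⟩)

variable (G) in
/-- The region states from which Min can enforce that a target is reached in less than `n` turns. -/
def attract (n : ℕ) : Set G.regionGame.Loc := attractStep^[n] ∅

theorem attract_succ (n : ℕ) : G.attract (n + 1) = attractStep (G.attract n) :=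
  Function.iterate_succ_apply' _ _ _

theorem attract_mono : Monotone G.attract :=
  Monotone.monotone_iterate_of_le_map attractStep_mono (Set.empty_subset _)

/-- The rank of a winning configuration may be infinite, but only finitely many region edges leave a
Max state, so the turns needed for their ends have a finite maximum. -/
theorem exists_mem_attract [Fintype X] (hG : G.Admissible) {c : G.Config} {a : ℝ}
    (hw : G.Wins c a) : ∀ c' : G.regionGame.Config, InRegion c' → baseConfig c' = c →
      ∃ n, c'.1 ∈ G.attract n := by
  have := hG.finite_edge
  induction hw with
  | target ht _ =>
    rintro c' - rfl
    exact ⟨1, by rw [attract_succ]; exact Or.inl ht⟩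
  | min m ht hm hl _ ih =>
    rintro c' hc' rfl
    obtain ⟨m', rfl, hl'⟩ := Legal.exists_lift hG hc' hl
    obtain ⟨n, hn⟩ := ih _ hl'.inRegion_step rfl
    refine ⟨n + 1, ?_⟩
    rw [attract_succ]
    exact Or.inr (Or.inl ⟨hm, m'.2, hl'.2.1, hn⟩)
  | max ht hm hl _ ih =>
    rintro c' hc' rfl
    have : ∀ t, ∃ n, G.regionGame.src t = c'.1 → G.regionGame.tgt t ∈ G.attract n := fun t => by
      by_cases ht : G.regionGame.src t = c'.1
      · obtain ⟨d, hd⟩ := exists_legal_of_src hc' ht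
        obtain ⟨n, hn⟩ := ih _ hd.base _ hd.inRegion_step rfl
        exact ⟨n, fun _ => hn⟩
      · exact ⟨0, fun h => absurd h ht⟩
    choose f hf using this
    obtain ⟨n, hn⟩ := (Set.finite_range f).bddAbove
    refine ⟨n + 1, ?_⟩
    rw [attract_succ]
    exact Or.inr (Or.inr ⟨hm, fun t ht => attract_mono (hn ⟨t, rfl⟩) (hf t ht)⟩)

/-- Min only chooses region edges, with any legal delay: each turn costs at most `maxWeight`, and
the final weight at most `maxFinalWeight`. -/
theorem wins_of_mem_attract [Fintype X] [Nonempty X] (hG : G.Admissible) (hfin : G.NoInfiniteValue)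
    {n : ℕ} : ∀ c : G.regionGame.Config, InRegion c → c.1 ∈ G.attract n → ∀ a : ℝ,
      n * G.maxWeight + G.maxFinalWeight < a → G.Wins (baseConfig c) a := by
  induction n with
  | zero => exact fun c _ h => absurd h (Set.notMem_empty _)
  | succ n ih =>
    intro c hc hmem a ha
    rw [attract_succ] at hmem
    push_cast at ha
    have hW := G.maxWeight_nonneg
    by_cases ht : (baseConfig c).1 ∈ G.target
    · refine .target ht ?_
      rw [hfin.finalWeight_eq hc.bounded ht, EReal.coe_lt_coe_iff]
      have := (abs_le.1 (abs_val_le_of_mem_target hG hfin (c := baseConfig c) hc.bounded ht)).2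
      have : 0 ≤ (n + 1) * G.maxWeight := by positivity
      linarith
    · have hstep : ∀ m, G.regionGame.Legal c m → G.regionGame.tgt m.2 ∈ G.attract n →
          G.Wins (G.step (baseConfig c) (baseMove m))
            (a - G.moveWeight (baseConfig c) (baseMove m)) := fun m hl hm => by
        refine ih (G.regionGame.step c m) hl.inRegion_step hm _ ?_
        have : G.moveWeight (baseConfig c) (baseMove m) ≤ G.maxWeight :=
          (abs_le.1 (abs_region_moveWeight_le hG hc hl)).2
        linarith
      rcases hmem with h | ⟨hm, t, hsrc, htgt⟩ | ⟨hm, hall⟩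
      · exact absurd h ht
      · obtain ⟨d, hd⟩ := exists_legal_of_src hc hsrc
        exact .min _ ht hm hd.base (hstep _ hd htgt)
      · refine .max ht hm (hG.no_deadlock _ ht _ hc.bounded) fun m hl => ?_
        obtain ⟨m', rfl, hl'⟩ := Legal.exists_lift hG hc hl
        exact hstep m' hl' (hall _ hl'.2.1)

instance [Finite X] [Finite G.Loc] : Finite G.regionGame.Loc :=
  inferInstanceAs (Finite (G.Loc × Region X G.bound))

variable (G) in
/-- A bound on the absolute value of the finite values. -/
noncomputable def valBound : ℝ := G.numRegionStates * G.maxWeight + G.maxFinalWeight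

theorem exists_baseConfig_eq {c : G.Config} (hc : BoundedVal G.bound c.2) :
    ∃ c', InRegion c' ∧ baseConfig c' = c :=
  ⟨((c.1, Region.mk c.2 hc), c.2), Region.mem_mk hc, rfl⟩

theorem val_le_valBound [Fintype X] [Nonempty X] (hG : G.Admissible) (hfin : G.NoInfiniteValue)
    {c : G.Config} (hc : BoundedVal G.bound c.2) : G.val c ≤ G.valBound := by
  have := hG.finite_loc
  obtain ⟨c', hc', rfl⟩ := exists_baseConfig_eq hc
  obtain ⟨a, ha⟩ := hfin.exists_wins hc
  obtain ⟨n, hn⟩ := exists_mem_attract hG ha c' hc' rfl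
  have hn' := subset_of_monotone_chain attract_mono
    (fun i h => by rw [attract_succ, attract_succ, ← h, ← attract_succ, ← h]) n hn
  exact le_of_forall_gt_imp_ge_of_dense fun b hb =>
    hfin.val_le hc (wins_of_mem_attract hG hfin c' hc' hn' b hb)

/-! ### The lower bound on the value -/

/-- If all the cycles of a play have a non-negative weight, its weight is bounded below. -/
theorem neg_card_mul_le_cumWeight [Fintype X] [Nonempty X] (hG : G.Admissible)
    {c : G.regionGame.Config} (hc : InRegion c) (h : List G.regionGame.Move)
    (S : Finset G.regionGame.Loc) (hp : G.regionGame.IsPlay c h)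
    (hS : ∀ h₁, h₁ <:+ h → (G.regionGame.last c h₁).1 ∈ S)
    (hcyc : ∀ h₂ h₁, h₂ ++ h₁ <:+ h →
      (G.regionGame.last c (h₂ ++ h₁)).1 = (G.regionGame.last c h₁).1 →
      0 ≤ G.regionGame.cumWeight (G.regionGame.last c h₁) h₂) :
    -(S.card * G.maxWeight) ≤ G.regionGame.cumWeight c h := by
  induction hn : h.length using Nat.strong_induction_on generalizing h S with
  | _ n ih =>
  have hW := G.maxWeight_nonneg
  -- The play is cut at the first visit of its final state: what follows is a cycle, of non-negative
  -- weight. Moves being listed newest first, prefixes of the play are suffixes of the list.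
  have hex : ∃ k, ∃ h₁, h₁ <:+ h ∧ h₁.length = k ∧
      (G.regionGame.last c h₁).1 = (G.regionGame.last c h).1 := ⟨_, h, List.suffix_rfl, rfl, rfl⟩
  obtain ⟨h₁, ⟨h₂, rfl⟩, hlen, hloc⟩ := Nat.find_spec hex
  have hmin := fun k (hk : k < Nat.find hex) => Nat.find_min hex hk
  have h2 := hcyc h₂ h₁ List.suffix_rfl hloc.symm
  rw [cumWeight_append]
  cases h₁ with
  | nil =>
    have : 0 ≤ S.card * G.maxWeight := by positivity
    have h0 : G.regionGame.cumWeight c [] = 0 := rfl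
    rw [h0]
    linarith
  | cons m h₁ =>
    have hpl := ((isPlay_append _ _ _ _).1 hp).1
    have hsuf : h₁ <:+ h₂ ++ m :: h₁ := (List.suffix_cons m h₁).trans (List.suffix_append _ _)
    have hy := hS _ List.suffix_rfl
    -- Before the move `m` the final state has not been visited, so it leaves `S`, which pays for
    -- the weight of `m`.
    have h1 := ih h₁.length (by rw [← hn]; simp; omega) h₁
      (S.erase (G.regionGame.last c (h₂ ++ m :: h₁)).1) hpl.1
      (fun h' hh' => Finset.mem_erase.2 ⟨fun he => ?_, hS h' (hh'.trans hsuf)⟩)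
      (fun a b hab => hcyc a b (hab.trans hsuf)) rfl
    · have hcard : ((S.erase (G.regionGame.last c (h₂ ++ m :: h₁)).1).card : ℝ) + 1 = S.card := by
        exact_mod_cast Finset.card_erase_add_one hy
      have h3 := (abs_le.1 (abs_region_moveWeight_le hG (hpl.1.inRegion_last hc) hpl.2)).1
      rw [cumWeight_cons, ← hcard]
      linarith
    · have hlt : h'.length < Nat.find hex := by
        rw [← hlen]
        have := hh'.length_le
        simp
        omega
      exact hmin _ hlt ⟨h', hh'.trans hsuf, rfl, he⟩

/-! ### Negative edges, and how Min can force their visits -/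

variable (G) in
/-- The edges outside the kernel that belong to a negative cycle. -/
def negEdges : Set G.regionGame.Edge :=
  {t | t ∉ G.kernel ∧ ∃ s p, G.Cycle s p ∧ t ∈ p ∧ ∃ w ∈ G.weights s p, w < 0}

theorem Cycle.exists_path {s s' : G.regionGame.Loc} {p p' : List G.regionGame.Edge}
    {t : G.regionGame.Edge} (hp : G.Cycle s p) (hp' : G.Cycle s' p') (ht : t ∈ p) (ht' : t ∈ p') :
    ∃ q, G.regionGame.IsPath s q s' := by
  obtain ⟨a, b, rfl⟩ := List.append_of_mem ht
  obtain ⟨a', b', rfl⟩ := List.append_of_mem ht'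
  obtain ⟨k, h1, h2⟩ := (isPath_append _).1 hp.2
  obtain ⟨k', h1', h2'⟩ := (isPath_append _).1 hp'.2
  exact ⟨a ++ t :: b', (isPath_append _).2 ⟨k, h1, h2.1, h2'.2⟩⟩

/-- Weight `0` would put the edge in the kernel, and positive weight would mix signs in the
component of the negative cycle through that edge. -/
theorem le_neg_one_of_mem_negEdges [Fintype X] [Nonempty X] (hG : G.Admissible)
    (hdiv : G.AlmostDivergent) {s : G.regionGame.Loc} {p : List G.regionGame.Edge}
    (hp : G.Cycle s p) {t : G.regionGame.Edge} (ht : t ∈ p) (hN : t ∈ G.negEdges) {w : ℝ}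
    (hw : w ∈ G.weights s p) : w ≤ -1 := by
  obtain ⟨hk, s', p', hp', ht', w', hw', hneg⟩ := hN
  rcases (hdiv s p hp w hw).1 with h | rfl | h
  · exact h
  · exact absurd ((hdiv.allZero_of_zero hp hw).mem_kernelEdges hdiv hp t ht) hk
  · obtain ⟨q, hq⟩ := hp.exists_path hp' ht ht'
    obtain ⟨q', hq'⟩ := hp'.exists_path hp ht' ht
    exact (not_pos_and_neg hG hdiv hp hp' hq hq' hw hw' (by linarith) hneg).elim

/-- A negative cycle without negative edges would lie in the kernel and have weight `0`. -/
theorem nonneg_of_notMem_negEdges [Fintype X] (hdiv : G.AlmostDivergent)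
    {s : G.regionGame.Loc} {p : List G.regionGame.Edge} (hp : G.Cycle s p)
    (hN : ∀ t ∈ p, t ∉ G.negEdges) {w : ℝ} (hw : w ∈ G.weights s p) : 0 ≤ w := by
  by_contra! hneg
  have hz : AllZero s p := allZero_of_kernel hdiv hp fun t ht => by
    by_contra hk
    exact hN t ht ⟨hk, s, p, hp, ht, w, hw, hneg⟩
  exact hneg.ne (hz w hw)

/-- The region states from which Min can enforce that an edge of `N` leads to `Z`. -/
inductive Force (G : WTG X) (N : Set G.regionGame.Edge) (Z : Set G.regionGame.Loc) :
    G.regionGame.Loc → Prop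
  | hit {s : G.regionGame.Loc} (t : G.regionGame.Edge) (hm : s ∈ G.regionGame.minLoc)
      (ht : G.regionGame.src t = s) (hN : t ∈ N) (hZ : G.regionGame.tgt t ∈ Z) : Force G N Z s
  | min {s : G.regionGame.Loc} (t : G.regionGame.Edge) (hm : s ∈ G.regionGame.minLoc)
      (ht : G.regionGame.src t = s) (h : Force G N Z (G.regionGame.tgt t)) : Force G N Z s
  | max {s : G.regionGame.Loc} (hT : s ∉ G.regionGame.target) (hm : s ∉ G.regionGame.minLoc)
      (h : ∀ t, G.regionGame.src t = s → ¬ (t ∈ N ∧ G.regionGame.tgt t ∈ Z) →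
        Force G N Z (G.regionGame.tgt t)) : Force G N Z s

theorem Force.mono {N : Set G.regionGame.Edge} {Z Z' : Set G.regionGame.Loc} (hZ : Z ⊆ Z')
    {s : G.regionGame.Loc} (h : G.Force N Z s) : G.Force N Z' s := by
  induction h with
  | hit t hm ht hN hZ' => exact .hit t hm ht hN (hZ hZ')
  | min t hm ht _ ih => exact .min t hm ht ih
  | max hT hm _ ih => exact .max hT hm fun t ht hn => ih t ht fun h => hn ⟨h.1, hZ h.2⟩

/-- Min follows the forcing choices while Max is almost optimal for `val`. The number of turns is
not fixed in advance, so half of the remaining error is spent at each turn. -/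
theorem Force.exists_play [Fintype X] (hG : G.Admissible) (hfin : G.NoInfiniteValue)
    {N : Set G.regionGame.Edge} {Z : Set G.regionGame.Loc} {s : G.regionGame.Loc}
    (h : G.Force N Z s) : ∀ c : G.regionGame.Config, InRegion c → c.1 = s → ∀ ε > 0,
      ∃ h, G.regionGame.IsPlay c h ∧ (∃ m ∈ h, m.2 ∈ N) ∧ (G.regionGame.last c h).1 ∈ Z ∧
        G.val (baseConfig c) ≤ G.regionGame.cumWeight c h +
          G.val (baseConfig (G.regionGame.last c h)) + ε := by
  have hone : ∀ (c : G.regionGame.Config) (m : G.regionGame.Move),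
      G.regionGame.cumWeight c [m] = G.regionGame.moveWeight c m := fun c m => by
    rw [cumWeight_cons]
    exact zero_add _
  have hcat : ∀ {c : G.regionGame.Config} {m : G.regionGame.Move} {ε : ℝ},
      G.regionGame.Legal c m →
      G.val (baseConfig c) ≤ G.regionGame.moveWeight c m +
        G.val (baseConfig (G.regionGame.step c m)) + ε / 2 →
      (∃ h, G.regionGame.IsPlay (G.regionGame.step c m) h ∧ (∃ m ∈ h, m.2 ∈ N) ∧
        (G.regionGame.last (G.regionGame.step c m) h).1 ∈ Z ∧
        G.val (baseConfig (G.regionGame.step c m)) ≤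
          G.regionGame.cumWeight (G.regionGame.step c m) h +
          G.val (baseConfig (G.regionGame.last (G.regionGame.step c m) h)) + ε / 2) →
      ∃ h, G.regionGame.IsPlay c h ∧ (∃ m ∈ h, m.2 ∈ N) ∧ (G.regionGame.last c h).1 ∈ Z ∧
        G.val (baseConfig c) ≤ G.regionGame.cumWeight c h +
          G.val (baseConfig (G.regionGame.last c h)) + ε := by
    rintro c m ε hl hv ⟨h, hpl, ⟨m', hm', hN⟩, hZ, hv'⟩
    have hlast : G.regionGame.last c (h ++ [m]) =
      G.regionGame.last (G.regionGame.step c m) h := last_append _ _ _ _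
    refine ⟨h ++ [m], (isPlay_append _ _ _ _).2 ⟨⟨trivial, hl⟩, hpl⟩,
      ⟨m', List.mem_append_left _ hm', hN⟩, hlast ▸ hZ, ?_⟩
    have hcum : G.regionGame.cumWeight c (h ++ [m]) = G.regionGame.moveWeight c m +
        G.regionGame.cumWeight (G.regionGame.step c m) h := by
      rw [cumWeight_append, hone]
      rfl
    rw [hlast, hcum]
    linarith
  induction h with
  | @hit s t hm ht hN hZ =>
    rintro c hc rfl ε hε
    obtain ⟨d, hd⟩ := exists_legal_of_src hc ht
    have hT : (baseConfig c).1 ∉ G.target := by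
      have := hG.src_notMem_target (baseMove (d, t)).2
      rwa [hd.base.2.1] at this
    have := val_le_moveWeight_add hfin (c := baseConfig c) hc.bounded hT hm hd.base
    refine ⟨[(d, t)], ⟨trivial, hd⟩, ⟨_, List.mem_singleton_self _, hN⟩, hZ, ?_⟩
    rw [hone]
    exact this.trans (le_add_of_nonneg_right hε.le)
  | min t hm ht _ ih =>
    rintro c hc rfl ε hε
    obtain ⟨d, hd⟩ := exists_legal_of_src hc ht
    have hT : (baseConfig c).1 ∉ G.target := by
      have := hG.src_notMem_target (baseMove (d, t)).2
      rwa [hd.base.2.1] at this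
    have := val_le_moveWeight_add hfin (c := baseConfig c) hc.bounded hT hm hd.base
    exact hcat hd (this.trans (le_add_of_nonneg_right (by positivity)))
      (ih _ hd.inRegion_step rfl (ε / 2) (by positivity))
  | max hT hm _ ih =>
    rintro c hc rfl ε hε
    obtain ⟨m, hl, hv⟩ := exists_val_le_moveWeight_add hG hfin (c := baseConfig c) hc.bounded hT hm
      (half_pos hε)
    obtain ⟨m, rfl, hl'⟩ := Legal.exists_lift hG hc hl
    by_cases hhit : m.2 ∈ N ∧ G.regionGame.tgt m.2 ∈ Z
    · refine ⟨[m], ⟨trivial, hl'⟩, ⟨_, List.mem_singleton_self _, hhit.1⟩, hhit.2, ?_⟩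
      rw [hone]
      exact hv.trans (add_le_add_right (half_le_self hε.le) _)
    · exact hcat hl' hv (ih _ hl'.2.1 hhit _ hl'.inRegion_step rfl (ε / 2) (by positivity))

end Bounds

end WTG

/-! ### Max bounds the number of negative edges: the lower bound on values -/

namespace WTG

variable {X : Type u}

section Bounds

variable {G : WTG X}

theorem Wins.region [Fintype X] (hG : G.Admissible) {c : G.Config} {a : ℝ} (hw : G.Wins c a) :
    ∀ c' : G.regionGame.Config, InRegion c' → baseConfig c' = c → G.regionGame.Wins c' a := by
  induction hw with
  | target ht h =>
    rintro c' - rfl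
    exact .target ht h
  | min m ht hm hl _ ih =>
    rintro c' hc' rfl
    obtain ⟨m', rfl, hl'⟩ := Legal.exists_lift hG hc' hl
    exact .min m' ht hm hl' (ih _ hl'.inRegion_step rfl)
  | max ht hm hl _ ih =>
    rintro c' hc' rfl
    refine .max ht hm ?_ fun m hl => ih _ hl.base _ hl.inRegion_step rfl
    obtain ⟨m, hl⟩ := hl
    obtain ⟨m', -, hl'⟩ := Legal.exists_lift hG hc' hl
    exact ⟨m', hl'⟩

/-- As no value is `-∞`, Min cannot enforce infinitely many visits of negative edges. -/
theorem eq_empty_of_subset_force [Fintype X] [Nonempty X] (hG : G.Admissible)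
    (hdiv : G.AlmostDivergent) (hfin : G.NoInfiniteValue) {Z : Set G.regionGame.Loc}
    (hZ : ∀ s ∈ Z, G.Force G.negEdges Z s) : Z = ∅ := by
  by_contra hne
  have := hG.finite_loc
  obtain ⟨s, hs⟩ := Set.nonempty_iff_ne_empty.2 hne
  obtain ⟨ν, hν⟩ := (stateRegion s).nonempty
  -- The `n`-th segment may lose `e n - e (n + 1)`, so that the errors telescope to less than `1/2`
  -- over any range.
  let e : ℕ → ℝ := fun n => (1 / 2) ^ (n + 1)
  have he : ∀ n, 0 < e n - e (n + 1) := fun n => by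
    simp only [e, pow_succ]
    have : (0 : ℝ) < (1 / 2) ^ n := by positivity
    linarith
  have he0 : ∀ n, 0 < e n := fun n => by positivity
  have he1 : ∀ n, e n ≤ 1 / 2 := fun n => by
    simp only [e, pow_succ]
    have : (1 / 2 : ℝ) ^ n ≤ 1 := pow_le_one₀ (by norm_num) (by norm_num)
    linarith
  have hstep : ∀ (n : ℕ) (q : {c : G.regionGame.Config // InRegion c ∧ c.1 ∈ Z}),
      ∃ q' : {c : G.regionGame.Config // InRegion c ∧ c.1 ∈ Z}, ∃ h,
        G.regionGame.IsPlay q.1 h ∧ (∃ m ∈ h, m.2 ∈ G.negEdges) ∧ G.regionGame.last q.1 h = q'.1 ∧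
        G.val (baseConfig q.1) ≤ G.regionGame.cumWeight q.1 h + G.val (baseConfig q'.1) +
          (e n - e (n + 1)) := by
    rintro n ⟨c, hc, hcZ⟩
    obtain ⟨h, hpl, hN, hlast, hv⟩ := (hZ _ hcZ).exists_play hG hfin c hc rfl _ (he n)
    exact ⟨⟨_, hpl.inRegion_last hc, hlast⟩, h, hpl, hN, rfl, hv⟩
  choose next hnext using hstep
  let u : ℕ → {c : G.regionGame.Config // InRegion c ∧ c.1 ∈ Z} :=
    fun n => Nat.rec ⟨(s, ν), hν, hs⟩ next n
  have hu : ∀ n, u (n + 1) = next n (u n) := fun _ => rfl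
  have hseg : ∀ i k, ∃ h, G.regionGame.IsPlay (u i).1 h ∧ (∃ m ∈ h, m.2 ∈ G.negEdges) ∧
      G.regionGame.last (u i).1 h = (u (i + (k + 1))).1 ∧
      G.val (baseConfig (u i).1) ≤ G.regionGame.cumWeight (u i).1 h +
        G.val (baseConfig (u (i + (k + 1))).1) + (e i - e (i + (k + 1))) := by
    intro i k
    induction k with
    | zero => exact hnext i (u i)
    | succ k ih =>
      obtain ⟨h, hpl, ⟨m, hm, hN⟩, hl, hv⟩ := ih
      obtain ⟨h', hpl', -, hl', hv'⟩ := hnext (i + (k + 1)) (u (i + (k + 1)))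
      refine ⟨h' ++ h, (isPlay_append _ _ _ _).2 ⟨hpl, by rwa [hl]⟩,
        ⟨m, List.mem_append_right _ hm, hN⟩, ?_, ?_⟩
      · rw [last_append, hl, hl']
        exact congrArg Subtype.val (hu _).symm
      · rw [cumWeight_append, hl]
        change _ ≤ _ + G.val (baseConfig (next (i + (k + 1)) (u (i + (k + 1)))).1) +
          (e i - e (i + (k + 1) + 1))
        linarith
  -- Between two visits of a recurring state `y` the play follows a cycle through a negative edge,
  -- of weight at most `-1`. The value must rise by at least `1/2` each time to compensate, and
  -- finally exceeds `valBound`.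
  obtain ⟨y, hy⟩ := Finite.exists_infinite_fiber fun n => (u n).1.1
  let g := Nat.orderEmbeddingOfSet ((fun n => (u n).1.1) ⁻¹' {y})
  have hg : ∀ n, (u (g n)).1.1 = y := fun n => by
    have : g n ∈ Set.range g := ⟨n, rfl⟩
    rw [Nat.orderEmbeddingOfSet_range] at this
    exact this
  have hinc : ∀ n, G.val (baseConfig (u (g n)).1) + 1 / 2 ≤
      G.val (baseConfig (u (g (n + 1))).1) := fun n => by
    obtain ⟨k, hk⟩ := Nat.exists_eq_add_of_lt (g.strictMono (Nat.lt_succ_self n))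
    obtain ⟨h, hpl, ⟨m, hm, hN⟩, hl, hv⟩ := hseg (g n) k
    rw [show g n + (k + 1) = g (n + 1) by rw [hk]; rfl] at hl hv
    have hcyc : G.Cycle (u (g n)).1.1 (path h) := by
      refine ⟨fun he => ?_, ?_⟩
      · have : m.2 ∈ path h := by simpa [path] using ⟨m.1, hm⟩
        simp [he] at this
      · have := hpl.isPath
        rw [hl, hg] at this
        rwa [hg] at this ⊢
    have hw := le_neg_one_of_mem_negEdges hG hdiv hcyc (t := m.2)
      (by simpa [path] using ⟨m.1, hm⟩) hN (hpl.mem_weights (u (g n)).2.1)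
    have h1 := he1 (g n)
    have h2 := he0 (g (n + 1))
    linarith
  have hlin : ∀ n : ℕ, G.val (baseConfig (u (g 0)).1) + n / 2 ≤
      G.val (baseConfig (u (g n)).1) := fun n => by
    induction n with
    | zero => simp
    | succ n ih =>
      have := hinc n
      push_cast
      linarith
  obtain ⟨n, hn⟩ := exists_nat_gt (2 * (G.valBound - G.val (baseConfig (u (g 0)).1)))
  have h1 := hlin n
  have h2 := val_le_valBound hG hfin (c := baseConfig (u (g n)).1) (u (g n)).2.1.bounded
  linarith

variable (G) in
/-- The region states from which Min can enforce that `n` negative edges are visited. -/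
def forceChain (n : ℕ) : Set G.regionGame.Loc :=
  (fun Z => {s | G.Force G.negEdges Z s})^[n] Set.univ

theorem mem_forceChain_succ {n : ℕ} {s : G.regionGame.Loc} :
    s ∈ G.forceChain (n + 1) ↔ G.Force G.negEdges (G.forceChain n) s := by
  rw [forceChain, Function.iterate_succ_apply']
  rfl

theorem forceChain_anti : Antitone G.forceChain :=
  Monotone.antitone_iterate_of_map_le (fun _ _ h _ hs => Force.mono h hs) (Set.subset_univ _)

/-- The decreasing chain is stationary from index `|R|` on. Its limit is a set from which Min can
force returns to it through negative edges forever, hence is empty. -/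
theorem exists_notMem_forceChain [Fintype X] [Nonempty X] (hG : G.Admissible)
    (hdiv : G.AlmostDivergent) (hfin : G.NoInfiniteValue) (s : G.regionGame.Loc) :
    ∃ n, s ∉ G.forceChain n := by
  have := hG.finite_loc
  have hsucc : ∀ i, G.forceChain (i + 1) = {s | G.Force G.negEdges (G.forceChain i) s} :=
    fun i => Set.ext fun s => mem_forceChain_succ
  have h := eq_succ_of_monotone_chain (A := fun n => (G.forceChain n)ᶜ)
    (fun a b hab => Set.compl_subset_compl.2 (forceChain_anti hab))
    (fun i h => by
      have h := compl_injective h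
      exact congrArg compl (by rw [hsucc (i + 1), ← h, ← hsucc i, ← h]))
  have h := compl_injective h
  refine ⟨Nat.card G.regionGame.Loc, fun hs => ?_⟩
  rw [eq_empty_of_subset_force hG hdiv hfin (Z := G.forceChain (Nat.card G.regionGame.Loc))] at hs
  · exact hs
  · intro s hs
    rw [h] at hs
    exact mem_forceChain_succ.1 hs

/-- The number of negative edges whose visit Min can enforce. -/
noncomputable def negRank (h : ∀ s, ∃ n, s ∉ G.forceChain n) (s : G.regionGame.Loc) : ℕ :=
  Nat.find (h s)

/-- The edges along which the rank does not increase, and decreases on negative edges. -/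
def RankDecreasing (h : ∀ s, ∃ n, s ∉ G.forceChain n) (t : G.regionGame.Edge) : Prop :=
  negRank h (G.regionGame.tgt t) ≤ negRank h (G.regionGame.src t) ∧
    (t ∈ G.negEdges → negRank h (G.regionGame.tgt t) < negRank h (G.regionGame.src t))

theorem rankDecreasing_of_not_force {h : ∀ s, ∃ n, s ∉ G.forceChain n} {t : G.regionGame.Edge}
    {n : ℕ} (hn : negRank h (G.regionGame.src t) = n + 1)
    (hhit : ¬ (t ∈ G.negEdges ∧ G.regionGame.tgt t ∈ G.forceChain n))
    (hf : ¬ G.Force G.negEdges (G.forceChain n) (G.regionGame.tgt t)) : RankDecreasing h t := by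
  refine ⟨?_, fun hN => ?_⟩
  · rw [hn]
    exact Nat.find_min' _ fun hm => hf (mem_forceChain_succ.1 hm)
  · rw [hn, Nat.lt_succ_iff]
    exact Nat.find_min' _ fun hm => hhit ⟨hN, hm⟩

theorem exists_negRank_eq_succ (h : ∀ s, ∃ n, s ∉ G.forceChain n) (s : G.regionGame.Loc) :
    ∃ n, negRank h s = n + 1 ∧ ¬ G.Force G.negEdges (G.forceChain n) s := by
  have hs : s ∉ G.forceChain (negRank h s) := Nat.find_spec (h s)
  rcases hn : negRank h s with _ | n
  · rw [hn] at hs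
    exact absurd (Set.mem_univ s) hs
  · rw [hn, mem_forceChain_succ] at hs
    exact ⟨n, rfl, hs⟩

theorem rankDecreasing_of_mem_minLoc (h : ∀ s, ∃ n, s ∉ G.forceChain n) {t : G.regionGame.Edge}
    (hm : G.regionGame.src t ∈ G.regionGame.minLoc) : RankDecreasing h t := by
  obtain ⟨n, hn, hf⟩ := exists_negRank_eq_succ h (G.regionGame.src t)
  exact rankDecreasing_of_not_force hn (fun hh => hf (.hit t hm rfl hh.1 hh.2))
    fun hh => hf (.min t hm rfl hh)

/-- If no edge were suitable, `Force.max` would put `s` in the set of the chain that its rank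
excludes. -/
theorem exists_rankDecreasing (h : ∀ s, ∃ n, s ∉ G.forceChain n) {s : G.regionGame.Loc}
    (hT : s ∉ G.regionGame.target) (hm : s ∉ G.regionGame.minLoc) :
    ∃ t, G.regionGame.src t = s ∧ RankDecreasing h t := by
  obtain ⟨n, hn, hf⟩ := exists_negRank_eq_succ h s
  by_contra! hcon
  refine hf (.max hT hm fun t ht hhit => ?_)
  by_contra hf'
  exact hcon t ht (rankDecreasing_of_not_force (ht ▸ hn) hhit hf')

theorem negRank_last_le (h : ∀ s, ∃ n, s ∉ G.forceChain n) {c : G.regionGame.Config}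
    {l : List G.regionGame.Move} (hp : G.regionGame.IsPlay c l)
    (hl : ∀ m ∈ l, RankDecreasing h m.2) :
    negRank h (G.regionGame.last c l).1 ≤ negRank h c.1 ∧ ((∃ m ∈ l, m.2 ∈ G.negEdges) →
      negRank h (G.regionGame.last c l).1 < negRank h c.1) := by
  induction l with
  | nil => exact ⟨le_rfl, by simp⟩
  | cons m l ih =>
    obtain ⟨i1, i2⟩ := ih hp.1 fun m hm => hl m (List.mem_cons_of_mem _ hm)
    obtain ⟨d1, d2⟩ := hl m List.mem_cons_self
    rw [hp.2.2.1] at d1 d2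
    refine ⟨d1.trans i1, ?_⟩
    rintro ⟨m', hm', hN⟩
    rcases List.mem_cons.1 hm' with rfl | hm'
    · exact (d2 hN).trans_le i1
    · exact d1.trans_lt (i2 ⟨m', hm', hN⟩)

/-- Max keeps to rank-decreasing edges. A cycle of the resulting play cannot contain a negative
edge, as the rank would drop strictly around it; so all its cycles are non-negative and its weight
is at least `-|R| W`. -/
theorem neg_valBound_le_val [Fintype X] [Nonempty X] (hG : G.Admissible)
    (hdiv : G.AlmostDivergent) (hfin : G.NoInfiniteValue) {c : G.Config}
    (hc : BoundedVal G.bound c.2) : -G.valBound ≤ G.val c := by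
  have := hG.finite_loc
  by_contra! hlt
  obtain ⟨c, hc', rfl⟩ := exists_baseConfig_eq hc
  have hr := exists_notMem_forceChain hG hdiv hfin
  obtain ⟨h, hpl, hI, hT, hf⟩ := Wins.exists_play (I := fun h => ∀ m ∈ h, RankDecreasing hr m.2)
    (fun h m hpl hI hT hm hl m' hm' => by
      rcases List.mem_cons.1 hm' with rfl | hm'
      · exact rankDecreasing_of_mem_minLoc hr (by rwa [hl.2.1])
      · exact hI m' hm')
    (fun h hpl hI hT hm _ => by
      obtain ⟨t, ht, hd⟩ := exists_rankDecreasing hr hT hm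
      obtain ⟨d, hl⟩ := exists_legal_of_src (hpl.inRegion_last hc') ht
      refine ⟨(d, t), hl, fun m' hm' => ?_⟩
      rcases List.mem_cons.1 hm' with rfl | hm'
      · exact hd
      · exact hI m' hm')
    ((hfin.wins_of_lt hc hlt).region hG c hc' rfl) (by simp)
  have hin := hpl.inRegion_last hc'
  have hfw := hfin.finalWeight_eq (c := baseConfig (G.regionGame.last c h)) hin.bounded hT
  have hval := (abs_le.1 (abs_val_le_of_mem_target hG hfin
    (c := baseConfig (G.regionGame.last c h)) hin.bounded hT)).1
  have hlt' : G.val (baseConfig (G.regionGame.last c h)) <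
      -G.valBound - G.regionGame.cumWeight c h := EReal.coe_lt_coe_iff.1 (hfw ▸ hf)
  have := Fintype.ofFinite G.regionGame.Loc
  have hcum := neg_card_mul_le_cumWeight hG hc' h Finset.univ hpl (fun _ _ => Finset.mem_univ _)
    fun h₂ h₁ hsuf hloc => by
      obtain ⟨h₃, rfl⟩ := hsuf
      rcases eq_or_ne h₂ [] with rfl | hne
      · exact le_rfl
      have hpl' := (isPlay_append _ _ _ _).1 ((isPlay_append _ _ _ _).1 hpl).1
      rw [last_append] at hloc
      refine nonneg_of_notMem_negEdges hdiv (s := (G.regionGame.last c h₁).1) (p := path h₂)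
        ⟨by simpa [path] using hne, ?_⟩ (fun t ht hN => ?_)
        (hpl'.2.mem_weights (hpl'.1.inRegion_last hc'))
      · have := hpl'.2.isPath
        rwa [hloc] at this
      · obtain ⟨m, hm, rfl⟩ : ∃ m ∈ h₂, m.2 = t := by simpa [path] using ht
        have := (negRank_last_le hr hpl'.2 fun m hm => hI m (by simp [hm])).2 ⟨m, hm, hN⟩
        rw [hloc] at this
        exact lt_irrefl _ this
  have hcard : ((Finset.univ : Finset G.regionGame.Loc).card : ℝ) = G.numRegionStates := by
    rw [Finset.card_univ, ← Nat.card_eq_fintype_card]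
    rfl
  rw [hcard] at hcum
  unfold valBound at hlt'
  linarith

end Bounds

end WTG

namespace WTG

variable {X : Type u}

/-! ### Finiteness of the semi-unfolding -/

theorem sum_count_eq_length {α : Type*} [Fintype α] [BEq α] [LawfulBEq α] (l : List α) :
    ∑ a, l.count a = l.length := by
  induction l with
  | nil => simp
  | cons b l ih => simp [List.count_cons, Finset.sum_add_distrib, ih]

section Unfolding

variable {G : WTG X} {s₀ : G.RegionState}

theorem two_le_unfoldBound (G : WTG X) : 2 ≤ G.unfoldBound := by
  have h1 := G.maxWeight_nonneg
  have h2 := G.maxFinalWeight_nonneg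
  have : 0 ≤ 3 * (G.numRegionStates : ℝ) * G.maxWeight := by positivity
  unfold unfoldBound
  linarith

theorem length_branchLabels (n : List G.RegionEdge) :
    (G.branchLabels s₀ n).length = n.length + 1 := by
  induction n with
  | nil => rfl
  | cons t n ih => rw [branchLabels, List.length_cons, ih, List.length_cons]

theorem count_branchLabels_cons (t : G.RegionEdge) (n : List G.RegionEdge) (s : G.RegionState) :
    (G.branchLabels s₀ (t :: n)).count s =
      (G.branchLabels s₀ n).count s + if G.entry s₀ (t :: n) = s then 1 else 0 := by
  rw [branchLabels, List.count_cons]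
  simp only [beq_iff_eq]

/-- The branch to the parent has exactly `n.length` labels, and as the parent is not a leaf, each
label occurs there fewer than `unfoldBound` times. -/
theorem IsNode.length_le [Finite X] [Finite G.Loc] {n : List G.RegionEdge} (hn : G.IsNode s₀ n) :
    (n.length : ℝ) ≤ G.numRegionStates * G.unfoldBound := by
  have := Fintype.ofFinite G.RegionState
  have h2 := G.two_le_unfoldBound
  cases n with
  | nil =>
    have : (0 : ℝ) ≤ G.numRegionStates * G.unfoldBound := by positivity
    simpa using this
  | cons t n =>
    have hleaf := hn.2.1
    simp only [IsLeaf, not_or, not_exists, not_le] at hleaf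
    have hsum : ((G.branchLabels s₀ n).length : ℝ) =
        ∑ s : G.RegionState, ((G.branchLabels s₀ n).count s : ℝ) := by
      rw [← Nat.cast_sum, sum_count_eq_length]
    rw [length_branchLabels] at hsum
    rw [List.length_cons, hsum]
    refine (Finset.sum_le_card_nsmul _ _ G.unfoldBound fun s _ => (hleaf.2 s).le).trans ?_
    rw [Finset.card_univ, ← Nat.card_eq_fintype_card, nsmul_eq_mul]
    rfl

theorem finite_nodes [Finite X] [Finite G.Loc] [Finite G.Edge] :
    {n : List G.RegionEdge | G.IsNode s₀ n}.Finite := by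
  have : Finite G.RegionEdge := inferInstanceAs (Finite G.regionGame.Edge)
  refine (List.finite_length_le G.RegionEdge ⌊G.numRegionStates * G.unfoldBound⌋₊).subset ?_
  exact fun n hn => Nat.le_floor (IsNode.length_le hn)

theorem finite_unfoldLoc [Finite X] [Finite G.Loc] [Finite G.Edge] : Finite (G.UnfoldLoc s₀) := by
  have : Finite G.RegionState := inferInstanceAs (Finite G.regionGame.Loc)
  have hfin : (({n : List G.RegionEdge | G.IsNode s₀ n} ×ˢ Set.univ :
      Set (List G.RegionEdge × G.RegionState))).Finite := finite_nodes.prod Set.finite_univ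
  exact (hfin.subset fun q hq => ⟨hq.1, trivial⟩).to_subtype

theorem finite_unfoldEdge [Finite X] [Finite G.Loc] [Finite G.Edge] :
    Finite (G.UnfoldEdge s₀) := by
  have : Finite G.RegionEdge := inferInstanceAs (Finite G.regionGame.Edge)
  have hfin : (({n : List G.RegionEdge | G.IsNode s₀ n} ×ˢ Set.univ :
      Set (List G.RegionEdge × G.RegionEdge))).Finite := finite_nodes.prod Set.finite_univ
  exact (hfin.subset fun q hq => ⟨hq.1, trivial⟩).to_subtype

/-! ### Plays of the semi-unfolding -/

/-- The node of the tree to which a location of the semi-unfolding belongs. -/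
def unfoldNode (q : (G.semiUnfolding s₀).Loc) : List G.RegionEdge := q.1.1

/-- The region state of which a location of the semi-unfolding is a copy. -/
def unfoldState (q : (G.semiUnfolding s₀).Loc) : G.regionGame.Loc := q.1.2

/-- The edge of the region game of which an edge of the semi-unfolding is a copy. -/
def unfoldEdge (e : (G.semiUnfolding s₀).Edge) : G.regionGame.Edge := e.1.2

/-- The configuration of the region game below a configuration of the semi-unfolding. -/
def projConfig (c : (G.semiUnfolding s₀).Config) : G.regionGame.Config := (unfoldState c.1, c.2)

/-- The move of the region game below a move of the semi-unfolding. -/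
def projMove (m : (G.semiUnfolding s₀).Move) : G.regionGame.Move := (m.1, unfoldEdge m.2)

theorem unfoldState_tgt (e : (G.semiUnfolding s₀).Edge) :
    unfoldState ((G.semiUnfolding s₀).tgt e) = G.regionGame.tgt (unfoldEdge e) := by
  change (G.unfoldTgt s₀ e).1.2 = _
  unfold unfoldTgt
  split_ifs <;> rfl

theorem unfoldNode_tgt_of_mem {e : (G.semiUnfolding s₀).Edge} (he : unfoldEdge e ∈ G.kernel) :
    unfoldNode ((G.semiUnfolding s₀).tgt e) = unfoldNode ((G.semiUnfolding s₀).src e) := by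
  have h : G.unfoldTgt s₀ e = _ := dif_pos he
  exact congrArg (fun q => q.1.1) h

theorem unfoldNode_tgt_of_notMem {e : (G.semiUnfolding s₀).Edge} (he : unfoldEdge e ∉ G.kernel) :
    unfoldNode ((G.semiUnfolding s₀).tgt e) =
      unfoldEdge e :: unfoldNode ((G.semiUnfolding s₀).src e) := by
  have h : G.unfoldTgt s₀ e = _ := dif_neg he
  exact congrArg (fun q => q.1.1) h

theorem projConfig_step (c : (G.semiUnfolding s₀).Config) (m : (G.semiUnfolding s₀).Move) :
    projConfig ((G.semiUnfolding s₀).step c m) =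
      G.regionGame.step (projConfig c) (projMove m) :=
  Prod.ext (unfoldState_tgt m.2) rfl

theorem Legal.proj {c : (G.semiUnfolding s₀).Config} {m : (G.semiUnfolding s₀).Move}
    (h : (G.semiUnfolding s₀).Legal c m) : G.regionGame.Legal (projConfig c) (projMove m) :=
  ⟨h.1, congrArg unfoldState h.2.1, h.2.2.1, h.2.2.2⟩

theorem Legal.exists_unfold {c : (G.semiUnfolding s₀).Config} {m : G.regionGame.Move}
    (hc : c.1 ∉ (G.semiUnfolding s₀).target) (h : G.regionGame.Legal (projConfig c) m) :
    ∃ m', projMove m' = m ∧ (G.semiUnfolding s₀).Legal c m' := by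
  have hs : G.regionGame.src m.2 = c.1.1.2 := h.2.1
  let e : G.UnfoldEdge s₀ := ⟨(c.1.1.1, m.2), c.1.2.1, hc, by
    change G.regionGame.src m.2 ∈ G.nodeStates s₀ c.1.1.1
    rw [hs]
    exact c.1.2.2⟩
  exact ⟨(m.1, e), rfl, h.1, Subtype.ext (Prod.ext rfl hs), h.2.2.1, h.2.2.2⟩

theorem projConfig_last (c : (G.semiUnfolding s₀).Config) (h : List (G.semiUnfolding s₀).Move) :
    projConfig ((G.semiUnfolding s₀).last c h) =
      G.regionGame.last (projConfig c) (h.map projMove) := by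
  induction h with
  | nil => rfl
  | cons m h ih => rw [last, projConfig_step, ih, List.map_cons, last]

theorem IsPlay.proj {c : (G.semiUnfolding s₀).Config} {h : List (G.semiUnfolding s₀).Move}
    (hp : (G.semiUnfolding s₀).IsPlay c h) :
    G.regionGame.IsPlay (projConfig c) (h.map projMove) := by
  induction h with
  | nil => trivial
  | cons m h ih => exact ⟨ih hp.1, projConfig_last c h ▸ hp.2.proj⟩

theorem cumWeight_proj (c : (G.semiUnfolding s₀).Config) (h : List (G.semiUnfolding s₀).Move) :
    (G.semiUnfolding s₀).cumWeight c h =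
      G.regionGame.cumWeight (projConfig c) (h.map projMove) := by
  induction h with
  | nil => rfl
  | cons m h ih =>
    rw [cumWeight_cons, ih, List.map_cons, cumWeight_cons, ← projConfig_last]
    rfl

theorem Legal.unfoldNode_step_of_mem {c : (G.semiUnfolding s₀).Config}
    {m : (G.semiUnfolding s₀).Move} (h : (G.semiUnfolding s₀).Legal c m)
    (hm : unfoldEdge m.2 ∈ G.kernel) :
    unfoldNode ((G.semiUnfolding s₀).step c m).1 = unfoldNode c.1 :=
  (unfoldNode_tgt_of_mem hm).trans (congrArg unfoldNode h.2.1)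

theorem Legal.unfoldNode_step_of_notMem {c : (G.semiUnfolding s₀).Config}
    {m : (G.semiUnfolding s₀).Move} (h : (G.semiUnfolding s₀).Legal c m)
    (hm : unfoldEdge m.2 ∉ G.kernel) :
    unfoldNode ((G.semiUnfolding s₀).step c m).1 = unfoldEdge m.2 :: unfoldNode c.1 :=
  (unfoldNode_tgt_of_notMem hm).trans (congrArg (unfoldEdge m.2 :: ·)
    (congrArg unfoldNode h.2.1))

theorem Legal.notMem_target {c : (G.semiUnfolding s₀).Config} {m : (G.semiUnfolding s₀).Move}
    (h : (G.semiUnfolding s₀).Legal c m) : c.1 ∉ (G.semiUnfolding s₀).target := by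
  rw [← h.2.1]
  exact m.2.2.2.1

/-- A kernel state lies on a cycle, so an edge leaves it, and no edge leaves a target. -/
theorem notMem_target_of_mem_kernelStates [Fintype X] (hG : G.Admissible) {s : G.RegionState}
    (hs : s ∈ G.kernelStates) : s.1 ∉ G.target := by
  have hsrc : ∀ t : G.regionGame.Edge, G.regionGame.src t ∉ G.regionGame.target := fun t =>
    hG.src_notMem_target (baseMove (0, t)).2
  obtain ⟨t, ⟨s', p, hp, -, -, ht⟩, rfl | rfl⟩ := hs
  · exact hsrc t
  · obtain ⟨a, b, rfl⟩ := List.append_of_mem ht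
    obtain ⟨k, h1, h2⟩ := (isPath_append (G := G.regionGame) (p := a) (q := t :: b)).1 hp.2
    cases b with
    | cons e b =>
      have := hsrc e
      rwa [h2.2.1] at this
    | nil =>
      have he : G.regionGame.tgt t = s' := h2.2
      change G.regionGame.tgt t ∉ G.regionGame.target
      rw [he]
      cases a with
      | nil =>
        have := hsrc t
        rwa [hp.2.1] at this
      | cons e a =>
        have := hsrc e
        rwa [hp.2.1] at this

theorem kernelPart_subset {s s' : G.RegionState} (hs : s ∈ G.kernelStates)
    (hs' : s' ∈ G.kernelPart s) : s' ∈ G.kernelStates := by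
  obtain ⟨p, hk, hp⟩ := hs'
  rcases List.eq_nil_or_concat p with rfl | ⟨p, t, rfl⟩
  · obtain rfl : s = s' := hp
    exact hs
  · rw [List.concat_eq_append] at hk hp
    obtain ⟨k, -, h2⟩ := (isPath_append (G := G.regionGame) (p := p) (q := [t])).1 hp
    exact ⟨t, hk t (by simp), Or.inr h2.2⟩

theorem unfoldState_notMem_target [Fintype X] (hG : G.Admissible) {q : (G.semiUnfolding s₀).Loc}
    (hq : q ∉ (G.semiUnfolding s₀).target) : unfoldState q ∉ G.regionGame.target := by
  rcases q.2.2 with ⟨_, hk, hp⟩ | ⟨h | _, h⟩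
  · exact notMem_target_of_mem_kernelStates hG (kernelPart_subset hk hp)
  · exact absurd h hq
  · intro ht
    refine hq (Or.inl ?_)
    rw [← h]
    exact ht

/-! ### Repetitions of labels along a branch -/

/-- Weight `0` would put all the edges of the cycle in the kernel; the sign is then that of the
component, since signs do not mix. -/
theorem cumWeight_of_cycle_notMem_kernel [Fintype X] [Nonempty X] (hG : G.Admissible)
    (hdiv : G.AlmostDivergent) {c : G.regionGame.Config} (hc : InRegion c)
    {h : List G.regionGame.Move} (hp : G.regionGame.IsPlay c h)
    (hlast : (G.regionGame.last c h).1 = c.1) {m : G.regionGame.Move} (hm : m ∈ h)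
    (hk : m.2 ∉ G.kernel) :
    (G.NonnegSCC c.1 → 1 ≤ G.regionGame.cumWeight c h) ∧
      (¬ G.NonnegSCC c.1 → G.regionGame.cumWeight c h ≤ -1) := by
  have hmp : m.2 ∈ path h := by simpa [path] using ⟨m.1, hm⟩
  have hcyc : G.Cycle c.1 (path h) := by
    refine ⟨List.ne_nil_of_mem hmp, ?_⟩
    have := hp.isPath
    rwa [hlast] at this
  have hw := hp.mem_weights hc
  have hne : G.regionGame.cumWeight c h ≠ 0 := fun h0 =>
    hk ((hdiv.allZero_of_zero hcyc (h0 ▸ hw)).mem_kernelEdges hdiv hcyc _ hmp)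
  refine ⟨fun hpos => ?_, fun hneg => ?_⟩
  · exact (hpos c.1 (path h) hcyc ⟨[], rfl⟩ ⟨[], rfl⟩ _ hw).resolve_left hne
  · unfold NonnegSCC at hneg
    push Not at hneg
    obtain ⟨s', p', hp', ⟨q, hq⟩, ⟨q', hq'⟩, w, hw', hw0, hw1⟩ := hneg
    have hwneg : w < 0 := by
      rcases (hdiv s' p' hp' w hw').1 with h | h | h
      · linarith
      · exact absurd h hw0
      · exact absurd h (not_le.2 hw1)
    rcases (hdiv c.1 (path h) hcyc _ hw).1 with h | h | h
    · exact h
    · exact absurd h hne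
    · exact (not_pos_and_neg hG hdiv hcyc hp' hq hq' hw hw' (by linarith) hwneg).elim

/-- The plays of the semi-unfolding that have just entered a node. -/
def IsEntry : List (G.semiUnfolding s₀).Move → Prop
  | [] => True
  | m :: _ => unfoldEdge m.2 ∉ G.kernel

variable (G s₀) in
/-- The initial configuration of the semi-unfolding with valuation `ν`. -/
def rootConfig (ν : X → ℝ) : (G.semiUnfolding s₀).Config := (G.unfoldRoot s₀, ν)

variable {ν₀ : X → ℝ}

theorem IsEntry.unfoldState_eq {h : List (G.semiUnfolding s₀).Move} (he : IsEntry h)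
    (hp : (G.semiUnfolding s₀).IsPlay (G.rootConfig s₀ ν₀) h) :
    unfoldState ((G.semiUnfolding s₀).last (G.rootConfig s₀ ν₀) h).1 =
      G.entry s₀ (unfoldNode ((G.semiUnfolding s₀).last (G.rootConfig s₀ ν₀) h).1) := by
  cases h with
  | nil => rfl
  | cons m h =>
    rw [last, hp.2.unfoldNode_step_of_notMem he]
    exact unfoldState_tgt m.2

theorem inRegion_last_root (hν₀ : ν₀ ∈ s₀.2.1) {h : List (G.semiUnfolding s₀).Move}
    (hp : (G.semiUnfolding s₀).IsPlay (G.rootConfig s₀ ν₀) h) :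
    InRegion (projConfig ((G.semiUnfolding s₀).last (G.rootConfig s₀ ν₀) h)) := by
  rw [projConfig_last]
  exact hp.proj.inRegion_last hν₀

/-- Between the first and the last nodes with the same label on a branch, the weight is large in
absolute value. -/
theorem exists_entry_of_count_pos [Fintype X] [Nonempty X] (hG : G.Admissible)
    (hdiv : G.AlmostDivergent) (hν₀ : ν₀ ∈ s₀.2.1) (h : List (G.semiUnfolding s₀).Move)
    (hp : (G.semiUnfolding s₀).IsPlay (G.rootConfig s₀ ν₀) h) (s : G.RegionState) {k : ℕ}
    (hk : (G.branchLabels s₀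
      (unfoldNode ((G.semiUnfolding s₀).last (G.rootConfig s₀ ν₀) h).1)).count s = k + 1) :
    ∃ h₁ h₂, h₁ <:+ h₂ ∧ h₂ <:+ h ∧ IsEntry h₁ ∧
      unfoldState ((G.semiUnfolding s₀).last (G.rootConfig s₀ ν₀) h₂).1 = s ∧
      (IsEntry h → unfoldState ((G.semiUnfolding s₀).last (G.rootConfig s₀ ν₀) h).1 = s →
        h₂ = h) ∧
      (G.NonnegSCC s → k ≤ (G.semiUnfolding s₀).cumWeight (G.rootConfig s₀ ν₀) h₂ -
        (G.semiUnfolding s₀).cumWeight (G.rootConfig s₀ ν₀) h₁) ∧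
      (¬ G.NonnegSCC s → (G.semiUnfolding s₀).cumWeight (G.rootConfig s₀ ν₀) h₂ -
        (G.semiUnfolding s₀).cumWeight (G.rootConfig s₀ ν₀) h₁ ≤ -k) := by
  induction h generalizing k with
  | nil =>
    have hk' : [s₀].count s = k + 1 := hk
    rw [List.count_singleton] at hk'
    split_ifs at hk' with hs
    · obtain rfl : k = 0 := by omega
      exact ⟨[], [], List.suffix_rfl, List.suffix_rfl, trivial, (eq_of_beq hs : s₀ = s),
        fun _ _ => rfl,
        fun _ => by simp, fun _ => by simp⟩
  | cons m h ih =>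
    by_cases hm : unfoldEdge m.2 ∈ G.kernel
    · rw [last, hp.2.unfoldNode_step_of_mem hm] at hk
      obtain ⟨h₁, h₂, h12, h2, he, hs, -, hw⟩ := ih hp.1 hk
      exact ⟨h₁, h₂, h12, h2.trans (List.suffix_cons m h), he, hs, fun hem => absurd hm hem, hw⟩
    · have hst : unfoldState ((G.semiUnfolding s₀).last (G.rootConfig s₀ ν₀) (m :: h)).1 =
        G.regionGame.tgt (unfoldEdge m.2) := unfoldState_tgt m.2
      rw [last, hp.2.unfoldNode_step_of_notMem hm] at hk
      replace hk := (count_branchLabels_cons _ _ _).symm.trans hk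
      split_ifs at hk with hs
      · have hs : G.regionGame.tgt (unfoldEdge m.2) = s := hs
        cases k with
        | zero =>
          exact ⟨m :: h, m :: h, List.suffix_rfl, List.suffix_rfl, hm, hst.trans hs,
            fun _ _ => rfl, fun _ => by simp, fun _ => by simp⟩
        | succ k =>
          obtain ⟨h₁, h₂, h12, ⟨g, rfl⟩, he, hs2, -, hw1, hw2⟩ := ih hp.1 (Nat.succ_injective hk)
          -- From the previous entry in a node labelled `s` to the present one, the play follows a
          -- cycle around `s` whose last edge is an output edge. Such a cycle contributes at least
          -- `1`, or at most `-1`.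
          have hp2 := (isPlay_append (G.semiUnfolding s₀) (G.rootConfig s₀ ν₀) (m :: g) h₂).1 hp
          have hin := inRegion_last_root hν₀ hp2.1
          have hcyc := cumWeight_of_cycle_notMem_kernel hG hdiv hin hp2.2.proj (m := projMove m)
            (by
              rw [← projConfig_last, ← last_append]
              exact (hst.trans hs).trans hs2.symm)
            (by simp) hm
          rw [← cumWeight_proj] at hcyc
          have hsc : (projConfig ((G.semiUnfolding s₀).last (G.rootConfig s₀ ν₀) h₂)).1 = s := hs2
          rw [hsc] at hcyc
          have hcum : (G.semiUnfolding s₀).cumWeight (G.rootConfig s₀ ν₀) (m :: (g ++ h₂)) = _ :=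
            cumWeight_append (G.semiUnfolding s₀) (G.rootConfig s₀ ν₀) (m :: g) h₂
          refine ⟨h₁, m :: (g ++ h₂), h12.trans (List.suffix_append (m :: g) h₂), List.suffix_rfl,
            he, hst.trans hs, fun _ _ => rfl, fun hN => ?_, fun hN => ?_⟩
          · have := hw1 hN
            have := hcyc.1 hN
            rw [hcum]
            push_cast
            linarith
          · have := hw2 hN
            have := hcyc.2 hN
            rw [hcum]
            push_cast
            linarith
      · obtain ⟨h₁, h₂, h12, h2, he, hs', -, hw⟩ := ih hp.1 hk
        refine ⟨h₁, h₂, h12, h2.trans (List.suffix_cons m h), he, hs', fun _ hs'' => ?_, hw⟩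
        exact absurd (hst.symm.trans hs'') hs

/-- Since the parent of a stopped leaf is not a leaf, the label that reaches the bound is that of
the leaf itself. Its occurrences delimit at least `unfoldBound - 1` cycles, all of the same sign. -/
theorem exists_entry_of_stopped_leaf [Fintype X] [Nonempty X] (hG : G.Admissible)
    (hdiv : G.AlmostDivergent) (hν₀ : ν₀ ∈ s₀.2.1) {h : List (G.semiUnfolding s₀).Move}
    (hp : (G.semiUnfolding s₀).IsPlay (G.rootConfig s₀ ν₀) h)
    (hleaf : ((G.semiUnfolding s₀).last (G.rootConfig s₀ ν₀) h).1 ∈ (G.semiUnfolding s₀).target)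
    (hT : unfoldState ((G.semiUnfolding s₀).last (G.rootConfig s₀ ν₀) h).1 ∉
      G.regionGame.target) :
    ∃ h₁, h₁ <:+ h ∧ IsEntry h₁ ∧
      (G.NonnegSCC (unfoldState ((G.semiUnfolding s₀).last (G.rootConfig s₀ ν₀) h).1) →
        G.unfoldBound - 1 ≤ (G.semiUnfolding s₀).cumWeight (G.rootConfig s₀ ν₀) h -
          (G.semiUnfolding s₀).cumWeight (G.rootConfig s₀ ν₀) h₁) ∧
      (¬ G.NonnegSCC (unfoldState ((G.semiUnfolding s₀).last (G.rootConfig s₀ ν₀) h).1) →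
        (G.semiUnfolding s₀).cumWeight (G.rootConfig s₀ ν₀) h -
          (G.semiUnfolding s₀).cumWeight (G.rootConfig s₀ ν₀) h₁ ≤ -(G.unfoldBound - 1)) := by
  have h2 := G.two_le_unfoldBound
  have hentry : IsEntry h := by
    cases h with
    | nil => trivial
    | cons m h =>
      intro hm
      refine hp.2.notMem_target ?_
      have : G.IsLeaf s₀ (unfoldNode _) := hleaf
      rw [last, hp.2.unfoldNode_step_of_mem hm] at this
      exact this
  have hst := hentry.unfoldState_eq hp
  have hleaf' : G.IsLeaf s₀
    (unfoldNode ((G.semiUnfolding s₀).last (G.rootConfig s₀ ν₀) h).1) := hleaf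
  rcases hleaf' with ht | ⟨s, hs⟩
  · rw [hst] at hT
    exact absurd ht hT
  · have hse : G.entry s₀ (unfoldNode ((G.semiUnfolding s₀).last (G.rootConfig s₀ ν₀) h).1) = s := by
      have hnode : G.IsNode s₀ (unfoldNode ((G.semiUnfolding s₀).last (G.rootConfig s₀ ν₀) h).1) :=
        ((G.semiUnfolding s₀).last (G.rootConfig s₀ ν₀) h).1.2.1
      revert hs hnode
      rcases unfoldNode ((G.semiUnfolding s₀).last (G.rootConfig s₀ ν₀) h).1 with _ | ⟨t, n⟩
      · intro hs _
        rw [branchLabels, List.count_singleton] at hs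
        split_ifs at hs with he
        · exact eq_of_beq he
        · norm_num at hs
          linarith
      · intro hs hnode
        rw [count_branchLabels_cons] at hs
        split_ifs at hs with he
        · exact he
        · exact absurd (Or.inr ⟨s, by simpa using hs⟩) hnode.2.1
    rw [hse] at hst
    obtain ⟨k, hk⟩ : ∃ k, (G.branchLabels s₀
        (unfoldNode ((G.semiUnfolding s₀).last (G.rootConfig s₀ ν₀) h).1)).count s = k + 1 := by
      refine Nat.exists_eq_succ_of_ne_zero fun h0 => ?_
      rw [h0] at hs
      norm_num at hs
      linarith
    obtain ⟨h₁, h₂, h12, -, he, -, heq, hw1, hw2⟩ :=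
      exists_entry_of_count_pos hG hdiv hν₀ h hp s hk
    obtain rfl := heq hentry hst
    rw [hk] at hs
    push_cast at hs
    rw [hst]
    refine ⟨h₁, h12, he, fun hN => ?_, fun hN => ?_⟩
    · linarith [hw1 hN]
    · linarith [hw2 hN]

end Unfolding

end WTG

namespace WTG

variable {X : Type u}

section Unfolding

variable {G : WTG X} {s₀ : G.RegionState} {ν₀ : X → ℝ}

/-! ### Equality of the values -/

variable (G s₀) in
/-- The cumulative weight of a play of the semi-unfolding plus the value in `G` of its last
configuration. -/
noncomputable def potential (ν₀ : X → ℝ) (h : List (G.semiUnfolding s₀).Move) : ℝ :=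
  (G.semiUnfolding s₀).cumWeight (G.rootConfig s₀ ν₀) h +
    G.val (baseConfig (projConfig ((G.semiUnfolding s₀).last (G.rootConfig s₀ ν₀) h)))

/-- At a stopped leaf, the potential differs by at least `1` from its value at some entry. -/
theorem exists_potential_gap [Fintype X] [Nonempty X] (hG : G.Admissible)
    (hdiv : G.AlmostDivergent) (hfin : G.NoInfiniteValue) (hν₀ : ν₀ ∈ s₀.2.1)
    {h : List (G.semiUnfolding s₀).Move}
    (hp : (G.semiUnfolding s₀).IsPlay (G.rootConfig s₀ ν₀) h)
    (hleaf : ((G.semiUnfolding s₀).last (G.rootConfig s₀ ν₀) h).1 ∈ (G.semiUnfolding s₀).target)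
    (hT : unfoldState ((G.semiUnfolding s₀).last (G.rootConfig s₀ ν₀) h).1 ∉
      G.regionGame.target) :
    ∃ h₁, h₁ <:+ h ∧ IsEntry h₁ ∧
      (G.NonnegSCC (unfoldState ((G.semiUnfolding s₀).last (G.rootConfig s₀ ν₀) h).1) →
        G.potential s₀ ν₀ h₁ + 1 ≤ G.potential s₀ ν₀ h) ∧
      (¬ G.NonnegSCC (unfoldState ((G.semiUnfolding s₀).last (G.rootConfig s₀ ν₀) h).1) →
        G.potential s₀ ν₀ h + 1 ≤ G.potential s₀ ν₀ h₁) := by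
  obtain ⟨h₁, ⟨g, rfl⟩, he, hw1, hw2⟩ := exists_entry_of_stopped_leaf hG hdiv hν₀ hp hleaf hT
  have hin := (inRegion_last_root hν₀ hp).bounded
  have hin₁ := (inRegion_last_root hν₀ ((isPlay_append _ _ _ _).1 hp).1).bounded
  have u := val_le_valBound hG hfin
    (c := baseConfig (projConfig ((G.semiUnfolding s₀).last (G.rootConfig s₀ ν₀) (g ++ h₁)))) hin
  have l := neg_valBound_le_val hG hdiv hfin
    (c := baseConfig (projConfig ((G.semiUnfolding s₀).last (G.rootConfig s₀ ν₀) (g ++ h₁)))) hin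
  have u₁ := val_le_valBound hG hfin
    (c := baseConfig (projConfig ((G.semiUnfolding s₀).last (G.rootConfig s₀ ν₀) h₁))) hin₁
  have l₁ := neg_valBound_le_val hG hdiv hfin
    (c := baseConfig (projConfig ((G.semiUnfolding s₀).last (G.rootConfig s₀ ν₀) h₁))) hin₁
  have hW : 0 ≤ G.numRegionStates * G.maxWeight := mul_nonneg (Nat.cast_nonneg _) G.maxWeight_nonneg
  -- This is the purpose of the constant in `unfoldBound`: the two values in the potentials account
  -- for at most `2 * valBound`, which leaves a gap of `1`.
  have hgap : 2 * G.valBound + 1 ≤ G.unfoldBound - 1 := by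
    unfold valBound unfoldBound
    linarith
  refine ⟨h₁, List.suffix_append _ _, he, fun hN => ?_, fun hN => ?_⟩
  · have := hw1 hN
    unfold potential
    linarith
  · have := hw2 hN
    unfold potential
    linarith

theorem unfolding_finalWeight_of_mem_target (hfin : G.NoInfiniteValue)
    {c : (G.semiUnfolding s₀).Config} (hc : InRegion (projConfig c))
    (hT : unfoldState c.1 ∈ G.regionGame.target) :
    (G.semiUnfolding s₀).finalWeight c.1 c.2 = (G.val (baseConfig (projConfig c)) : EReal) := by
  have h : (G.semiUnfolding s₀).finalWeight c.1 c.2 = G.finalWeight _ _ := if_pos hT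
  exact h.trans (hfin.finalWeight_eq (c := baseConfig (projConfig c)) hc.bounded hT)

theorem unfolding_finalWeight_of_nonneg {c : (G.semiUnfolding s₀).Config}
    (hT : unfoldState c.1 ∉ G.regionGame.target) (hN : G.NonnegSCC (unfoldState c.1)) :
    (G.semiUnfolding s₀).finalWeight c.1 c.2 = ⊤ :=
  (if_neg hT).trans (if_pos hN)

theorem unfolding_finalWeight_of_not_nonneg {c : (G.semiUnfolding s₀).Config}
    (hT : unfoldState c.1 ∉ G.regionGame.target) (hN : ¬ G.NonnegSCC (unfoldState c.1)) :
    (G.semiUnfolding s₀).finalWeight c.1 c.2 = ⊥ :=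
  (if_neg hT).trans (if_neg hN)

/-- Max secures the value of `G` in the semi-unfolding, by playing almost optimally at each turn. -/
theorem not_wins_unfolding [Fintype X] [Nonempty X] (hG : G.Admissible)
    (hdiv : G.AlmostDivergent) (hfin : G.NoInfiniteValue) (hν₀ : ν₀ ∈ s₀.2.1) {a : ℝ}
    (ha : a < G.val (s₀.1, ν₀)) : ¬ (G.semiUnfolding s₀).Wins (G.rootConfig s₀ ν₀) a := by
  intro hw
  obtain ⟨δ, hδ, hδ1, hδa⟩ : ∃ δ : ℝ, 0 < δ ∧ δ ≤ 1 / 2 ∧ a ≤ G.val (s₀.1, ν₀) - δ :=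
    ⟨min (1 / 2) (G.val (s₀.1, ν₀) - a), lt_min (by norm_num) (sub_pos.2 ha), min_le_left _ _,
      by linarith [min_le_right (1 / 2) (G.val (s₀.1, ν₀) - a)]⟩
  -- At turn `n` Max may lose `e n / 2 = e n - e (n + 1)`, so the total loss stays below `δ`.
  let e : ℕ → ℝ := fun n => δ * (1 / 2) ^ n
  have he0 : ∀ n, 0 < e n := fun n => by positivity
  have he1 : ∀ n, e n ≤ δ := fun n =>
    mul_le_of_le_one_right hδ.le (pow_le_one₀ (by norm_num) (by norm_num))
  have hes : ∀ n, e (n + 1) = e n / 2 := fun n => by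
    simp only [e, pow_succ]
    ring
  let T := G.semiUnfolding s₀
  have hcons : ∀ (h : List T.Move) (m : T.Move),
      (∀ h₁, h₁ <:+ h → G.potential s₀ ν₀ h₁ - e h₁.length ≤ G.potential s₀ ν₀ h - e h.length) →
      G.val (baseConfig (projConfig (T.last (G.rootConfig s₀ ν₀) h))) ≤
        T.moveWeight (T.last (G.rootConfig s₀ ν₀) h) m +
          G.val (baseConfig (projConfig (T.last (G.rootConfig s₀ ν₀) (m :: h)))) +
          e h.length / 2 →
      ∀ h₁, h₁ <:+ m :: h → G.potential s₀ ν₀ h₁ - e h₁.length ≤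
        G.potential s₀ ν₀ (m :: h) - e (m :: h).length := by
    intro h m hI hv h₁ hh₁
    rcases List.suffix_cons_iff.1 hh₁ with rfl | hh₁
    · exact le_rfl
    · have h1 := hI h₁ hh₁
      have h2 : G.potential s₀ ν₀ (m :: h) = T.cumWeight (G.rootConfig s₀ ν₀) h +
        T.moveWeight (T.last (G.rootConfig s₀ ν₀) h) m +
          G.val (baseConfig (projConfig (T.last (G.rootConfig s₀ ν₀) (m :: h)))) := rfl
      have h3 : G.potential s₀ ν₀ h = T.cumWeight (G.rootConfig s₀ ν₀) h +
          G.val (baseConfig (projConfig (T.last (G.rootConfig s₀ ν₀) h))) := rfl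
      rw [h2, List.length_cons, hes]
      linarith
  -- The invariant compares the present with every earlier moment, and not only with the root,
  -- because the potential gap refers to an intermediate entry.
  obtain ⟨h, hp, hI, hleaf, hf⟩ := Wins.exists_play
    (I := fun h : List T.Move => ∀ h₁, h₁ <:+ h →
      G.potential s₀ ν₀ h₁ - e h₁.length ≤ G.potential s₀ ν₀ h - e h.length)
    (fun h m hp hI hT hm hl => hcons h m hI (by
      have hl' : T.Legal _ m := hl
      rw [last, projConfig_step]
      have := val_le_moveWeight_add hfin (c := baseConfig (projConfig _))
        (inRegion_last_root hν₀ hp).bounded (unfoldState_notMem_target hG hT) hm hl.proj.base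
      exact this.trans (le_add_of_nonneg_right (by linarith [he0 h.length]))))
    (fun h hp hI hT hm _ => by
      have hin := inRegion_last_root hν₀ hp
      obtain ⟨m, hl, hv⟩ := exists_val_le_moveWeight_add hG hfin (c := baseConfig (projConfig _))
        hin.bounded (unfoldState_notMem_target hG hT) hm (half_pos (he0 h.length))
      obtain ⟨m, rfl, hl₁⟩ := Legal.exists_lift hG hin hl
      obtain ⟨m, rfl, hl₂⟩ := Legal.exists_unfold hT hl₁
      refine ⟨m, hl₂, hcons h m hI ?_⟩
      rw [last, projConfig_step]
      exact hv)
    hw (by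
      intro h₁ hh₁
      rw [List.suffix_nil.1 hh₁])
  have hin := inRegion_last_root hν₀ hp
  by_cases hT : unfoldState ((G.semiUnfolding s₀).last (G.rootConfig s₀ ν₀) h).1 ∈
      G.regionGame.target
  · rw [unfolding_finalWeight_of_mem_target hfin hin hT, EReal.coe_lt_coe_iff] at hf
    have h0 := hI [] List.nil_suffix
    have hroot : G.potential s₀ ν₀ [] = G.val (s₀.1, ν₀) := zero_add _
    have h1 := he1 ([] : List T.Move).length
    have h2 := he0 h.length
    rw [hroot] at h0
    unfold potential at h0
    linarith
  · by_cases hN : G.NonnegSCC (unfoldState ((G.semiUnfolding s₀).last (G.rootConfig s₀ ν₀) h).1)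
    · rw [unfolding_finalWeight_of_nonneg hT hN] at hf
      exact not_top_lt hf
    -- At a `-∞` leaf the potential would have dropped by `1`, more than the allowed `δ ≤ 1 / 2`.
    · obtain ⟨h₁, hsuf, -, -, hgap⟩ := exists_potential_gap hG hdiv hfin hν₀ hp hleaf hT
      have h0 := hI h₁ hsuf
      have h1 := he1 h₁.length
      have h2 := he0 h.length
      linarith [hgap hN]

/-- Min secures the value of `G` in the semi-unfolding, up to any error: at the entry of each node,
the budget is set to the value plus a small error. -/
theorem wins_unfolding [Fintype X] [Nonempty X] (hG : G.Admissible)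
    (hdiv : G.AlmostDivergent) (hfin : G.NoInfiniteValue) (hν₀ : ν₀ ∈ s₀.2.1) {a : ℝ}
    (ha : G.val (s₀.1, ν₀) < a) : (G.semiUnfolding s₀).Wins (G.rootConfig s₀ ν₀) a := by
  have := hG.finite_loc
  obtain ⟨K, hK⟩ : ∃ K : ℕ, ∀ q : (G.semiUnfolding s₀).Loc, (unfoldNode q).length ≤ K :=
    ⟨⌊G.numRegionStates * G.unfoldBound⌋₊, fun q => Nat.le_floor (IsNode.length_le q.2.1)⟩
  -- One error `ε` is paid per output edge, hence at most `ε * K` in all: less than the margin of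
  -- `a` over the value, and at most half of the potential gap.
  obtain ⟨ε, hε, hε1, hεa⟩ : ∃ ε : ℝ, 0 < ε ∧ ε * K ≤ 1 / 2 ∧ G.val (s₀.1, ν₀) + ε * K < a := by
    have hpos : (0 : ℝ) < K + 1 := by positivity
    have hδ : 0 < min (1 / 2) (a - G.val (s₀.1, ν₀)) := lt_min (by norm_num) (sub_pos.2 ha)
    refine ⟨min (1 / 2) (a - G.val (s₀.1, ν₀)) / (K + 1), by positivity, ?_, ?_⟩ <;>
      rw [div_mul_eq_mul_div]
    · rw [div_le_iff₀ hpos]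
      have := min_le_left (1 / 2) (a - G.val (s₀.1, ν₀))
      nlinarith
    · rw [← lt_sub_iff_add_lt', div_lt_iff₀ hpos]
      have := min_le_right (1 / 2) (a - G.val (s₀.1, ν₀))
      nlinarith
  let T := G.semiUnfolding s₀
  let N : List T.Move → List G.RegionEdge :=
    fun h => unfoldNode (T.last (G.rootConfig s₀ ν₀) h).1
  have hroot : G.potential s₀ ν₀ [] = G.val (s₀.1, ν₀) := zero_add _
  -- Induction on the depth left below the node just entered. The potential corrected by `ε` times
  -- the depth is required not to exceed its value at any earlier entry.
  suffices H : ∀ (k : ℕ) (h : List T.Move), K - (N h).length = k →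
      T.IsPlay (G.rootConfig s₀ ν₀) h → IsEntry h →
      (∀ h₁, h₁ <:+ h → IsEntry h₁ → G.potential s₀ ν₀ h - ε * (N h).length ≤
        G.potential s₀ ν₀ h₁ - ε * (N h₁).length) →
      T.Wins (T.last (G.rootConfig s₀ ν₀) h) (a - T.cumWeight (G.rootConfig s₀ ν₀) h) by
    have := H _ [] rfl trivial trivial fun h₁ hh₁ _ => by rw [List.suffix_nil.1 hh₁]
    have h0 : T.cumWeight (G.rootConfig s₀ ν₀) [] = 0 := rfl
    rwa [h0, sub_zero] at this
  intro k
  induction k using Nat.strong_induction_on with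
  | _ k ih =>
  intro h hk hp he htight
  have hin := inRegion_last_root hν₀ hp
  have hNK : ε * (N h).length ≤ ε * K :=
    mul_le_mul_of_nonneg_left (by exact_mod_cast hK _) hε.le
  by_cases hleaf : (T.last (G.rootConfig s₀ ν₀) h).1 ∈ T.target
  · refine .target hleaf ?_
    by_cases hT : unfoldState (T.last (G.rootConfig s₀ ν₀) h).1 ∈ G.regionGame.target
    · rw [unfolding_finalWeight_of_mem_target hfin hin hT, EReal.coe_lt_coe_iff]
      have h0 := htight [] List.nil_suffix trivial
      have hN0 : 0 ≤ ε * (N []).length := by positivity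
      rw [hroot] at h0
      unfold potential at h0
      linarith
    · by_cases hN : G.NonnegSCC (unfoldState (T.last (G.rootConfig s₀ ν₀) h).1)
      -- A `+∞` leaf would need the potential to have risen by `1` since some entry, but it has
      -- risen by at most `ε * K ≤ 1 / 2`.
      · exfalso
        obtain ⟨h₁, hsuf, he₁, hgap, -⟩ := exists_potential_gap hG hdiv hfin hν₀ hp hleaf hT
        have h0 := htight h₁ hsuf he₁
        have hN0 : 0 ≤ ε * (N h₁).length := by positivity
        linarith [hgap hN]
      · rw [unfolding_finalWeight_of_not_nonneg hT hN]
        exact EReal.bot_lt_coe _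
  · have hw := hfin.wins_of_lt (c := baseConfig (projConfig (T.last (G.rootConfig s₀ ν₀) h)))
      hin.bounded (lt_add_of_pos_right _ hε)
    -- Inside the node, Min imitates a win in `G` with budget `val + ε` at the entry. Induction on
    -- `Wins` excludes endless stays in the kernel, and the node has no target copy at which the
    -- imitated win could end.
    suffices inner : ∀ c b, G.Wins c b → ∀ h' : List T.Move, T.IsPlay (G.rootConfig s₀ ν₀) h' →
        N h' = N h → (∀ h₁, h₁ <:+ h' → IsEntry h₁ → h₁ <:+ h) →
        c = baseConfig (projConfig (T.last (G.rootConfig s₀ ν₀) h')) →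
        b = G.potential s₀ ν₀ h + ε - T.cumWeight (G.rootConfig s₀ ν₀) h' →
        T.Wins (T.last (G.rootConfig s₀ ν₀) h') (a - T.cumWeight (G.rootConfig s₀ ν₀) h') by
      refine inner _ _ hw h hp rfl (fun _ hh _ => hh) rfl ?_
      unfold potential
      ring
    have hnext : ∀ (h' : List T.Move) (m : T.Move), T.IsPlay (G.rootConfig s₀ ν₀) h' →
        N h' = N h → (∀ h₁, h₁ <:+ h' → IsEntry h₁ → h₁ <:+ h) →
        T.Legal (T.last (G.rootConfig s₀ ν₀) h') m →
        G.Wins (baseConfig (projConfig (T.last (G.rootConfig s₀ ν₀) (m :: h'))))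
          (G.potential s₀ ν₀ h + ε - T.cumWeight (G.rootConfig s₀ ν₀) (m :: h')) →
        ((∀ h₁, h₁ <:+ m :: h' → IsEntry h₁ → h₁ <:+ h) → N (m :: h') = N h →
          T.Wins (T.last (G.rootConfig s₀ ν₀) (m :: h'))
            (a - T.cumWeight (G.rootConfig s₀ ν₀) (m :: h'))) →
        T.Wins (T.last (G.rootConfig s₀ ν₀) (m :: h'))
          (a - T.cumWeight (G.rootConfig s₀ ν₀) (m :: h')) := by
      intro h' m hp' hN' hent hl hw' hker
      by_cases hm : unfoldEdge m.2 ∈ G.kernel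
      · refine hker (fun h₁ hh₁ he₁ => ?_) ((hl.unfoldNode_step_of_mem hm).trans hN')
        rcases List.suffix_cons_iff.1 hh₁ with rfl | hh₁
        · exact absurd hm he₁
        · exact hent h₁ hh₁ he₁
      · have hNm : N (m :: h') = unfoldEdge m.2 :: N h :=
          (hl.unfoldNode_step_of_notMem hm).trans (congrArg (unfoldEdge m.2 :: ·) hN')
        have hlen : (N (m :: h')).length = (N h).length + 1 := congrArg List.length hNm
        have hle : (N (m :: h')).length ≤ K := hK _
        have hpm : T.IsPlay (G.rootConfig s₀ ν₀) (m :: h') := ⟨hp', hl⟩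
        refine ih _ (by omega) (m :: h') rfl hpm hm fun h₁ hh₁ he₁ => ?_
        rcases List.suffix_cons_iff.1 hh₁ with rfl | hh₁
        · exact le_rfl
        · have h1 := htight h₁ (hent h₁ hh₁ he₁) he₁
          -- On leaving the node, the remaining budget of the imitated win still bounds the value,
          -- so the potential has increased by at most `ε` since the entry.
          have h2 := hfin.val_le
            (c := baseConfig (projConfig (T.last (G.rootConfig s₀ ν₀) (m :: h')))) (inRegion_last_root hν₀ hpm).bounded hw'
          have h3 : G.potential s₀ ν₀ (m :: h') ≤ G.potential s₀ ν₀ h + ε := by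
            rw [potential]
            linarith!
          rw [hlen]
          push_cast
          linarith
    intro c b hw'
    induction hw' with
    | target ht _ =>
      rintro h' hp' hN' hent rfl rfl
      refine absurd ht (unfoldState_notMem_target hG ?_)
      intro hleaf'
      have hl' : G.IsLeaf s₀ (N h') := hleaf'
      rw [hN'] at hl'
      exact hleaf hl'
    | min m ht hm hl hwm ihw =>
      rintro h' hp' hN' hent rfl rfl
      have hleaf' : (T.last (G.rootConfig s₀ ν₀) h').1 ∉ T.target := fun hleaf' => by
        have hl' : G.IsLeaf s₀ (N h') := hleaf'
        rw [hN'] at hl'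
        exact hleaf hl'
      obtain ⟨m, rfl, hl₁⟩ := Legal.exists_lift hG (inRegion_last_root hν₀ hp') hl
      obtain ⟨m, rfl, hl₂⟩ := Legal.exists_unfold hleaf' hl₁
      have hcum : T.cumWeight (G.rootConfig s₀ ν₀) (m :: h') = T.cumWeight (G.rootConfig s₀ ν₀) h' +
        T.moveWeight (T.last (G.rootConfig s₀ ν₀) h') m := rfl
      have hb : G.potential s₀ ν₀ h + ε - T.cumWeight (G.rootConfig s₀ ν₀) h' -
          T.moveWeight (T.last (G.rootConfig s₀ ν₀) h') m =
          G.potential s₀ ν₀ h + ε - T.cumWeight (G.rootConfig s₀ ν₀) (m :: h') := by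
        rw [hcum]; ring
      have hc : G.step (baseConfig (projConfig (T.last (G.rootConfig s₀ ν₀) h')))
          (baseMove (projMove m)) =
          baseConfig (projConfig (T.last (G.rootConfig s₀ ν₀) (m :: h'))) := by
        rw [last, projConfig_step]
        rfl
      refine .min m hleaf' hm hl₂ ?_
      have := hnext h' m hp' hN' hent hl₂ (by rw [← hc, ← hb]; exact hwm)
        fun hent' hN'' => ihw (m :: h') ⟨hp', hl₂⟩ hN'' hent' hc hb
      rwa [hcum, ← sub_sub] at this
    | max ht hm hl hwm ihw =>
      rintro h' hp' hN' hent rfl rfl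
      have hleaf' : (T.last (G.rootConfig s₀ ν₀) h').1 ∉ T.target := fun hleaf' => by
        have hl' : G.IsLeaf s₀ (N h') := hleaf'
        rw [hN'] at hl'
        exact hleaf hl'
      refine .max hleaf' hm ?_ fun m hl => ?_
      · obtain ⟨m, hl⟩ := hl
        obtain ⟨m, rfl, hl₁⟩ := Legal.exists_lift hG (inRegion_last_root hν₀ hp') hl
        obtain ⟨m, rfl, hl₂⟩ := Legal.exists_unfold hleaf' hl₁
        exact ⟨m, hl₂⟩
      · have hcum : T.cumWeight (G.rootConfig s₀ ν₀) (m :: h') =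
          T.cumWeight (G.rootConfig s₀ ν₀) h' +
          T.moveWeight (T.last (G.rootConfig s₀ ν₀) h') m := rfl
        have hb : G.potential s₀ ν₀ h + ε - T.cumWeight (G.rootConfig s₀ ν₀) h' -
            T.moveWeight (T.last (G.rootConfig s₀ ν₀) h') m =
            G.potential s₀ ν₀ h + ε - T.cumWeight (G.rootConfig s₀ ν₀) (m :: h') := by
          rw [hcum]; ring
        have hc : G.step (baseConfig (projConfig (T.last (G.rootConfig s₀ ν₀) h')))
            (baseMove (projMove m)) =
            baseConfig (projConfig (T.last (G.rootConfig s₀ ν₀) (m :: h'))) := by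
          rw [last, projConfig_step]
          rfl
        have := hnext h' m hp' hN' hent hl
          (by rw [← hc, ← hb]; exact hwm _ hl.proj.base)
          fun hent' hN'' => ihw _ hl.proj.base (m :: h') ⟨hp', hl⟩ hN'' hent' hc hb
        rwa [hcum, ← sub_sub] at this

end Unfolding

end WTG

theorem mainTheorem8 {X : Type u} [Fintype X] [Nonempty X] (G : WTG X) (hG : G.Admissible)
    (hdiv : G.AlmostDivergent)
    (hfin : ∀ (l : G.Loc) (ν : X → ℝ), BoundedVal G.bound ν →
      ¬ G.HasValue (l, ν) ⊤ ∧ ¬ G.HasValue (l, ν) ⊥)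
    (s₀ : G.RegionState) :
    Finite (G.semiUnfolding s₀).Loc ∧ Finite (G.semiUnfolding s₀).Edge ∧
    (∀ n : List G.RegionEdge, G.IsNode s₀ n →
      (n.length : ℝ) ≤ G.numRegionStates * G.unfoldBound) ∧
    ∀ ν₀ ∈ s₀.2.1, ∃ v : ℝ, G.HasValue (s₀.1, ν₀) v ∧
      (G.semiUnfolding s₀).HasValue (G.unfoldRoot s₀, ν₀) v := by
  have := hG.finite_loc
  have := hG.finite_edge
  refine ⟨WTG.finite_unfoldLoc, WTG.finite_unfoldEdge, fun n hn => hn.length_le, fun ν₀ hν₀ => ?_⟩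
  refine ⟨G.val (s₀.1, ν₀), WTG.NoInfiniteValue.hasValue hfin (s₀.2.bounded hν₀), ?_⟩
  exact WTG.hasValue_of_wins (fun a ha => WTG.wins_unfolding hG hdiv hfin hν₀ ha)
    fun a ha => WTG.not_wins_unfolding hG hdiv hfin hν₀ ha
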